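/- **Theorem 7.** Let $q\ge1$ and consider one of the following two kinds of data. (i) *Single series:* a Dirichlet character $\chi_1$ mod $q$ (for $q=1$ this is $\zeta$), with weights $\alpha_{\chi_1}=1$ and $\alpha_\chi=0$ for $\chi\ne\chi_1$; put $\kappa=1$. (ii) *Several series:* two distinct residue classes $a,b$ prime to $q$, with weights $\alpha_\chi=\tfrac12|\chi(a)-\chi(b)|$ for the characters $\chi$ mod $q$; put $\kappa=\varphi(q)/2$. For each $\chi$ let $\gamma$ run over the imaginary parts of the zeros of $L(s,\chi)$ in $0<\Re s<1$, counted with multiplicity. For $u\ge0$ and $k\ge1$ put $$b_k(\chi,u)=\sum_{\gamma>u}\frac1{(1/4+\gamma^2)^k},\quad B_k(u)=\sum_\chi\alpha_\chi^{2k}b_k(\chi,u),\quad R_k(u)=\frac{B_k(u)}{B_1(u)^k},\quad \sigma_u=\sqrt{2B_1(u)}.$$ Let $X_\gamma$ be independent random variables with density $1/(\pi\sqrt{1-x^2})$ on $(-1,1)$, let $P_u$ be the law of $2\sum_\chi\alpha_\chi\sum_{\gamma>u}X_\gamma/\sqrt{1/4+\gamma^2}$ (summed in order of increasing $\gamma$),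 and let $L_u(s)=\log\int e^{sv}\,dP_u(v)$ for real $s$. Let $c_k$ be defined by $\log J_0(w)=-\sum_{k\ge1}c_kw^{2k}/2^k$ near $w=0$, and let $j_1$ be the first positive zero of the Bessel function $J_0$. For a character $\chi$ with $\alpha_\chi\neq0$, of conductor $q^*$, put $y=\log(q^*u/2\pi)$ and, when $u>0$ and $y>-1/3$, $$T_u=j_1\sqrt{\frac{(y+1/3)\,\kappa}{3(y+1)R_2(u)}} .$$ Then, for every $u\ge 0$, the integral defining $L_u(s)$ converges for all real $s$ and $L_u$ is infinitely differentiable on $\mathbb R$. Moreover, for every $\Lambda>0$ and every integer $m\ge0$ there is a constant $C$, depending only on the data in (i) or (ii), on $\Lambda$ and on $m$, such that the following holds for all $u>0$, all $\chi$ with $\alpha_\chi\ne0$ and $y>-1/3$, all $T$ with $0<T\le\Lambda T_u$ (in particular $T=T_u$), all integers $K\ge1$ and all real $s$ such that $t=\sigma_us=\sqrt{2B_1(u)}\,s$ satisfies $|t|<T$: $$\left|\frac{d^m}{ds^m}\Big(L_u(s)-\sum_{k=1}^K(-1)^{k-1}c_kR_k(u)t^{2k}\Big)\right|\le C\left|\frac{d^m}{ds^m}\,\frac{c_KR_K(u)\,t^{2K+2}}{T^2-t^2}\right|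 .$$ The case $m=0$ is $L_u(s)=\sum_{k=1}^K(-1)^{k-1}c_kR_kt^{2k}+O\big(c_KR_Kt^{2K+2}/(T^2-t^2)\big)$; the cases $m\ge1$ say that this expression may be differentiated. -/

import Mathlib

open MeasureTheory Filter Topology
open scoped ContDiff Nat

noncomputable section

namespace PrimeRace

/-- The two kinds of distribution: one governed by a single `L`- or zeta function (prime count,
squares against non-squares, or any individual character), and the race between two residue
classes `a` and `b` modulo `q`. -/
inductive Distribution (q : ℕ) : Type
  | single (χ : DirichletCharacter ℂ q) : Distribution q
  | interResidue (a b : (ZMod q)ˣ) (hab : a ≠ b) : Distribution q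

variable {q : ℕ}

open Classical in
/-- The weight `α_χ`: it is `1` for the only character of a single distribution, and
`|χ(a) - χ(b)| / 2` for a race (this is `0` for the trivial character). -/
def Distribution.weight (D : Distribution q) (χ : DirichletCharacter ℂ q) : ℝ :=
  match D with
  | .single χ₀ => if χ = χ₀ then 1 else 0
  | .interResidue a b _ => ‖χ (a : ZMod q) - χ (b : ZMod q)‖ / 2

/-- The factor by which the formula for `T ^ 2` in the case of several series exceeds the one for
a single series. -/
def Distribution.seriesFactor (D : Distribution q) : ℝ :=
  match D with
  | .single _ => 1
  | .interResidue _ _ _ => (Nat.totient q : ℝ) / 2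

/-- Non-trivial zeros `ρ` of `L(s, χ)` with `Im ρ > u`; a zero of order `n` occurs `n` times, as
`(ρ, 0), …, (ρ, n - 1)`. -/
def TailZero [NeZero q] (χ : DirichletCharacter ℂ q) (u : ℝ) : Type :=
  {p : ℂ × ℕ // 0 < p.1.re ∧ p.1.re < 1 ∧ u < p.1.im ∧ χ.LFunction p.1 = 0 ∧
    p.2 < analyticOrderNatAt χ.LFunction p.1}

/-- The imaginary part `γ` of a zero. -/
def TailZero.ordinate [NeZero q] {χ : DirichletCharacter ℂ q} {u : ℝ} (z : TailZero χ u) : ℝ :=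
  z.1.1.im

/-- `b_k(χ, u) = ∑_{γ > u} (1/4 + γ²)^{-k}`. -/
def b [NeZero q] (k : ℕ) (χ : DirichletCharacter ℂ q) (u : ℝ) : ℝ :=
  ∑' z : TailZero χ u, 1 / (1 / 4 + z.ordinate ^ 2) ^ k

/-- `B_k(u) = ∑_χ α_χ^{2k} b_k(χ, u)`. -/
def B [NeZero q] (D : Distribution q) (k : ℕ) (u : ℝ) : ℝ :=
  ∑ χ : DirichletCharacter ℂ q, D.weight χ ^ (2 * k) * b k χ u

/-- `R_k(u) = B_k(u) / B_1(u)^k`. -/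
def R [NeZero q] (D : Distribution q) (k : ℕ) (u : ℝ) : ℝ :=
  B D k u / B D 1 u ^ k

/-- The standard deviation `σ_u = √(2 B_1(u))`. -/
def sigma [NeZero q] (D : Distribution q) (u : ℝ) : ℝ :=
  √(2 * B D 1 u)

/-- The law with density `1 / (π √(1 - x²))` on `(-1, 1)` and `0` elsewhere. -/
def arcsineLaw : Measure ℝ :=
  volume.withDensity ((Set.Ioo (-1) 1).indicator
    fun x : ℝ => ENNReal.ofReal (1 / (Real.pi * √(1 - x ^ 2))))

instance : IsProbabilityMeasure arcsineLaw := by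
  refine ⟨?_⟩
  have himg : Real.cos '' Set.Ioo 0 Real.pi = Set.Ioo (-1) 1 := by
    ext x
    constructor
    · rintro ⟨θ, ⟨h0, h1⟩, rfl⟩
      have a := Real.cos_lt_cos_of_nonneg_of_le_pi le_rfl h1.le h0
      have b := Real.cos_lt_cos_of_nonneg_of_le_pi h0.le le_rfl h1
      rw [Real.cos_zero] at a
      rw [Real.cos_pi] at b
      exact ⟨b, a⟩
    · rintro ⟨h0, h1⟩
      refine ⟨Real.arccos x, ⟨Real.arccos_pos.2 h1, ?_⟩, Real.cos_arccos h0.le h1.le⟩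
      refine lt_of_le_of_ne (Real.arccos_le_pi x) fun h => ?_
      rw [Real.arccos_eq_pi] at h
      linarith
  rw [arcsineLaw, withDensity_apply _ MeasurableSet.univ, Measure.restrict_univ,
    lintegral_indicator measurableSet_Ioo, ← himg,
    lintegral_image_eq_lintegral_abs_deriv_mul measurableSet_Ioo
      (fun x _ => (Real.hasDerivAt_cos x).hasDerivWithinAt)
      (Real.injOn_cos.mono Set.Ioo_subset_Icc_self)]
  rw [setLIntegral_congr_fun (g := fun _ => ENNReal.ofReal (1 / Real.pi)) measurableSet_Ioo]
  · rw [setLIntegral_const, Real.volume_Ioo, ← ENNReal.ofReal_mul (by positivity)]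
    rw [sub_zero, one_div_mul_cancel Real.pi_ne_zero, ENNReal.ofReal_one]
  · intro θ hθ
    have hs : 0 < Real.sin θ := Real.sin_pos_of_pos_of_lt_pi hθ.1 hθ.2
    have h2 : √(1 - Real.cos θ ^ 2) = Real.sin θ := by
      rw [← Real.sin_sq, Real.sqrt_sq hs.le]
    simp only [h2]
    rw [← ENNReal.ofReal_mul (abs_nonneg _), abs_neg, abs_of_pos hs]
    congr 1
    field_simp

/-- The pairs `(χ, γ)` with `γ > u`. -/
abbrev TailIndex (q : ℕ) [NeZero q] (u : ℝ) : Type :=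
  Σ χ : DirichletCharacter ℂ q, TailZero χ u

/-- The random sum `2 ∑_χ α_χ ∑_{γ > u} X_γ / √(1/4 + γ²)` at a sample point `X`, summed in the
order of increasing `γ`. -/
def tailSum [NeZero q] (D : Distribution q) (u : ℝ) (X : TailIndex q u → ℝ) : ℝ :=
  limUnder atTop fun V : ℝ => ∑ᶠ i ∈ {i : TailIndex q u | i.2.ordinate ≤ V},
    2 * D.weight i.1 * X i / √(1 / 4 + i.2.ordinate ^ 2)

/-- The law (with density `P_u`) of the random sum, the `X_γ` being independent with the
arcsine law. -/
def tailLaw [NeZero q] (D : Distribution q) (u : ℝ) : Measure ℝ :=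
  (Measure.infinitePi fun _ : TailIndex q u => arcsineLaw).map (tailSum D u)

/-- The two-sided Laplace transform `∫ P_u(v) e^{sv} dv`. -/
def tailLaplace [NeZero q] (D : Distribution q) (u s : ℝ) : ℝ :=
  ∫ v, Real.exp (s * v) ∂(tailLaw D u)

/-- `L_u(s)`, the logarithm of the Laplace transform. -/
def L [NeZero q] (D : Distribution q) (u s : ℝ) : ℝ :=
  Real.log (tailLaplace D u s)

/-- The Bessel function `J_0`. -/
def J0 (w : ℝ) : ℝ :=
  ∑' n : ℕ, (-1) ^ n * (w / 2) ^ (2 * n) / (n ! : ℝ) ^ 2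

/-- The first positive zero `j_1` of `J_0`. -/
def j1 : ℝ :=
  sInf {x : ℝ | 0 < x ∧ J0 x = 0}

/-- The coefficients in `log J_0(w) = -∑_{k ≥ 1} c_k w^{2k} / 2^k`, read off from the Taylor
expansion at `0`. -/
def c (k : ℕ) : ℝ :=
  -(2 ^ k * iteratedDeriv (2 * k) (fun w => Real.log (J0 w)) 0 / ((2 * k)! : ℝ))

/-- `y = log (q* u / 2π)`, with `q*` the conductor of `χ`. -/
def y (χ : DirichletCharacter ℂ q) (u : ℝ) : ℝ :=
  Real.log (χ.conductor * u / (2 * Real.pi))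

/-- The explicit formula for `T`, with `y` taken for the character `χ`:
`j_1 √((y + 1/3) / (3 (y + 1) R_2))` for a single series (where `R_2 = r_2`) and
`j_1 √((y + 1/3) φ(q) / (6 (y + 1) R_2))` for several series. -/
def T [NeZero q] (D : Distribution q) (χ : DirichletCharacter ℂ q) (u : ℝ) : ℝ :=
  j1 * √((y χ u + 1 / 3) * D.seriesFactor / (3 * (y χ u + 1) * R D 2 u))

/-- The partial sum `∑_{k = 1}^K (-1)^{k-1} c_k R_k t^{2k}`, with `t = σ_u s`, as a function
of `s`. -/
def mainTerm [NeZero q] (D : Distribution q) (u : ℝ) (K : ℕ) (s : ℝ) : ℝ :=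
  ∑ k ∈ Finset.Icc 1 K, (-1) ^ (k - 1) * c k * R D k u * (sigma D u * s) ^ (2 * k)

/-- The error term `c_K R_K t^{2K+2} / (τ² - t²)`, with `t = σ_u s`, as a function of `s`. -/
def errorTerm [NeZero q] (D : Distribution q) (u τ : ℝ) (K : ℕ) (s : ℝ) : ℝ :=
  c K * R D K u * (sigma D u * s) ^ (2 * K + 2) / (τ ^ 2 - (sigma D u * s) ^ 2)

end PrimeRace

end

/-!
Why the theorem is true. The random variable `2 a X`, with `X` of arcsine law, has the moment
generating function `I_0 (2 a s) = Φ (a ^ 2 s ^ 2)`, where `Φ z = ∑ z ^ n / (n !) ^ 2`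
(`besselSeries`, or `besselReal` on the real line). The random series converges almost surely,
because its partial sums form a martingale bounded in `L¹`, and its exponential moments converge,
because they are bounded in `L²`. So
`L_u(s) = ∑ log Φ (a ^ 2 s ^ 2)` over the zeros of the `L`-functions above `u`, with
`a = α_χ / √(1 / 4 + γ ^ 2)` (`laplace_randomSeries`). The function `Φ` has order `1 / 2` and its
zeros `-1 / w` are real and negative, hence `log Φ x = ∑ log (1 + w x)`
(`hasSum_log_besselReal`), and altogether `L_u(s) = ∑ log (1 + l s ^ 2)` with the summable family
`l = a ^ 2 w` (`L_eq_logSeries`). Comparing Taylor coefficients, `c_k` is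
`∑ w ^ k / (2 ^ k k)` (`c_eq_tsum`), so that `c_k R_k σ ^ (2 k)` is `∑ l ^ k / k`. The main term is
therefore the sum of the Taylor polynomials of the terms `log (1 + l s ^ 2)`, and the error term is
a sum of the same shape with `l ^ K / K` in front of `s ^ (2 K + 2) / (τ ^ 2 - s ^ 2)`,
`τ = T / σ`. It is enough to compare one remainder `log (1 + l s ^ 2) - ∑ …` and its derivatives
with this function, uniformly for bounded `l τ ^ 2`
(`exists_iteratedDeriv_logRem_le_errorModel`). After scaling to `τ = 1`, the derivative of the
remainder is a monomial times `1 / (1 + θ x ^ 2)`, and all terms of the Leibniz expansion of the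
derivatives of `x ^ (2 K + 2) / (1 - x ^ 2)` are nonnegative on `[0, 1)`, so that one of them is a
lower bound. Only the parity of the order of differentiation needs care near `x = 0`.

That `l τ ^ 2` is bounded for `T ≤ Λ T_u` amounts to `B_1 ≪ (1 / 4 + u ^ 2) B_2`: the zeros with
`γ` of the size of `u` carry a positive proportion of `B_1` (`exists_mul_b_one_le`). This follows
from bounds of the right order for the number of zeros, without the counting formula. If `F` is the
completed `L`-function of the primitive character, the reflection `F (1 - conj s) = ε conj (F s)` and
the partial fractions of `F' / F (s) - F' / F (1 - conj s)`, which need no convergence factors, give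
`2 Re (F' / F) (s)` as a sum of Poisson kernels over the zeros (`IsCompletion.hasSum_zeroKernel`).
The mean value theorem on `[s, s + 2]`, where `F (s + 2) / F s` is explicit up to bounded factors,
evaluates this as `log |s| + O(1)`, uniformly in `Re s ≥ 2` (`IsCompletion.poisson_bounds`). The
point `s = u` bounds `b_1(χ, u)` from above, and the comparison of the points `ε u + 3 i u / 2` and
`u + 3 i u / 2` yields many zeros between `u` and `2 u`.
-/

namespace PrimeRace

/-! ### Zeros of entire functions of small order -/

/-- The zeros of `f`, a zero of order `n` occurring `n` times, as `(ρ, 0), …, (ρ, n - 1)`. -/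
def ZeroIndex (f : ℂ → ℂ) : Type :=
  {p : ℂ × ℕ // f p.1 = 0 ∧ p.2 < analyticOrderNatAt f p.1}

/-- The zero `ρ` underlying an index. -/
def ZeroIndex.val {f : ℂ → ℂ} (p : ZeroIndex f) : ℂ := p.1.1

lemma ZeroIndex.apply_val {f : ℂ → ℂ} (p : ZeroIndex f) : f p.val = 0 := p.2.1

lemma analyticOrderAt_ne_top_of_entire {f : ℂ → ℂ} (hf : Differentiable ℂ f) {w : ℂ} (hw : f w ≠ 0)
    (z : ℂ) : analyticOrderAt f z ≠ ⊤ := by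
  have hA : AnalyticOnNhd ℂ f Set.univ := fun x _ => hf.analyticAt x
  refine hA.analyticOrderAt_ne_top_of_isPreconnected isPreconnected_univ (x := w)
    (Set.mem_univ _) (Set.mem_univ _) ?_
  rw [(hf.analyticAt w).analyticOrderAt_eq_zero.2 hw]
  simp

lemma finite_zeros_of_entire {f : ℂ → ℂ} (hf : Differentiable ℂ f) {w : ℂ} (hw : f w ≠ 0) (R : ℝ) :
    {z : ℂ | f z = 0 ∧ ‖z‖ ≤ R}.Finite := by
  have hA : AnalyticOnNhd ℂ f Set.univ := fun x _ => hf.analyticAt x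
  have h := hA.preimage_zero_mem_codiscrete hw
  rw [mem_codiscrete', Set.preimage_compl, compl_compl] at h
  have : ((Metric.closedBall (0 : ℂ) R) ∩ f ⁻¹' {0}).Finite := by
    refine ((isCompact_closedBall 0 R).inter_right ?_).finite ?_
    · exact isClosed_singleton.preimage hf.continuous
    · exact h.2.mono Set.inter_subset_right
  refine this.subset fun z hz => ⟨by simpa using hz.2, hz.1⟩

/-- A zero of an entire function can be divided out. -/
lemma exists_eq_pow_mul_of_entire {f : ℂ → ℂ} (hf : Differentiable ℂ f) {w : ℂ} (hw : f w ≠ 0)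
    (c : ℂ) : ∃ g : ℂ → ℂ, Differentiable ℂ g ∧ g c ≠ 0 ∧
      ∀ z, f z = (z - c) ^ analyticOrderNatAt f c * g z := by
  obtain ⟨g₀, hg₀, hg₀c, hev⟩ := ((hf.analyticAt c).analyticOrderNatAt_eq_iff
    (analyticOrderAt_ne_top_of_entire hf hw c)).1 rfl
  set n := analyticOrderNatAt f c
  let g : ℂ → ℂ := Function.update (fun z => f z / (z - c) ^ n) c (g₀ c)
  have hoff : ∀ z, z ≠ c → g z = f z / (z - c) ^ n := fun z hz => Function.update_of_ne hz _ _
  have hself : g c = g₀ c := Function.update_self _ _ _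
  have hgc : g =ᶠ[𝓝 c] g₀ := by
    filter_upwards [hev] with z hz
    by_cases h : z = c
    · rw [h, hself]
    · rw [hoff z h, hz, smul_eq_mul, mul_div_cancel_left₀ _ (pow_ne_zero _ (sub_ne_zero.2 h))]
  refine ⟨g, fun z => ?_, by rwa [hself], fun z => ?_⟩
  · by_cases h : z = c
    · rw [h]; exact (hgc.differentiableAt_iff).2 hg₀.differentiableAt
    · have : g =ᶠ[𝓝 z] fun z => f z / (z - c) ^ n := by
        filter_upwards [isOpen_ne.mem_nhds h] with x hx using hoff x hx
      refine this.differentiableAt_iff.2 ((hf z).div (by fun_prop) ?_)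
      exact pow_ne_zero _ (sub_ne_zero.2 h)
  · by_cases h : z = c
    · have := hev.self_of_nhds
      rw [h, hself, this, smul_eq_mul]
    · rw [hoff z h, mul_div_cancel₀ _ (pow_ne_zero _ (sub_ne_zero.2 h))]

/-- An entire function is a polynomial with the given zeros times an entire function that does not
vanish there. -/
lemma exists_eq_prod_mul_of_entire {f : ℂ → ℂ} (hf : Differentiable ℂ f) {w : ℂ} (hw : f w ≠ 0)
    (S : Finset ℂ) : ∃ g : ℂ → ℂ, Differentiable ℂ g ∧ (∀ c ∈ S, g c ≠ 0) ∧
      ∀ z, f z = (∏ c ∈ S, (z - c) ^ analyticOrderNatAt f c) * g z := by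
  induction S using Finset.induction_on with
  | empty => exact ⟨f, hf, by simp, by simp⟩
  | insert c S hc ih =>
    obtain ⟨g, hg, hgS, hfg⟩ := ih
    have hgw : g w ≠ 0 := fun h => hw (by rw [hfg, h, mul_zero])
    obtain ⟨h, hh, hhc, hgh⟩ := exists_eq_pow_mul_of_entire hg hgw c
    have hord : analyticOrderNatAt f c = analyticOrderNatAt g c := by
      have hP : AnalyticAt ℂ (fun z => ∏ c ∈ S, (z - c) ^ analyticOrderNatAt f c) c := by
        fun_prop
      have hP0 : (∏ c' ∈ S, (c - c') ^ analyticOrderNatAt f c') ≠ 0 :=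
        Finset.prod_ne_zero_iff.2 fun c' hc' => pow_ne_zero _
          (sub_ne_zero.2 fun h => hc (h ▸ hc'))
      have : analyticOrderAt f c = analyticOrderAt g c := by
        have hfun : f = (fun z => ∏ c ∈ S, (z - c) ^ analyticOrderNatAt f c) * g := by
          ext z; exact hfg z
        conv_lhs => rw [hfun]
        rw [analyticOrderAt_mul hP (hg.analyticAt c), hP.analyticOrderAt_eq_zero.2 hP0, zero_add]
      simp [analyticOrderNatAt, this]
    refine ⟨h, hh, ?_, fun z => ?_⟩
    · intro c' hc'
      rcases Finset.mem_insert.1 hc' with rfl | hc'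
      · exact hhc
      · intro h0
        exact hgS c' hc' (by rw [hgh, h0, mul_zero])
    · rw [Finset.prod_insert hc, hfg z, hgh z, hord]
      ring

/-- A nowhere vanishing holomorphic function on a disc about `w` whose modulus is at most
`exp M` times its value at `w` has a small logarithmic derivative near `w`, with a small
variation (Borel–Carathéodory and Cauchy). -/
lemma logDeriv_bounds_of_ne_zero {g : ℂ → ℂ} {w z : ℂ} {R M : ℝ} (hR : 0 < R) (hM : 0 < M)
    (hg : Differentiable ℂ g) (h0 : ∀ x ∈ Metric.ball w (R / 2), g x ≠ 0)
    (hb : ∀ x ∈ Metric.ball w (R / 2), ‖g x‖ ≤ ‖g w‖ * Real.exp M) (hz : ‖z - w‖ ≤ R / 16) :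
    ‖logDeriv g z‖ ≤ 16 * M / R ∧
      ‖logDeriv g z - logDeriv g w‖ ≤ 256 * M / R ^ 2 * ‖z - w‖ := by
  have hdl : DifferentiableOn ℂ (logDeriv g) (Metric.ball w (R / 2)) := by
    intro x hx
    have : DifferentiableAt ℂ (deriv g) x := (hg.analyticAt x).deriv.differentiableAt
    exact (this.div (hg x) (h0 x hx)).differentiableWithinAt
  obtain ⟨G, hGw, hG⟩ := hdl.isExactOn_ball.with_val_at w 0
  have hwmem : w ∈ Metric.ball w (R / 2) := Metric.mem_ball_self (by positivity)
  have hexp : ∀ x ∈ Metric.ball w (R / 2), g x = g w * Complex.exp (G x) := by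
    have hder : ∀ x ∈ Metric.ball w (R / 2),
        HasDerivAt (fun x => g x * Complex.exp (-G x)) 0 x := by
      intro x hx
      have h1 := ((hg x).hasDerivAt).mul (hG x hx).neg.cexp
      refine h1.congr_deriv ?_
      have := h0 x hx
      simp only [logDeriv_apply, Pi.neg_apply]
      field_simp
      ring
    intro x hx
    have hconst := (convex_ball w (R / 2)).is_const_of_fderivWithin_eq_zero (𝕜 := ℂ)
      (f := fun x => g x * Complex.exp (-G x))
      (fun y hy => (hder y hy).differentiableAt.differentiableWithinAt)
      (fun y hy => by
        rw [fderivWithin_of_isOpen Metric.isOpen_ball hy]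
        ext
        simpa using (hder y hy).deriv) hx hwmem
    simp only [hGw, neg_zero, Complex.exp_zero, mul_one] at hconst
    rw [← hconst, mul_assoc, ← Complex.exp_add]
    simp
  have hGre : ∀ x ∈ Metric.ball w (R / 2), (G x).re ≤ M := by
    intro x hx
    have h1 := hb x hx
    rw [hexp x hx, norm_mul, Complex.norm_exp] at h1
    have h2 : 0 < ‖g w‖ := norm_pos_iff.2 (h0 w hwmem)
    exact Real.exp_le_exp.1 (le_of_mul_le_mul_left h1 h2)
  have hGn : ∀ x ∈ Metric.closedBall w (R / 4), ‖G x‖ ≤ 2 * M := by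
    intro x hx
    have hx' : ‖x - w‖ ≤ R / 4 := by simpa [dist_eq_norm] using hx
    have h := Complex.borelCaratheodory_zero (f := fun y => G (w + y)) (R := R / 2) (z := x - w) hM
      ?_ ?_ (by positivity) ?_ (by simpa using hGw)
    · simp only [add_sub_cancel] at h
      refine h.trans ?_
      rw [div_le_iff₀ (by linarith)]
      nlinarith
    · intro y hy
      have hy' : w + y ∈ Metric.ball w (R / 2) := by simpa [dist_eq_norm] using hy
      exact ((hG _ hy').differentiableAt.comp y (by fun_prop)).differentiableWithinAt
    · intro y hy
      have hy' : w + y ∈ Metric.ball w (R / 2) := by simpa [dist_eq_norm] using hy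
      exact hGre _ hy'
    · simp only [Metric.mem_ball, dist_zero_right]; linarith
  have hL : ∀ x ∈ Metric.closedBall w (R / 8), ‖logDeriv g x‖ ≤ 16 * M / R := by
    intro x hx
    have hx' : dist x w ≤ R / 8 := hx
    have hsub : Metric.closedBall x (R / 8) ⊆ Metric.closedBall w (R / 4) := fun y hy => by
      have : dist y x ≤ R / 8 := hy
      have := dist_triangle y x w
      simp only [Metric.mem_closedBall]; linarith
    have hsub2 : Metric.closedBall w (R / 4) ⊆ Metric.ball w (R / 2) :=
      Metric.closedBall_subset_ball (by linarith)
    have h := Complex.norm_deriv_le_of_forall_mem_sphere_norm_le (f := G) (c := x) (R := R / 8)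
      (C := 2 * M) (by positivity) ?_ (fun y hy => hGn y (hsub (Metric.sphere_subset_closedBall hy)))
    · rw [(hG x (hsub2 (hsub (Metric.mem_closedBall_self (by positivity))))).deriv] at h
      refine h.trans (le_of_eq ?_)
      field_simp; norm_num
    · refine DifferentiableOn.diffContOnCl_ball (U := Metric.ball w (R / 2)) ?_ (hsub.trans hsub2)
      exact fun y hy => (hG y hy).differentiableAt.differentiableWithinAt
  have hzmem : z ∈ Metric.closedBall w (R / 16) := by simpa [dist_eq_norm] using hz
  refine ⟨hL z (Metric.closedBall_subset_closedBall (by linarith) hzmem), ?_⟩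
  have hL' : ∀ x ∈ Metric.closedBall w (R / 16), ‖deriv (logDeriv g) x‖ ≤ 256 * M / R ^ 2 := by
    intro x hx
    have hx' : dist x w ≤ R / 16 := hx
    have hsub : Metric.closedBall x (R / 16) ⊆ Metric.closedBall w (R / 8) := fun y hy => by
      have : dist y x ≤ R / 16 := hy
      have := dist_triangle y x w
      simp only [Metric.mem_closedBall]; linarith
    have hsub2 : Metric.closedBall w (R / 8) ⊆ Metric.ball w (R / 2) :=
      Metric.closedBall_subset_ball (by linarith)
    have h := Complex.norm_deriv_le_of_forall_mem_sphere_norm_le (f := logDeriv g) (c := x)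
      (R := R / 16) (C := 16 * M / R) (by positivity) ?_
      (fun y hy => hL y (hsub (Metric.sphere_subset_closedBall hy)))
    · refine h.trans (le_of_eq ?_)
      field_simp; norm_num
    · exact hdl.diffContOnCl_ball (hsub.trans hsub2)
  refine Convex.norm_image_sub_le_of_norm_deriv_le (s := Metric.closedBall w (R / 16))
    (fun x hx => ?_) hL' (convex_closedBall _ _) (Metric.mem_closedBall_self (by positivity)) hzmem
  exact hdl.differentiableAt (Metric.isOpen_ball.mem_nhds
    (Metric.closedBall_subset_ball (by linarith) hx))

/-- Near `w`, the logarithmic derivative of an entire function is given by its zeros of modulus at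
most `R`, up to an error controlled by the size of the function on the circle of radius `4 * R`. -/
lemma logDeriv_sub_sum_bounds {f : ℂ → ℂ} (hf : Differentiable ℂ f) {w z : ℂ} (hw : f w ≠ 0)
    (hz : f z ≠ 0) {R M : ℝ} (hR : 0 < R) (hM : 0 < M) (hwR : ‖w‖ ≤ R / 2) (hzw : ‖z - w‖ ≤ R / 16)
    (hb : ∀ x, ‖x‖ = 4 * R → ‖f x‖ ≤ ‖f w‖ * Real.exp M) (S : Finset ℂ)
    (hS : ∀ x, x ∈ S ↔ f x = 0 ∧ ‖x‖ ≤ R) :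
    ‖logDeriv f z - ∑ c ∈ S, analyticOrderNatAt f c * (1 / (z - c))‖ ≤ 16 * M / R ∧
    ‖(logDeriv f z - logDeriv f w) -
      ∑ c ∈ S, analyticOrderNatAt f c * (1 / (z - c) - 1 / (w - c))‖ ≤
        256 * M / R ^ 2 * ‖z - w‖ := by
  obtain ⟨g, hg, hgS, hfg⟩ := exists_eq_prod_mul_of_entire hf hw S
  set P : ℂ → ℂ := fun z => ∏ c ∈ S, (z - c) ^ analyticOrderNatAt f c with hP
  have hg0 : ∀ x, ‖x‖ ≤ R → g x ≠ 0 := by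
    intro x hx h
    exact hgS x ((hS x).2 ⟨by rw [hfg, h, mul_zero], hx⟩) h
  have hlog : ∀ x, f x ≠ 0 → logDeriv f x =
      (∑ c ∈ S, analyticOrderNatAt f c * (1 / (x - c))) + logDeriv g x := by
    intro x hx
    have hgx : g x ≠ 0 := fun h => hx (by rw [hfg, h, mul_zero])
    have hxc : ∀ c ∈ S, x - c ≠ 0 := fun c hc h => by
      rw [sub_eq_zero.1 h] at hx
      exact hx ((hS c).1 hc).1
    have hPx : P x ≠ 0 := Finset.prod_ne_zero_iff.2 fun c hc => pow_ne_zero _ (hxc c hc)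
    have hfun : f = fun x => P x * g x := by ext x; exact hfg x
    have hPd : DifferentiableAt ℂ P x := by simp only [hP]; fun_prop
    conv_lhs => rw [hfun]
    rw [logDeriv_mul x hPx hgx hPd (hg x)]
    congr 1
    simp only [hP]
    rw [logDeriv_prod (f := fun c x => (x - c) ^ analyticOrderNatAt f c)
      (fun c hc => pow_ne_zero _ (hxc c hc)) (fun c hc => by fun_prop)]
    refine Finset.sum_congr rfl fun c hc => ?_
    rw [logDeriv_fun_pow (by fun_prop)]
    congr 1
    rw [logDeriv_apply]
    simp
  have hPw : P w ≠ 0 := fun h => hw (by rw [hfg]; exact mul_eq_zero_of_left h _)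
  have hgb : ∀ x, ‖x‖ = 4 * R → ‖g x‖ ≤ ‖g w‖ * Real.exp M := by
    intro x hx
    -- each factor of `P` is larger at `x`, which lies far outside the zeros
    have h1 : ‖P w‖ ≤ ‖P x‖ := by
      simp only [hP, norm_prod, norm_pow]
      refine Finset.prod_le_prod (fun _ _ => by positivity) fun c hc => ?_
      have hc' := ((hS c).1 hc).2
      refine pow_le_pow_left₀ (norm_nonneg _) ?_ _
      have h2 := norm_sub_le w c
      have h3 := norm_sub_norm_le x c
      linarith
    have h2 := hb x hx
    rw [hfg x, hfg w, norm_mul, norm_mul] at h2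
    have h3 : 0 < ‖P w‖ := norm_pos_iff.2 hPw
    have h4 : ‖P w‖ * ‖g x‖ ≤ ‖P w‖ * (‖g w‖ * Real.exp M) := by
      refine (mul_le_mul_of_nonneg_right h1 (norm_nonneg _)).trans (h2.trans ?_)
      rw [mul_assoc]
    exact le_of_mul_le_mul_left h4 h3
  have hgb' : ∀ x, ‖x‖ ≤ 4 * R → ‖g x‖ ≤ ‖g w‖ * Real.exp M := by
    intro x hx
    refine Complex.norm_le_of_forall_mem_frontier_norm_le (U := Metric.ball (0 : ℂ) (4 * R))
      Metric.isBounded_ball hg.diffContOnCl (fun y hy => hgb y ?_) ?_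
    · rw [frontier_ball _ (by positivity)] at hy
      simpa using hy
    · rw [closure_ball _ (by positivity)]
      simpa using hx
  have hball : ∀ x ∈ Metric.ball w (R / 2), ‖x‖ ≤ R := by
    intro x hx
    have h1 : ‖x - w‖ < R / 2 := by simpa [dist_eq_norm] using hx
    have h2 := norm_sub_norm_le x w
    linarith
  obtain ⟨h1, h2⟩ := logDeriv_bounds_of_ne_zero hR hM hg (fun x hx => hg0 x (hball x hx))
    (fun x hx => hgb' x ((hball x hx).trans (by linarith))) hzw
  constructor
  · rwa [hlog z hz, add_sub_cancel_left]
  · rw [hlog z hz, hlog w hw]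
    simp only [mul_sub, Finset.sum_sub_distrib]
    convert h2 using 2
    ring

/-- The entire function `f` is `O(exp (C (1 + |z|) ^ p))`, i.e. it has order at most `p` and finite
type. -/
def HasGrowth (f : ℂ → ℂ) (p : ℝ) : Prop :=
  ∃ C : ℝ, ∀ z, ‖f z‖ ≤ Real.exp (C * (1 + ‖z‖) ^ p)

/-- The zeros of modulus at most `R`, without multiplicity. -/
noncomputable def zerosIn {f : ℂ → ℂ} (hf : Differentiable ℂ f) {w : ℂ} (hw : f w ≠ 0) (R : ℝ) :
    Finset ℂ := (finite_zeros_of_entire hf hw R).toFinset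

/-- For nonnegative terms, a limit of sums over zeros of modulus at most `R` is an unconditional sum
over the zeros with multiplicity. -/
lemma hasSum_zeros_of_tendsto {f : ℂ → ℂ} (hf : Differentiable ℂ f) {w : ℂ} (hw : f w ≠ 0)
    {ψ : ℂ → ℝ} (hψ : ∀ c, f c = 0 → 0 ≤ ψ c) {a : ℝ}
    (h : Tendsto (fun R => ∑ c ∈ zerosIn hf hw R, analyticOrderNatAt f c * ψ c) atTop (𝓝 a)) :
    HasSum (fun p : ZeroIndex f => ψ p.val) a := by
  classical
  have hmem : ∀ R x, x ∈ zerosIn hf hw R ↔ f x = 0 ∧ ‖x‖ ≤ R := fun R x => by simp [zerosIn]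
  have hfin : ∀ R, {p : ZeroIndex f | ‖p.val‖ ≤ R}.Finite := by
    intro R
    let B := (zerosIn hf hw R).sigma fun c => Finset.range (analyticOrderNatAt f c)
    refine Set.Finite.of_injOn (f := fun p : ZeroIndex f => (⟨p.1.1, p.1.2⟩ : Σ _ : ℂ, ℕ))
      (t := (B : Set (Σ _ : ℂ, ℕ))) ?_ ?_ B.finite_toSet
    · intro p hp
      simp only [B, Finset.coe_sigma, Set.mem_sigma_iff, Finset.mem_coe, Finset.mem_range, hmem]
      exact ⟨⟨p.2.1, hp⟩, p.2.2⟩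
    · intro p _ p' _ hpp
      simp only [Sigma.mk.injEq, heq_eq_eq] at hpp
      exact Subtype.ext (Prod.ext hpp.1 hpp.2)
  let T : ℝ → Finset (ZeroIndex f) := fun R => (hfin R).toFinset
  have hT : ∀ R p, p ∈ T R ↔ ‖p.val‖ ≤ R := fun R p => by simp [T]
  have hsum : ∀ R, ∑ p ∈ T R, ψ p.val =
      ∑ c ∈ zerosIn hf hw R, analyticOrderNatAt f c * ψ c := by
    intro R
    have h1 : ∀ c, (analyticOrderNatAt f c : ℝ) * ψ c =
        ∑ _j ∈ Finset.range (analyticOrderNatAt f c), ψ c := by simp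
    rw [Finset.sum_congr rfl (fun c _ => h1 c), Finset.sum_sigma']
    refine Finset.sum_bij (fun p _ => (⟨p.1.1, p.1.2⟩ : Σ _ : ℂ, ℕ)) ?_ ?_ ?_ ?_
    · intro p hp
      simp only [Finset.mem_sigma, Finset.mem_range, hmem]
      exact ⟨⟨p.2.1, (hT R p).1 hp⟩, p.2.2⟩
    · intro p _ p' _ hpp
      simp only [Sigma.mk.injEq, heq_eq_eq] at hpp
      exact Subtype.ext (Prod.ext hpp.1 hpp.2)
    · rintro ⟨c, j⟩ hcj
      simp only [Finset.mem_sigma, Finset.mem_range, hmem] at hcj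
      exact ⟨⟨(c, j), hcj.1.1, hcj.2⟩, (hT R _).2 hcj.1.2, rfl⟩
    · intro p _; rfl
  have hmono : Monotone T := fun R R' hRR p hp => (hT R' p).2 (((hT R p).1 hp).trans hRR)
  have htend : Tendsto T atTop atTop := by
    refine tendsto_atTop_finset_of_monotone hmono fun p => ⟨‖p.val‖, (hT _ p).2 le_rfl⟩
  have h' : Tendsto (fun R => ∑ p ∈ T R, ψ p.val) atTop (𝓝 a) := by
    simpa only [hsum] using h
  have hnn : ∀ p : ZeroIndex f, 0 ≤ ψ p.val := fun p => hψ _ p.2.1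
  have hmono' : Monotone fun R => ∑ p ∈ T R, ψ p.val := fun R R' hRR =>
    Finset.sum_le_sum_of_subset_of_nonneg (hmono hRR) fun p _ _ => hnn p
  have hsummable : Summable fun p : ZeroIndex f => ψ p.val := by
    refine summable_of_sum_le hnn (c := a) fun u => ?_
    obtain ⟨R, hR⟩ := (htend.eventually_ge_atTop u).exists
    exact (Finset.sum_le_sum_of_subset_of_nonneg hR fun p _ _ => hnn p).trans
      (hmono'.ge_of_tendsto h' R)
  have := tendsto_nhds_unique (hsummable.hasSum.comp htend) h'
  rw [← this]
  exact hsummable.hasSum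

lemma exists_bound_of_hasGrowth {f : ℂ → ℂ} {p : ℝ} (hp : 0 ≤ p) (hg : HasGrowth f p) {w : ℂ}
    (hw : f w ≠ 0) : ∃ C : ℝ, 0 < C ∧ ∀ R : ℝ, 1 ≤ R → ∀ x, ‖x‖ = 4 * R →
      ‖f x‖ ≤ ‖f w‖ * Real.exp (C * R ^ p) := by
  obtain ⟨C, hC⟩ := hg
  refine ⟨|C| * 5 ^ p + |Real.log ‖f w‖| + 1, by positivity, fun R hR x hx => ?_⟩
  have hw' : 0 < ‖f w‖ := norm_pos_iff.2 hw
  have hRp : 1 ≤ R ^ p := Real.one_le_rpow hR hp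
  have h1 : (1 + ‖x‖) ^ p ≤ 5 ^ p * R ^ p := by
    rw [← Real.mul_rpow (by norm_num) (by linarith)]
    exact Real.rpow_le_rpow (by positivity) (by rw [hx]; linarith) hp
  calc ‖f x‖ ≤ Real.exp (C * (1 + ‖x‖) ^ p) := hC x
    _ ≤ Real.exp (Real.log ‖f w‖ + (|C| * 5 ^ p + |Real.log ‖f w‖| + 1) * R ^ p) := by
      refine Real.exp_le_exp.2 ?_
      have h2 : C * (1 + ‖x‖) ^ p ≤ |C| * (5 ^ p * R ^ p) :=
        (mul_le_mul_of_nonneg_right (le_abs_self C) (by positivity)).trans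
          (mul_le_mul_of_nonneg_left h1 (abs_nonneg _))
      have h3 := neg_abs_le (Real.log ‖f w‖)
      have h4 : |Real.log ‖f w‖| ≤ |Real.log ‖f w‖| * R ^ p :=
        le_mul_of_one_le_right (abs_nonneg _) hRp
      nlinarith
    _ = _ := by rw [Real.exp_add, Real.exp_log hw']

/-- The partial fraction expansion of `f' / f` for an entire function of order less than `2`, in the
form that avoids convergence factors: the difference between two points. -/
lemma tendsto_sum_logDeriv_sub {f : ℂ → ℂ} (hf : Differentiable ℂ f) {p : ℝ} (hp : 0 ≤ p)
    (hp2 : p < 2) (hg : HasGrowth f p) {w z : ℂ} (hw : f w ≠ 0) (hz : f z ≠ 0) :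
    Tendsto (fun R => ∑ c ∈ zerosIn hf hw R, analyticOrderNatAt f c * (1 / (z - c) - 1 / (w - c)))
      atTop (𝓝 (logDeriv f z - logDeriv f w)) := by
  obtain ⟨C, hC0, hC⟩ := exists_bound_of_hasGrowth hp hg hw
  rw [tendsto_iff_norm_sub_tendsto_zero]
  have hlim : Tendsto (fun R : ℝ => 256 * C * ‖z - w‖ * R ^ (-(2 - p))) atTop (𝓝 0) := by
    simpa using (tendsto_rpow_neg_atTop (by linarith : 0 < 2 - p)).const_mul (256 * C * ‖z - w‖)
  refine squeeze_zero' (Eventually.of_forall fun R => norm_nonneg _) ?_ hlim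
  filter_upwards [eventually_ge_atTop 1, eventually_ge_atTop (2 * ‖w‖),
    eventually_ge_atTop (16 * ‖z - w‖)] with R h1 h2 h3
  have hR : 0 < R := by linarith
  have h := (logDeriv_sub_sum_bounds hf hw hz hR (M := C * R ^ p) (by positivity) (by linarith)
    (by linarith) (hC R h1) (zerosIn hf hw R) (fun x => by simp [zerosIn])).2
  rw [norm_sub_rev]
  refine h.trans (le_of_eq ?_)
  have : R ^ (-(2 - p)) = R ^ p / R ^ 2 := by
    rw [neg_sub, Real.rpow_sub hR]; norm_cast
  rw [this]; ring

/-- The partial fraction expansion of `f' / f` for an entire function of order less than `1`. -/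
lemma tendsto_sum_logDeriv {f : ℂ → ℂ} (hf : Differentiable ℂ f) {p : ℝ} (hp : 0 ≤ p)
    (hp1 : p < 1) (hg : HasGrowth f p) {z : ℂ} (hz : f z ≠ 0) :
    Tendsto (fun R => ∑ c ∈ zerosIn hf hz R, analyticOrderNatAt f c * (1 / (z - c)))
      atTop (𝓝 (logDeriv f z)) := by
  obtain ⟨C, hC0, hC⟩ := exists_bound_of_hasGrowth hp hg hz
  rw [tendsto_iff_norm_sub_tendsto_zero]
  have hlim : Tendsto (fun R : ℝ => 16 * C * R ^ (-(1 - p))) atTop (𝓝 0) := by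
    simpa using (tendsto_rpow_neg_atTop (by linarith : 0 < 1 - p)).const_mul (16 * C)
  refine squeeze_zero' (Eventually.of_forall fun R => norm_nonneg _) ?_ hlim
  filter_upwards [eventually_ge_atTop 1, eventually_ge_atTop (2 * ‖z‖)] with R h1 h2
  have hR : 0 < R := by linarith
  have h := (logDeriv_sub_sum_bounds hf hz hz hR (M := C * R ^ p) (by positivity) (by linarith)
    (by simp; positivity) (hC R h1) (zerosIn hf hz R) (fun x => by simp [zerosIn])).1
  rw [norm_sub_rev]
  refine h.trans (le_of_eq ?_)
  have : R ^ (-(1 - p)) = R ^ p / R := by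
    rw [neg_sub, Real.rpow_sub hR, Real.rpow_one]
  rw [this]; ring

/-! ### Growth of the completed Hurwitz zeta functions -/

lemma HasGrowth.exists_nonneg {f : ℂ → ℂ} {p : ℝ} (h : HasGrowth f p) :
    ∃ C : ℝ, 0 ≤ C ∧ ∀ z, ‖f z‖ ≤ Real.exp (C * (1 + ‖z‖) ^ p) := by
  obtain ⟨C, hC⟩ := h
  refine ⟨max C 0, le_max_right _ _, fun z => (hC z).trans (Real.exp_le_exp.2 ?_)⟩
  exact mul_le_mul_of_nonneg_right (le_max_left _ _) (by positivity)

lemma HasGrowth.mul {f g : ℂ → ℂ} {p : ℝ} (hf : HasGrowth f p) (hg : HasGrowth g p) :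
    HasGrowth (fun z => f z * g z) p := by
  obtain ⟨C, hC⟩ := hf
  obtain ⟨D, hD⟩ := hg
  refine ⟨C + D, fun z => ?_⟩
  rw [norm_mul, add_mul, Real.exp_add]
  exact mul_le_mul (hC z) (hD z) (norm_nonneg _) (Real.exp_nonneg _)

lemma HasGrowth.add {f g : ℂ → ℂ} {p : ℝ} (hp : 0 ≤ p) (hf : HasGrowth f p)
    (hg : HasGrowth g p) : HasGrowth (fun z => f z + g z) p := by
  obtain ⟨C, hC0, hC⟩ := hf.exists_nonneg
  obtain ⟨D, hD0, hD⟩ := hg.exists_nonneg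
  refine ⟨C + D + 1, fun z => (norm_add_le _ _).trans ?_⟩
  have h1 : 1 ≤ (1 + ‖z‖) ^ p := Real.one_le_rpow (by linarith [norm_nonneg z]) hp
  set x := (1 + ‖z‖) ^ p
  have h2 : ‖f z‖ ≤ Real.exp ((C + D) * x) :=
    (hC z).trans (Real.exp_le_exp.2 (by nlinarith))
  have h3 : ‖g z‖ ≤ Real.exp ((C + D) * x) :=
    (hD z).trans (Real.exp_le_exp.2 (by nlinarith))
  have h4 : 2 ≤ Real.exp x := by linarith [Real.add_one_le_exp x]
  have h5 : Real.exp ((C + D + 1) * x) = Real.exp ((C + D) * x) * Real.exp x := by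
    rw [← Real.exp_add]; ring_nf
  rw [h5]
  nlinarith [Real.exp_pos ((C + D) * x)]

lemma hasGrowth_const (c : ℂ) {p : ℝ} (hp : 0 ≤ p) : HasGrowth (fun _ => c) p := by
  refine ⟨‖c‖, fun z => ?_⟩
  have h1 : 1 ≤ (1 + ‖z‖) ^ p := Real.one_le_rpow (by linarith [norm_nonneg z]) hp
  have := Real.add_one_le_exp (‖c‖ * (1 + ‖z‖) ^ p)
  nlinarith [norm_nonneg c]

lemma hasGrowth_id {p : ℝ} (hp : 1 ≤ p) : HasGrowth (fun z => z) p := by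
  refine ⟨1, fun z => ?_⟩
  have h1 : 1 + ‖z‖ ≤ (1 + ‖z‖) ^ p := Real.self_le_rpow_of_one_le
    (by linarith [norm_nonneg z]) hp
  have := Real.add_one_le_exp (1 * (1 + ‖z‖) ^ p)
  linarith

lemma HasGrowth.sum {ι : Type*} {f : ι → ℂ → ℂ} {p : ℝ} (hp : 0 ≤ p) (S : Finset ι)
    (hf : ∀ i, HasGrowth (f i) p) : HasGrowth (fun z => ∑ i ∈ S, f i z) p := by
  classical
  induction S using Finset.induction_on with
  | empty => simpa using hasGrowth_const 0 hp
  | insert i S hi ih => simpa [Finset.sum_insert hi] using (hf i).add hp ih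

lemma HasGrowth.comp_affine {f : ℂ → ℂ} {p : ℝ} (hp : 0 ≤ p) (hf : HasGrowth f p) (a b : ℂ) :
    HasGrowth (fun z => f (a * z + b)) p := by
  obtain ⟨C, hC0, hC⟩ := hf.exists_nonneg
  refine ⟨C * (1 + ‖a‖ + ‖b‖) ^ p, fun z => (hC _).trans (Real.exp_le_exp.2 ?_)⟩
  rw [mul_assoc, ← Real.mul_rpow (by positivity) (by positivity)]
  refine mul_le_mul_of_nonneg_left (Real.rpow_le_rpow (by positivity) ?_ hp) hC0
  have := norm_add_le (a * z) b
  rw [norm_mul] at this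
  nlinarith [norm_nonneg a, norm_nonneg b, norm_nonneg z, mul_nonneg (norm_nonneg b) (norm_nonneg z)]

lemma hasGrowth_exp_mul (c : ℂ) {p : ℝ} (hp : 1 ≤ p) :
    HasGrowth (fun z => Complex.exp (c * z)) p := by
  refine ⟨‖c‖, fun z => ?_⟩
  rw [Complex.norm_exp]
  refine Real.exp_le_exp.2 ((Complex.re_le_norm _).trans ?_)
  rw [norm_mul]
  have h1 : 1 + ‖z‖ ≤ (1 + ‖z‖) ^ p := Real.self_le_rpow_of_one_le
    (by linarith [norm_nonneg z]) hp
  exact mul_le_mul_of_nonneg_left (by linarith) (norm_nonneg c)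

/-- The Mellin transform of a function decaying exponentially at infinity grows at most like the
Gamma function in a right half-plane. -/
lemma exists_norm_mellin_le {h : ℝ → ℂ} (hconv : MellinConvergent h 0) {p : ℝ} (hp : 0 < p)
    (hO : h =O[atTop] fun x => Real.exp (-p * x)) :
    ∃ C : ℝ, 0 ≤ C ∧ ∀ s : ℂ, 0 ≤ s.re →
      ‖mellin h s‖ ≤ Real.exp (C * (1 + ‖s‖) ^ (3 / 2 : ℝ)) := by
  obtain ⟨M, hM0, hM⟩ := hO.exists_pos
  obtain ⟨X₀, hX₀⟩ := eventually_atTop.1 hM.bound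
  set X := max X₀ 1 with hX
  have hX1 : 1 ≤ X := le_max_right _ _
  set W : ℝ → ℝ := fun t => ‖(t : ℂ) ^ ((0 : ℂ) - 1) • h t‖ + M * Real.exp (-(p / 2) * t) with hW
  have hWint : IntegrableOn W (Set.Ioi 0) := by
    refine IntegrableOn.add hconv.norm ?_
    exact (exp_neg_integrableOn_Ioi 0 (by positivity)).const_mul M
  set I := ∫ t in Set.Ioi (0 : ℝ), W t with hI
  have hI0 : 0 ≤ I := integral_nonneg fun t => by positivity
  set B := X + 2 / p with hB
  have hB1 : 1 ≤ B := by have : 0 < 2 / p := by positivity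
                         linarith
  have key : ∀ s : ℂ, 0 ≤ s.re → ‖mellin h s‖ ≤ (B * (1 + ‖s‖)) ^ s.re * I := by
    intro s hs
    -- `t ^ Re s ≤ A ^ Re s * exp (p t / 2)`, with the maximum of `t ^ Re s * exp (-p t / 2)` in mind
    set A := B * (1 + ‖s‖) with hA
    have hsr : s.re ≤ ‖s‖ := Complex.re_le_norm s
    have hAX : X ≤ A := by
      have : 0 < 2 / p := by positivity
      nlinarith [norm_nonneg s]
    have hA0 : 0 < A := by linarith
    have hAp : s.re / A ≤ p / 2 := by
      rw [div_le_iff₀ hA0]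
      have h1 : 2 / p * (1 + ‖s‖) ≤ A := mul_le_mul_of_nonneg_right (by linarith) (by positivity)
      have h2 : p / 2 * (2 / p * (1 + ‖s‖)) = 1 + ‖s‖ := by field_simp
      have h3 := mul_le_mul_of_nonneg_left h1 (by positivity : 0 ≤ p / 2)
      linarith
    rw [mellin, hI, ← integral_const_mul]
    refine norm_integral_le_of_norm_le (hWint.const_mul _) ?_
    refine (ae_restrict_iff' measurableSet_Ioi).2 (Eventually.of_forall fun t ht => ?_)
    have ht0 : (0 : ℝ) < t := ht
    have hn : ‖(t : ℂ) ^ (s - 1) • h t‖ = t ^ s.re * ‖(t : ℂ) ^ ((0 : ℂ) - 1) • h t‖ := by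
      rw [norm_smul, norm_smul, Complex.norm_cpow_eq_rpow_re_of_pos ht0,
        Complex.norm_cpow_eq_rpow_re_of_pos ht0, ← mul_assoc, ← Real.rpow_add ht0]
      simp [sub_eq_add_neg]
    rcases le_or_gt t X with htX | htX
    · rw [hn]
      refine mul_le_mul (Real.rpow_le_rpow ht0.le (htX.trans hAX) hs) ?_ (by positivity)
        (by positivity)
      simp only [hW]
      have : 0 ≤ M * Real.exp (-(p / 2) * t) := by positivity
      linarith
    · have ht1 : 1 < t := lt_of_le_of_lt hX1 htX
      have hb := hX₀ t ((le_max_left _ _).trans htX.le)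
      rw [Real.norm_of_nonneg (Real.exp_nonneg _)] at hb
      have h0 : ‖(t : ℂ) ^ ((0 : ℂ) - 1) • h t‖ ≤ M * Real.exp (-p * t) := by
        rw [norm_smul, Complex.norm_cpow_eq_rpow_re_of_pos ht0]
        refine (mul_le_of_le_one_left (norm_nonneg _) ?_).trans hb
        exact Real.rpow_le_one_of_one_le_of_nonpos ht1.le (by simp)
      have h1 : t ^ s.re ≤ A ^ s.re * Real.exp (p / 2 * t) := by
        rw [Real.rpow_def_of_pos ht0, Real.rpow_def_of_pos hA0, ← Real.exp_add]
        refine Real.exp_le_exp.2 ?_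
        have h2 : Real.log t ≤ Real.log A + (t / A - 1) := by
          have := Real.log_le_sub_one_of_pos (div_pos ht0 hA0)
          rw [Real.log_div ht0.ne' hA0.ne'] at this
          linarith
        have h3 : s.re / A * t ≤ p / 2 * t := mul_le_mul_of_nonneg_right hAp ht0.le
        have h4 : s.re * (t / A) = s.re / A * t := by ring
        nlinarith
      rw [hn]
      calc t ^ s.re * ‖(t : ℂ) ^ ((0 : ℂ) - 1) • h t‖
          ≤ (A ^ s.re * Real.exp (p / 2 * t)) * (M * Real.exp (-p * t)) := by gcongr
        _ = A ^ s.re * (M * Real.exp (-(p / 2) * t)) := by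
          have : Real.exp (-(p / 2) * t) = Real.exp (p / 2 * t) * Real.exp (-p * t) := by
            rw [← Real.exp_add]; ring_nf
          rw [this]; ring
        _ ≤ A ^ s.re * W t := by
          refine mul_le_mul_of_nonneg_left ?_ (by positivity)
          simp only [hW]
          exact le_add_of_nonneg_left (norm_nonneg _)
  refine ⟨Real.log B + 2 + I, by have := Real.log_nonneg hB1; positivity, fun s hs => (key s hs).trans ?_⟩
  set r := ‖s‖
  have hr : 0 ≤ r := norm_nonneg s
  have hlogB := Real.log_nonneg hB1
  set x := (1 + r) ^ (3 / 2 : ℝ) with hx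
  have hx2 : (1 + r) * (1 + r) ^ (1 / 2 : ℝ) = x := by
    rw [hx, ← Real.rpow_one_add' (by positivity) (by norm_num)]; norm_num
  have hsq : 1 ≤ (1 + r) ^ (1 / 2 : ℝ) := Real.one_le_rpow (by linarith) (by norm_num)
  have hx1 : 1 + r ≤ x := by nlinarith
  have hlog : Real.log (1 + r) ≤ 2 * (1 + r) ^ (1 / 2 : ℝ) := by
    have := Real.log_le_rpow_div (x := 1 + r) (by linarith) (by norm_num : (0 : ℝ) < 1 / 2)
    linarith
  have h1 : (B * (1 + r)) ^ s.re ≤ Real.exp ((Real.log B + 2) * x) := by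
    rw [Real.rpow_def_of_pos (by positivity), Real.log_mul (by positivity) (by positivity)]
    refine Real.exp_le_exp.2 ?_
    have hsr : s.re ≤ r := Complex.re_le_norm s
    have hl0 : 0 ≤ Real.log (1 + r) := Real.log_nonneg (by linarith)
    have h5 : (Real.log B + Real.log (1 + r)) * s.re ≤ (Real.log B + Real.log (1 + r)) * (1 + r) :=
      mul_le_mul_of_nonneg_left (by linarith) (by positivity)
    have h6 : Real.log (1 + r) * (1 + r) ≤ 2 * x := by nlinarith
    nlinarith
  have h2 : I ≤ Real.exp (I * x) := by
    have := Real.add_one_le_exp (I * x)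
    nlinarith
  calc (B * (1 + r)) ^ s.re * I ≤ Real.exp ((Real.log B + 2) * x) * Real.exp (I * x) := by gcongr
    _ = _ := by rw [← Real.exp_add]; ring_nf

/-- The entire part of a Mellin transform with a functional equation: both half-planes are covered
by `exists_norm_mellin_le`, the left one through the functional equation. -/
lemma hasGrowth_Λ₀ (P : WeakFEPair ℂ) {p p' : ℝ} (hp : 0 < p) (hp' : 0 < p')
    (hf : (fun x => P.f x - P.f₀) =O[atTop] fun x => Real.exp (-p * x))
    (hg : (fun x => P.g x - P.g₀) =O[atTop] fun x => Real.exp (-p' * x)) :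
    HasGrowth P.Λ₀ (3 / 2) := by
  have half : ∀ (Q : WeakFEPair ℂ) {p : ℝ}, 0 < p →
      ((fun x => Q.f x - Q.f₀) =O[atTop] fun x => Real.exp (-p * x)) →
      ∃ C : ℝ, 0 ≤ C ∧ ∀ s : ℂ, 0 ≤ s.re →
        ‖Q.Λ₀ s‖ ≤ Real.exp (C * (1 + ‖s‖) ^ (3 / 2 : ℝ)) := by
    intro Q p hp hQ
    refine exists_norm_mellin_le (Q.isStrongFEPair_toStrongFEPair.hasMellin 0).1 hp ?_
    refine hQ.congr' ?_ .rfl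
    filter_upwards [eventually_gt_atTop 1] with x hx
    have h1 : x ∉ Set.Ioo (0 : ℝ) 1 := fun h => by have := h.2; linarith
    simp [WeakFEPair.f_modif, Set.mem_Ioi.2 hx, h1]
  obtain ⟨C, hC0, hC⟩ := half P hp hf
  obtain ⟨D, hD0, hD⟩ := half P.symm hp' hg
  obtain ⟨E, hE0, hE⟩ := ((hasGrowth_const P.ε (p := 3 / 2) (by norm_num)).exists_nonneg)
  have hk := P.hk
  refine ⟨C + (E + D * (2 + P.k) ^ (3 / 2 : ℝ)), fun s => ?_⟩
  have hx0 : 0 ≤ (1 + ‖s‖) ^ (3 / 2 : ℝ) := by positivity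
  rcases le_total 0 s.re with hs | hs
  · refine (hC s hs).trans (Real.exp_le_exp.2 (mul_le_mul_of_nonneg_right ?_ hx0))
    have : 0 ≤ E + D * (2 + P.k) ^ (3 / 2 : ℝ) := by positivity
    linarith
  · have h1 := P.functional_equation₀ (P.k - s)
    rw [sub_sub_cancel] at h1
    have hk0 : 0 ≤ ((P.k : ℂ) - s).re := by simp; linarith
    rw [h1, norm_smul]
    have hn : 1 + ‖(P.k : ℂ) - s‖ ≤ (2 + P.k) * (1 + ‖s‖) := by
      have := norm_sub_le (P.k : ℂ) s
      rw [Complex.norm_real, Real.norm_of_nonneg hk.le] at this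
      nlinarith [norm_nonneg s]
    have h2 : (1 + ‖(P.k : ℂ) - s‖) ^ (3 / 2 : ℝ) ≤
        (2 + P.k) ^ (3 / 2 : ℝ) * (1 + ‖s‖) ^ (3 / 2 : ℝ) := by
      rw [← Real.mul_rpow (by positivity) (by positivity)]
      exact Real.rpow_le_rpow (by positivity) hn (by norm_num)
    calc ‖P.ε‖ * ‖P.symm.Λ₀ (P.k - s)‖
        ≤ Real.exp (E * (1 + ‖s‖) ^ (3 / 2 : ℝ)) *
          Real.exp (D * ((2 + P.k) ^ (3 / 2 : ℝ) * (1 + ‖s‖) ^ (3 / 2 : ℝ))) := by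
          refine mul_le_mul (hE s) ((hD _ hk0).trans (Real.exp_le_exp.2 ?_)) (norm_nonneg _)
            (Real.exp_nonneg _)
          exact mul_le_mul_of_nonneg_left h2 hD0
      _ = Real.exp ((E + D * (2 + P.k) ^ (3 / 2 : ℝ)) * (1 + ‖s‖) ^ (3 / 2 : ℝ)) := by
          rw [← Real.exp_add]; ring_nf
      _ ≤ _ := Real.exp_le_exp.2 (mul_le_mul_of_nonneg_right (by linarith) hx0)

open HurwitzZeta in
lemma hasGrowth_completedHurwitzZetaEven₀ (a : UnitAddCircle) :
    HasGrowth (completedHurwitzZetaEven₀ a) (3 / 2) := by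
  obtain ⟨p, hp, hO⟩ := isBigO_atTop_evenKernel_sub a
  obtain ⟨p', hp', hO'⟩ := isBigO_atTop_cosKernel_sub a
  have h := hasGrowth_Λ₀ (hurwitzEvenFEPair a) hp hp' ?_ ?_
  · have h2 := (h.comp_affine (by norm_num) (1 / 2) 0).mul
      (hasGrowth_const (1 / 2) (by norm_num))
    convert h2 using 2 with s
    rw [completedHurwitzZetaEven₀]
    ring_nf
  · refine Asymptotics.IsBigO.congr_left
      (f₁ := fun x => ((evenKernel a x - if a = 0 then 1 else 0 : ℝ) : ℂ)) ?_ ?_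
    · exact Complex.isBigO_ofReal_left.2 hO
    · intro x; simp [hurwitzEvenFEPair]; split_ifs <;> simp
  · refine Asymptotics.IsBigO.congr_left (f₁ := fun x => ((cosKernel a x - 1 : ℝ) : ℂ)) ?_ ?_
    · exact Complex.isBigO_ofReal_left.2 hO'
    · intro x; simp [hurwitzEvenFEPair]

open HurwitzZeta in
lemma hasGrowth_completedHurwitzZetaOdd (a : UnitAddCircle) :
    HasGrowth (completedHurwitzZetaOdd a) (3 / 2) := by
  obtain ⟨p, hp, hO⟩ := isBigO_atTop_oddKernel a
  obtain ⟨p', hp', hO'⟩ := isBigO_atTop_sinKernel a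
  have h := hasGrowth_Λ₀ (hurwitzOddFEPair a) hp hp' ?_ ?_
  · have h2 := (h.comp_affine (by norm_num) (1 / 2) (1 / 2)).mul
      (hasGrowth_const (1 / 2) (by norm_num))
    convert h2 using 2 with s
    have : (hurwitzOddFEPair a).Λ = (hurwitzOddFEPair a).Λ₀ := by
      ext s; simp [WeakFEPair.Λ, hurwitzOddFEPair]
    rw [completedHurwitzZetaOdd, this]
    ring_nf
  · refine Asymptotics.IsBigO.congr_left (f₁ := fun x => ((oddKernel a x : ℝ) : ℂ)) ?_ ?_
    · exact Complex.isBigO_ofReal_left.2 hO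
    · intro x; simp [hurwitzOddFEPair]
  · refine Asymptotics.IsBigO.congr_left (f₁ := fun x => ((sinKernel a x : ℝ) : ℂ)) ?_ ?_
    · exact Complex.isBigO_ofReal_left.2 hO'
    · intro x; simp [hurwitzOddFEPair]

/-! ### Completed Dirichlet `L`-functions -/

open scoped ComplexConjugate

/-- What is used about the completed `L`-function `F` of the primitive character inducing `χ`
(multiplied by `s (1 - s)` for the trivial character): it is entire of order less than `2`,
satisfies the functional equation in the form of a reflection in the critical line, has exactly the
non-trivial zeros of `χ.LFunction`, and `F (s + 2) / F s` is of the size of `s` on `2 ≤ Re s`. -/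
structure IsCompletion {q : ℕ} [NeZero q] (χ : DirichletCharacter ℂ q) (F : ℂ → ℂ) : Prop where
  differentiable : Differentiable ℂ F
  growth : HasGrowth F (3 / 2)
  reflect : ∃ ε : ℂ, ∀ s, F (1 - conj s) = ε * conj (F s)
  zero_re : ∀ s, F s = 0 → 0 < s.re ∧ s.re < 1
  order_eq : ∀ s : ℂ, 0 < s.re → s.re < 1 → analyticOrderAt F s = analyticOrderAt χ.LFunction s
  shift : ∃ C : ℝ, ∀ s : ℂ, 2 ≤ s.re → |Real.log ‖F (s + 2)‖ - Real.log ‖F s‖ - Real.log ‖s‖| ≤ C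

/-- The identity theorem, from the half-plane of absolute convergence. -/
lemma eq_of_eqOn_re_gt_one {f g : ℂ → ℂ} (hf : Differentiable ℂ f) (hg : Differentiable ℂ g)
    (h : ∀ s : ℂ, 1 < s.re → f s = g s) : f = g := by
  refine AnalyticOnNhd.eq_of_eventuallyEq (z₀ := 2) (fun x _ => hf.analyticAt x)
    (fun x _ => hg.analyticAt x) ?_
  filter_upwards [(isOpen_lt continuous_const Complex.continuous_re).mem_nhds
    (show (1 : ℝ) < (2 : ℂ).re by norm_num)] with s hs using h s hs

lemma Gammaℝ_conj (s : ℂ) : Complex.Gammaℝ (conj s) = conj (Complex.Gammaℝ s) := by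
  rw [Complex.Gammaℝ_def, Complex.Gammaℝ_def, map_mul, ← Complex.Gamma_conj]
  have h1 : (Real.pi : ℂ).arg ≠ Real.pi := by
    rw [Complex.arg_ofReal_of_nonneg Real.pi_pos.le]; exact Real.pi_ne_zero.symm
  have h2 := Complex.cpow_conj (Real.pi : ℂ) (-s / 2) h1
  rw [Complex.conj_ofReal] at h2
  rw [← h2]
  simp [Complex.conj_ofNat]

lemma natCast_cpow_conj (n : ℕ) (s : ℂ) : (n : ℂ) ^ (conj s) = conj ((n : ℂ) ^ s) := by
  have h1 : (n : ℂ).arg ≠ Real.pi := by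
    rw [Complex.natCast_arg]; exact Real.pi_ne_zero.symm
  have h2 := Complex.cpow_conj (n : ℂ) s h1
  rwa [Complex.conj_natCast] at h2

lemma LFunction_inv_conj {N : ℕ} [NeZero N] (χ : DirichletCharacter ℂ N) {s : ℂ} (hs : 1 < s.re) :
    χ⁻¹.LFunction (conj s) = conj (χ.LFunction s) := by
  rw [DirichletCharacter.LFunction_eq_LSeries _ (by simpa using hs),
    DirichletCharacter.LFunction_eq_LSeries _ hs, LSeries, LSeries, Complex.conj_tsum]
  refine tsum_congr fun n => ?_
  rcases eq_or_ne n 0 with rfl | hn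
  · simp
  · rw [LSeries.term_of_ne_zero hn, LSeries.term_of_ne_zero hn, map_div₀, natCast_cpow_conj]
    congr 1
    exact (MulChar.star_apply' χ _).symm

/-- A character and its inverse have the same parity `a`, hence the same Gamma factor. -/
lemma gammaFactor_eq {N : ℕ} (χ : DirichletCharacter ℂ N) : ∃ a : ℕ, a ≤ 1 ∧
    (∀ s, χ.gammaFactor s = Complex.Gammaℝ (s + a)) ∧
    ∀ s, χ⁻¹.gammaFactor s = Complex.Gammaℝ (s + a) := by
  have hinv : χ⁻¹ (-1) = (χ (-1))⁻¹ := MulChar.inv_apply_eq_inv' χ (-1)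
  rcases χ.even_or_odd with h | h
  · refine ⟨0, by norm_num, fun s => by simp [h.gammaFactor_def], fun s => ?_⟩
    have h' : χ⁻¹.Even := by
      rw [DirichletCharacter.Even] at h ⊢; rw [hinv, h, inv_one]
    simp [h'.gammaFactor_def]
  · refine ⟨1, le_rfl, fun s => by simp [h.gammaFactor_def], fun s => ?_⟩
    have h' : χ⁻¹.Odd := by
      rw [DirichletCharacter.Odd] at h ⊢; rw [hinv, h]; norm_num
    simp [h'.gammaFactor_def]

/-- The completed `L`-function of a primitive character, with its elementary factors. -/
lemma exists_completion_of_isPrimitive {N : ℕ} [NeZero N] {χ : DirichletCharacter ℂ N}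
    (hχ : χ.IsPrimitive) : ∃ (F P : ℂ → ℂ) (a : ℕ), a ≤ 1 ∧
      (P = (fun _ => 1) ∨ P = fun s => s * (1 - s)) ∧ Differentiable ℂ F ∧ HasGrowth F (3 / 2) ∧
      (∃ ε : ℂ, ∀ s, F (1 - conj s) = ε * conj (F s)) ∧ F 1 ≠ 0 ∧
      ∀ s : ℂ, 0 < s.re → s ≠ 1 →
        F s = P s * (N : ℂ) ^ (s / 2) * Complex.Gammaℝ (s + a) * χ.LFunction s := by
  have hN0 : (N : ℂ) ≠ 0 := NeZero.ne _
  rcases eq_or_ne N 1 with rfl | hN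
  · set F : ℂ → ℂ := fun s => s * (1 - s) * completedRiemannZeta₀ s - 1 with hF
    have hd : Differentiable ℂ F := by
      have := differentiable_completedZeta₀
      simp only [hF]; fun_prop
    have hform : ∀ s : ℂ, 0 < s.re → s ≠ 1 → F s = s * (1 - s) *
        (Complex.Gammaℝ s * riemannZeta s) := by
      intro s hs hs1
      have hs0 : s ≠ 0 := fun h => by simp [h] at hs
      have h1s : 1 - s ≠ 0 := sub_ne_zero.2 hs1.symm
      rw [riemannZeta_def_of_ne_zero hs0, mul_div_cancel₀ _ (Complex.Gammaℝ_ne_zero_of_re_pos hs),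
        completedRiemannZeta_eq]
      simp only [hF]
      field_simp
      ring
    have hconj : ∀ s, F (conj s) = conj (F s) := by
      have h := eq_of_eqOn_re_gt_one (f := fun s => conj (F (conj s))) (g := F)
        (fun s => differentiableAt_conj_conj_iff.2 (hd _)) hd ?_
      · intro s
        rw [← congrFun h s, Complex.conj_conj]
      · intro s hs
        have hs' : 1 < (conj s).re := by simpa using hs
        have hs1 : s ≠ 1 := fun h => by simp [h] at hs
        have hs1' : conj s ≠ 1 := fun h => by simp [h] at hs'
        have h2 := LFunction_inv_conj (1 : DirichletCharacter ℂ 1) hs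
        rw [inv_one, DirichletCharacter.LFunction_modOne_eq] at h2
        change conj (F (conj s)) = F s
        rw [hform _ (by linarith) hs1', hform _ (by linarith) hs1, Gammaℝ_conj, h2]
        simp
    have hg0 : HasGrowth completedRiemannZeta₀ (3 / 2) :=
      hasGrowth_completedHurwitzZetaEven₀ 0
    refine ⟨F, fun s => s * (1 - s), 0, by norm_num, Or.inr rfl, hd, ?_, ⟨1, fun s => ?_⟩, ?_, ?_⟩
    · have hid : HasGrowth (fun s => s) (3 / 2) := hasGrowth_id (by norm_num)
      have h1 := ((hid.mul (hid.comp_affine (by norm_num) (-1) 1)).mul hg0).add (by norm_num)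
        (hasGrowth_const (-1) (by norm_num))
      convert h1 using 2 with s
      simp only [hF]; ring
    · have : F (1 - conj s) = F (conj s) := by
        simp only [hF, completedRiemannZeta₀_one_sub]; ring
      rw [this, hconj, one_mul]
    · simp [hF]
    · intro s hs hs1
      rw [hform s hs hs1, DirichletCharacter.LFunction_modOne_eq]
      simp
      ring
  · have hχ1 : χ ≠ 1 := by
      rintro rfl
      rw [DirichletCharacter.isPrimitive_def, DirichletCharacter.conductor_one] at hχ
      exact hN hχ.symm
    have hχ1' : χ⁻¹ ≠ 1 := inv_ne_one.2 hχ1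
    obtain ⟨a, ha, hga, hga'⟩ := gammaFactor_eq χ
    have hcomp : ∀ {ψ : DirichletCharacter ℂ N}, (∀ s, ψ.gammaFactor s = Complex.Gammaℝ (s + a)) →
        ∀ s : ℂ, 0 < s.re → ψ.completedLFunction s = Complex.Gammaℝ (s + a) * ψ.LFunction s := by
      intro ψ hψ s hs
      have : Complex.Gammaℝ (s + a) ≠ 0 :=
        Complex.Gammaℝ_ne_zero_of_re_pos (by simp; positivity)
      rw [DirichletCharacter.LFunction_eq_completed_div_gammaFactor ψ s (Or.inr hN), hψ,
        mul_div_cancel₀ _ this]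
    have hconj : ∀ s, χ⁻¹.completedLFunction (conj s) = conj (χ.completedLFunction s) := by
      have h := eq_of_eqOn_re_gt_one (f := fun s => conj (χ⁻¹.completedLFunction (conj s)))
        (g := χ.completedLFunction)
        (fun s => differentiableAt_conj_conj_iff.2
          (DirichletCharacter.differentiable_completedLFunction hχ1' _))
        (DirichletCharacter.differentiable_completedLFunction hχ1) ?_
      · intro s
        rw [← congrFun h s, Complex.conj_conj]
      · intro s hs
        rw [hcomp hga' _ (by simp; linarith), hcomp hga _ (by linarith), LFunction_inv_conj χ hs,
          map_mul, Complex.conj_conj]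
        congr 1
        rw [← Gammaℝ_conj]
        simp
    set F : ℂ → ℂ := fun s => (N : ℂ) ^ (s / 2) * χ.completedLFunction s with hF
    have hcd : Differentiable ℂ χ.completedLFunction :=
      DirichletCharacter.differentiable_completedLFunction hχ1
    have hlog : ∀ s : ℂ, (N : ℂ) ^ s = Complex.exp (Complex.log N * s) := fun s => by
      rw [Complex.cpow_def_of_ne_zero hN0]
    refine ⟨F, fun _ => 1, a, ha, Or.inl rfl, ?_, ?_,
      ⟨(N : ℂ) ^ ((1 : ℂ) / 2 - 1 / 2) * χ.rootNumber, fun s => ?_⟩, ?_, ?_⟩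
    · simp only [hF]
      have : NeZero (N : ℂ) := ⟨hN0⟩
      fun_prop
    · have h1 : HasGrowth χ.completedLFunction (3 / 2) := by
        have hN' : ∀ c : ℂ, HasGrowth (fun s : ℂ => (N : ℂ) ^ (c * s)) (3 / 2) := fun c => by
          simp_rw [hlog]
          have := hasGrowth_exp_mul (Complex.log N * c) (p := 3 / 2) (by norm_num)
          simpa only [mul_assoc] using this
        have h2 := ((hN' (-1)).mul (HasGrowth.sum (by norm_num) Finset.univ fun j : ZMod N =>
          (hasGrowth_const (χ j) (by norm_num)).mul
            (hasGrowth_completedHurwitzZetaEven₀ (ZMod.toAddCircle j)))).add (by norm_num)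
          ((hN' (-1)).mul (HasGrowth.sum (by norm_num) Finset.univ fun j : ZMod N =>
          (hasGrowth_const (χ j) (by norm_num)).mul
            (hasGrowth_completedHurwitzZetaOdd (ZMod.toAddCircle j))))
        convert h2 using 2 with s
        rw [DirichletCharacter.completedLFunction, ZMod.completedLFunction_eq,
          χ.map_zero' hN, χ.sum_eq_zero_of_ne_one hχ1, ZMod.completedLFunction₀]
        simp
      have h3 : HasGrowth (fun s : ℂ => (N : ℂ) ^ (s / 2)) (3 / 2) := by
        simp_rw [hlog]
        have := hasGrowth_exp_mul (Complex.log N * (1 / 2)) (p := 3 / 2) (by norm_num)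
        convert this using 2 with s
        ring_nf
      exact h3.mul h1
    · simp only [hF]
      rw [DirichletCharacter.IsPrimitive.completedLFunction_one_sub hχ, hconj, map_mul,
        ← natCast_cpow_conj, map_div₀, Complex.conj_ofNat]
      have : (N : ℂ) ^ ((1 - conj s) / 2) * (N : ℂ) ^ (conj s - 1 / 2) =
          (N : ℂ) ^ ((1 : ℂ) / 2 - 1 / 2) * (N : ℂ) ^ (conj s / 2) := by
        rw [← Complex.cpow_add _ _ hN0, ← Complex.cpow_add _ _ hN0]; ring_nf
      linear_combination (χ.rootNumber * conj (χ.completedLFunction s)) * this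
    · have h1 := DirichletCharacter.LFunction_ne_zero_of_one_le_re χ (s := 1) (Or.inl hχ1) (by simp)
      simp only [hF]
      refine mul_ne_zero (by simp [hN0]) ?_
      rw [hcomp hga 1 (by simp)]
      exact mul_ne_zero (Complex.Gammaℝ_ne_zero_of_re_pos (by simp; positivity)) h1
    · intro s hs _
      simp only [hF]
      rw [hcomp hga s hs]
      ring

lemma norm_LFunction_sub_one_le {N : ℕ} [NeZero N] (χ : DirichletCharacter ℂ N) {s : ℂ}
    (hs : 2 ≤ s.re) : ‖χ.LFunction s - 1‖ ≤ 2 / 3 := by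
  have hs1 : 1 < s.re := by linarith
  rw [DirichletCharacter.LFunction_eq_LSeries _ hs1]
  have h1 : HasSum (LSeries.term (fun n => χ n) s) (LSeries (fun n => χ n) s) :=
    (DirichletCharacter.LSeriesSummable_of_one_lt_re χ hs1).hasSum
  have h2 : HasSum (fun n => LSeries.term (fun n => χ n) s n - if n = 1 then 1 else 0)
      (LSeries (fun n => χ n) s - 1) := h1.sub (hasSum_ite_eq 1 1)
  have h3 : HasSum (fun n : ℕ => 1 / (n : ℝ) ^ 2 - if n = 1 then 1 else 0) (Real.pi ^ 2 / 6 - 1) :=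
    hasSum_zeta_two.sub (hasSum_ite_eq 1 1)
  have h4 : ‖LSeries (fun n => χ n) s - 1‖ ≤ Real.pi ^ 2 / 6 - 1 := by
    rw [← h2.tsum_eq]
    refine tsum_of_norm_bounded h3 fun n => ?_
    rcases eq_or_ne n 0 with rfl | hn
    · simp
    rcases eq_or_ne n 1 with rfl | hn1
    · simp [LSeries.term_of_ne_zero]
    · simp only [hn1, if_false, sub_zero]
      rw [LSeries.term_of_ne_zero hn, norm_div, Complex.norm_natCast_cpow_of_pos (by omega)]
      have hn2 : (1 : ℝ) ≤ n := by exact_mod_cast Nat.one_le_iff_ne_zero.2 hn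
      refine div_le_div₀ (by norm_num) (χ.norm_le_one _) (by positivity) ?_
      rw [← Real.rpow_two]
      exact Real.rpow_le_rpow_of_exponent_le hn2 hs
  have := Real.pi_lt_d2
  have := Real.pi_pos
  nlinarith

lemma abs_log_sub_log_le {x y c : ℝ} (hx : 0 < x) (hxy : x ≤ y) (hy : y ≤ c * x) :
    |Real.log y - Real.log x| ≤ Real.log c := by
  have hc : 0 < c := pos_of_mul_pos_left (hx.trans_le (hxy.trans hy)) hx.le
  rw [abs_of_nonneg (sub_nonneg.2 (Real.log_le_log hx hxy))]
  have := Real.log_le_log (hx.trans_le hxy) hy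
  rw [Real.log_mul hc.ne' hx.ne'] at this
  linarith

lemma abs_log_norm_LFunction_le {N : ℕ} [NeZero N] (χ : DirichletCharacter ℂ N) {s : ℂ}
    (hs : 2 ≤ s.re) : |Real.log ‖χ.LFunction s‖| ≤ Real.log 3 := by
  have h := norm_LFunction_sub_one_le χ hs
  have h1 : ‖χ.LFunction s‖ ≤ 3 := by
    have := norm_le_norm_sub_add (χ.LFunction s) 1
    rw [norm_one] at this; linarith
  have h2 : 1 / 3 ≤ ‖χ.LFunction s‖ := by
    have := norm_sub_norm_le 1 (χ.LFunction s)
    rw [norm_one, norm_sub_rev] at this; linarith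
  rw [abs_le]
  constructor
  · have := Real.log_le_log (by norm_num) h2
    rwa [one_div, Real.log_inv] at this
  · exact Real.log_le_log (by linarith) h1

lemma abs_log_norm_add_sub_le {s : ℂ} {a c : ℝ} (ha : 0 ≤ a) (hs : 0 < s.re)
    (hac : a ≤ (c - 1) * s.re) : |Real.log ‖s + a‖ - Real.log ‖s‖| ≤ Real.log c := by
  have h0 : 0 < ‖s‖ := norm_pos_iff.2 fun h => by simp [h] at hs
  have h1 : ‖s‖ ≤ ‖s + a‖ := by
    rw [Complex.norm_def, Complex.norm_def]
    refine Real.sqrt_le_sqrt ?_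
    simp only [Complex.normSq_apply, Complex.add_re, Complex.ofReal_re, Complex.add_im,
      Complex.ofReal_im, add_zero]
    nlinarith
  refine abs_log_sub_log_le h0 h1 ?_
  have h2 := norm_add_le s a
  rw [Complex.norm_real, Real.norm_of_nonneg ha] at h2
  have h3 := Complex.re_le_norm s
  have h4 : 0 ≤ c - 1 := by
    by_contra h
    nlinarith
  nlinarith

lemma completion_prefactor_ne_zero {N : ℕ} [NeZero N] {P : ℂ → ℂ} (a : ℕ)
    (hP : P = (fun _ => 1) ∨ P = fun s => s * (1 - s)) {s : ℂ} (hs : 0 < s.re) (hs1 : s ≠ 1) :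
    P s ≠ 0 ∧ (N : ℂ) ^ (s / 2) ≠ 0 ∧ Complex.Gammaℝ (s + a) ≠ 0 := by
  refine ⟨?_, ?_, Complex.Gammaℝ_ne_zero_of_re_pos (by simp; positivity)⟩
  · rcases hP with rfl | rfl
    · exact one_ne_zero
    · exact mul_ne_zero (fun h => by simp [h] at hs) (sub_ne_zero.2 hs1.symm)
  · simp [Complex.cpow_eq_zero_iff, NeZero.ne N]

/-- The Gamma factor and the Euler factors at the primes dividing the level do not vanish in the
strip, so the completed function has the same zeros there as the imprimitive `L`-function. -/
lemma completion_order_eq {q N : ℕ} [NeZero q] [NeZero N] (hNq : N ∣ q)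
    {ψ : DirichletCharacter ℂ N} {F P : ℂ → ℂ} {a : ℕ}
    (hP : P = (fun _ => 1) ∨ P = fun s => s * (1 - s))
    (hform : ∀ s : ℂ, 0 < s.re → s ≠ 1 →
      F s = P s * (N : ℂ) ^ (s / 2) * Complex.Gammaℝ (s + a) * ψ.LFunction s)
    {s : ℂ} (hs0 : 0 < s.re) (hs1 : s.re < 1) :
    analyticOrderAt F s =
      analyticOrderAt (DirichletCharacter.changeLevel hNq ψ).LFunction s := by
  have hN0 : (N : ℂ) ≠ 0 := NeZero.ne _
  have hPd : Differentiable ℂ P := by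
    rcases hP with rfl | rfl <;> fun_prop
  set Q : ℂ → ℂ := fun s => ∏ p ∈ q.primeFactors, (1 - ψ p * (p : ℂ) ^ (-s)) with hQ
  set E : ℂ → ℂ := fun s => P s * (N : ℂ) ^ (s / 2) * Complex.Gammaℝ (s + a) with hE
  have hsne : s ≠ 1 := fun h => by simp [h] at hs1
  have hχL : ∀ z, z ≠ 1 →
      (DirichletCharacter.changeLevel hNq ψ).LFunction z = ψ.LFunction z * Q z :=
    fun z hz => DirichletCharacter.LFunction_changeLevel _ ψ (Or.inr hz)
  have hE0 : E s ≠ 0 := by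
    obtain ⟨h1, h2, h3⟩ := completion_prefactor_ne_zero (N := N) a hP hs0 hsne
    exact mul_ne_zero (mul_ne_zero h1 h2) h3
  have hQd : Differentiable ℂ Q := by
    refine Differentiable.fun_finsetProd fun p hp => ?_
    have : NeZero (p : ℂ) := ⟨by exact_mod_cast (Nat.prime_of_mem_primeFactors hp).ne_zero⟩
    fun_prop
  have hQ0 : Q s ≠ 0 := by
    refine Finset.prod_ne_zero_iff.2 fun p hp h => ?_
    have hp2 := (Nat.prime_of_mem_primeFactors hp).two_le
    have h1 : ‖ψ p * (p : ℂ) ^ (-s)‖ < 1 := by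
      rw [norm_mul]
      refine (mul_le_of_le_one_left (norm_nonneg _) (ψ.norm_le_one _)).trans_lt ?_
      rw [Complex.norm_natCast_cpow_of_pos (by omega)]
      refine Real.rpow_lt_one_of_one_lt_of_neg (by exact_mod_cast (by omega : 1 < p)) ?_
      simpa using hs0
    rw [← sub_eq_zero.1 h, norm_one] at h1
    exact lt_irrefl _ h1
  have hψA : AnalyticAt ℂ ψ.LFunction s := by
    refine DifferentiableOn.analyticAt (s := {1}ᶜ) (fun z hz => ?_)
      (isOpen_compl_singleton.mem_nhds hsne)
    exact (DirichletCharacter.differentiableAt_LFunction ψ z (Or.inl hz)).differentiableWithinAt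
  have hopen : IsOpen {z : ℂ | 0 < z.re ∧ z ≠ 1} :=
    (isOpen_lt continuous_const Complex.continuous_re).inter isOpen_compl_singleton
  have hEA : AnalyticAt ℂ E s := by
    refine DifferentiableOn.analyticAt (s := {z : ℂ | 0 < z.re ∧ z ≠ 1}) (fun z hz => ?_)
      (hopen.mem_nhds ⟨hs0, hsne⟩)
    have : NeZero (N : ℂ) := ⟨hN0⟩
    have hG : DifferentiableAt ℂ (fun z => Complex.Gammaℝ (z + a)) z := by
      have hz0 : 0 < (z + a).re := by simp; linarith [hz.1, Nat.cast_nonneg (α := ℝ) a]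
      simp only [Complex.Gammaℝ_def]
      have : NeZero (Real.pi : ℂ) := ⟨by exact_mod_cast Real.pi_ne_zero⟩
      refine DifferentiableAt.mul (by fun_prop) ?_
      refine (Complex.differentiableAt_Gamma _ fun m hm => ?_).comp z (by fun_prop)
      have := congrArg Complex.re hm
      simp at this hz0
      linarith [Nat.cast_nonneg (α := ℝ) m]
    refine DifferentiableAt.differentiableWithinAt (DifferentiableAt.mul ?_ hG)
    fun_prop
  have h1 : analyticOrderAt F s = analyticOrderAt ψ.LFunction s := by
    have : F =ᶠ[𝓝 s] E * ψ.LFunction := by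
      filter_upwards [hopen.mem_nhds ⟨hs0, hsne⟩] with z hz using hform z hz.1 hz.2
    rw [analyticOrderAt_congr this, analyticOrderAt_mul hEA hψA,
      hEA.analyticOrderAt_eq_zero.2 hE0, zero_add]
  have h2 : analyticOrderAt (DirichletCharacter.changeLevel hNq ψ).LFunction s =
       analyticOrderAt ψ.LFunction s := by
    have : (DirichletCharacter.changeLevel hNq ψ).LFunction =ᶠ[𝓝 s] ψ.LFunction * Q := by
      filter_upwards [hopen.mem_nhds ⟨hs0, hsne⟩] with z hz using hχL z hz.2
    rw [analyticOrderAt_congr this, analyticOrderAt_mul hψA (hQd.analyticAt s),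
      (hQd.analyticAt s).analyticOrderAt_eq_zero.2 hQ0, add_zero]
  rw [h1, h2]

/-- The functional equation of the Gamma function contributes `|s + a| / (2 π)` to `F (s + 2) / F s`,
and the other factors are bounded. -/
lemma completion_shift {N : ℕ} [NeZero N] {ψ : DirichletCharacter ℂ N} {F P : ℂ → ℂ} {a : ℕ}
    (ha : a ≤ 1)
    (hP : P = (fun _ => 1) ∨ P = fun s => s * (1 - s))
    (hform : ∀ s : ℂ, 0 < s.re → s ≠ 1 →
      F s = P s * (N : ℂ) ^ (s / 2) * Complex.Gammaℝ (s + a) * ψ.LFunction s) :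
    ∃ C : ℝ, ∀ s : ℂ, 2 ≤ s.re →
      |Real.log ‖F (s + 2)‖ - Real.log ‖F s‖ - Real.log ‖s‖| ≤ C := by
  have hN0 : (N : ℂ) ≠ 0 := NeZero.ne _
  refine ⟨2 * Real.log 3 + Real.log N + Real.log (2 * Real.pi) + 2 * Real.log 4 + Real.log 4,
    fun s hs => ?_⟩
  have hs1 : s ≠ 1 := fun h => by simp [h] at hs
  have hs2 : s + 2 ≠ 1 := fun h => by
    have := congrArg Complex.re h
    simp at this; linarith
  have hsa : s + a ≠ 0 := fun h => by
    have := congrArg Complex.re h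
    simp at this; linarith [Nat.cast_nonneg (α := ℝ) a]
  have hL1 : ψ.LFunction s ≠ 0 :=
    DirichletCharacter.LFunction_ne_zero_of_one_le_re ψ (Or.inr hs1) (by linarith)
  have hL2 : ψ.LFunction (s + 2) ≠ 0 :=
    DirichletCharacter.LFunction_ne_zero_of_one_le_re ψ (Or.inr hs2) (by simp; linarith)
  obtain ⟨hPs, hNpow, hG⟩ := completion_prefactor_ne_zero (N := N) a hP (by linarith) hs1
  have hPs2 := (completion_prefactor_ne_zero (N := N) (s := s + 2) a hP
    (by simp; linarith) hs2).1
  have hpi : (Real.pi : ℂ) ≠ 0 := by exact_mod_cast Real.pi_ne_zero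
  have e1 : Real.log ‖F (s + 2)‖ = Real.log ‖P (s + 2)‖ + Real.log ‖(N : ℂ) ^ (s / 2)‖ +
      Real.log N + Real.log ‖Complex.Gammaℝ (s + a)‖ + Real.log ‖s + a‖
      - Real.log (2 * Real.pi) + Real.log ‖ψ.LFunction (s + 2)‖ := by
    rw [hform (s + 2) (by simp; linarith) hs2]
    have h1 : (N : ℂ) ^ ((s + 2) / 2) = (N : ℂ) ^ (s / 2) * N := by
      rw [show (s + 2) / 2 = s / 2 + 1 by ring, Complex.cpow_add _ _ hN0, Complex.cpow_one]
    have h2 : Complex.Gammaℝ (s + 2 + a) =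
        Complex.Gammaℝ (s + a) * ((s + a) / (2 * Real.pi : ℝ)) := by
      rw [show s + 2 + a = (s + a) + 2 by ring, Complex.Gammaℝ_add_two hsa]
      push_cast; ring
    have hN' : ‖(N : ℂ)‖ = N := by simp
    rw [h1, h2]
    simp only [norm_mul, norm_div, hN', Complex.norm_real,
      Real.norm_of_nonneg (by positivity : (0 : ℝ) ≤ 2 * Real.pi)]
    have : (N : ℝ) ≠ 0 := by exact_mod_cast NeZero.ne N
    have g1 := norm_ne_zero_iff.2 hPs2
    have g2 := norm_ne_zero_iff.2 hNpow
    have g3 := norm_ne_zero_iff.2 hG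
    have g4 := norm_ne_zero_iff.2 hsa
    have g5 := norm_ne_zero_iff.2 hL2
    have g6 : (2 * Real.pi) ≠ 0 := by positivity
    rw [Real.log_mul (by positivity) g5, Real.log_mul (by positivity) (by positivity),
      Real.log_mul g1 (by positivity), Real.log_mul g2 this, Real.log_mul g3 (by positivity),
      Real.log_div g4 g6]
    ring
  have e2 : Real.log ‖F s‖ = Real.log ‖P s‖ + Real.log ‖(N : ℂ) ^ (s / 2)‖ +
      Real.log ‖Complex.Gammaℝ (s + a)‖ + Real.log ‖ψ.LFunction s‖ := by
    rw [hform s (by linarith) hs1]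
    simp only [norm_mul]
    have g1 := norm_ne_zero_iff.2 hPs
    have g2 := norm_ne_zero_iff.2 hNpow
    have g3 := norm_ne_zero_iff.2 hG
    have g5 := norm_ne_zero_iff.2 hL1
    rw [Real.log_mul (by positivity) g5, Real.log_mul (by positivity) g3, Real.log_mul g1 g2]
  have b1 : |Real.log ‖P (s + 2)‖ - Real.log ‖P s‖| ≤ 2 * Real.log 4 := by
    rcases hP with rfl | rfl
    · simp; exact Real.log_nonneg (by norm_num)
    · have i1 := abs_log_norm_add_sub_le (s := s) (a := 2) (c := 4) (by norm_num) (by linarith)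
        (by linarith)
      have i2 := abs_log_norm_add_sub_le (s := s - 1) (a := 2) (c := 4) (by norm_num)
        (by simp; linarith) (by simp; linarith)
      have hss : s ≠ 0 := fun h => by simp [h] at hs; norm_num at hs
      have hss2 : s + 2 ≠ 0 := fun h => by
        have := congrArg Complex.re h
        simp at this; linarith
      simp only [norm_mul]
      have n1 : ‖1 - s‖ = ‖s - 1‖ := norm_sub_rev _ _
      have n2 : ‖1 - (s + 2)‖ = ‖s - 1 + (2 : ℝ)‖ := by
        rw [norm_sub_rev]; congr 1; push_cast; ring
      have n3 : ‖s + 2‖ = ‖s + (2 : ℝ)‖ := by push_cast; rfl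
      rw [Real.log_mul (norm_ne_zero_iff.2 hss2) (norm_ne_zero_iff.2 (sub_ne_zero.2 hs2.symm)),
        Real.log_mul (norm_ne_zero_iff.2 hss) (norm_ne_zero_iff.2 (sub_ne_zero.2 hs1.symm)),
        n1, n2, n3]
      rw [abs_le] at *
      constructor <;> linarith [i1.1, i1.2, i2.1, i2.2]
  have b2 := abs_log_norm_LFunction_le ψ hs
  have b3 := abs_log_norm_LFunction_le ψ (s := s + 2) (by simp; linarith)
  have b4 : |Real.log ‖s + a‖ - Real.log ‖s‖| ≤ Real.log 4 := by
    have ha' : (a : ℝ) ≤ 1 := by exact_mod_cast ha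
    have := abs_log_norm_add_sub_le (s := s) (a := a) (c := 4) (by positivity) (by linarith)
      (by linarith)
    simpa using this
  have b5 : 0 ≤ Real.log N := Real.log_natCast_nonneg N
  have b6 : 0 ≤ Real.log (2 * Real.pi) := Real.log_nonneg (by linarith [Real.pi_gt_three])
  rw [e1, e2]
  rw [abs_le] at *
  constructor <;> linarith [b1.1, b1.2, b2.1, b2.2, b3.1, b3.2, b4.1, b4.2]

theorem exists_isCompletion {q : ℕ} [NeZero q] (χ : DirichletCharacter ℂ q) :
    ∃ F, IsCompletion χ F := by
  have hcond : NeZero χ.conductor := ⟨χ.conductor_ne_zero⟩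
  obtain ⟨F, P, a, ha, hP, hFd, hFg, ⟨ε, hε⟩, hF1, hform⟩ :=
    exists_completion_of_isPrimitive χ.primitiveCharacter_isPrimitive
  have hFne : ∀ s : ℂ, 1 ≤ s.re → F s ≠ 0 := by
    intro s hs
    rcases eq_or_ne s 1 with rfl | hs1
    · exact hF1
    rw [hform s (by linarith) hs1]
    obtain ⟨h1, h2, h3⟩ :=
      completion_prefactor_ne_zero (N := χ.conductor) a hP (by linarith) hs1
    exact mul_ne_zero (mul_ne_zero (mul_ne_zero h1 h2) h3)
      (DirichletCharacter.LFunction_ne_zero_of_one_le_re _ (Or.inr hs1) hs)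
  refine ⟨F, hFd, hFg, ⟨ε, hε⟩, fun s hs => ⟨?_, ?_⟩, fun s hs0 hs1 => ?_,
    completion_shift ha hP hform⟩
  · by_contra! h
    refine hFne (1 - conj s) (by simp [h]) ?_
    rw [hε, hs]; simp
  · by_contra! h
    exact hFne s h hs
  · rw [completion_order_eq χ.conductor_dvd_level hP hform hs0 hs1,
      DirichletCharacter.changeLevel_primitiveCharacter]

/-! ### Zeros above a given height -/

section TailZeros

variable {q : ℕ} [NeZero q] {χ : DirichletCharacter ℂ q} {F : ℂ → ℂ}

lemma IsCompletion.ne_zero_of_one_le (h : IsCompletion χ F) {s : ℂ} (hs : 1 ≤ s.re) : F s ≠ 0 :=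
  fun h0 => absurd (h.zero_re s h0).2 (not_lt.2 hs)

lemma IsCompletion.ne_zero_of_le_zero (h : IsCompletion χ F) {s : ℂ} (hs : s.re ≤ 0) : F s ≠ 0 :=
  fun h0 => absurd (h.zero_re s h0).1 (not_lt.2 hs)

lemma IsCompletion.logDeriv_reflect (h : IsCompletion χ F) {s : ℂ} (hs : F s ≠ 0) :
    logDeriv F (1 - conj s) = -conj (logDeriv F s) := by
  obtain ⟨ε, hε⟩ := h.reflect
  have hε0 : ε ≠ 0 := by
    rintro rfl
    have := hε 0
    simp only [map_zero, sub_zero, zero_mul] at this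
    exact h.ne_zero_of_one_le (by simp) this
  have h1 : HasDerivAt (fun z => F (1 - z)) (-deriv F (1 - conj s)) (conj s) := by
    have := (h.differentiable (1 - conj s)).hasDerivAt.comp (conj s)
      ((hasDerivAt_id (conj s)).const_sub 1)
    simpa [Function.comp_def] using this
  have h2 : HasDerivAt (fun z => ε * conj (F (conj z))) (ε * conj (deriv F s)) (conj s) := by
    have := ((h.differentiable s).hasDerivAt.conj_conj).const_mul ε
    simpa using this
  have h3 : (fun z => F (1 - z)) = fun z => ε * conj (F (conj z)) := by
    ext z
    have := hε (conj z)
    rwa [Complex.conj_conj] at this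
  rw [h3] at h1
  have h4 := h1.unique h2
  have h5 : conj (F s) ≠ 0 := (map_ne_zero _).2 hs
  rw [logDeriv_apply, logDeriv_apply, hε s, map_div₀]
  rw [eq_comm, ← neg_div, div_eq_div_iff h5 (mul_ne_zero hε0 h5)]
  linear_combination conj (F s) * h4

/-- The contribution of a zero `c` and of its mirror image `1 - conj c` to `2 Re (F' / F)` at the
point `σ + i t`. -/
noncomputable def zeroKernel (σ t : ℝ) (c : ℂ) : ℝ :=
  (σ - c.re) / ((σ - c.re) ^ 2 + (t - c.im) ^ 2) +
    (σ - 1 + c.re) / ((σ - 1 + c.re) ^ 2 + (t - c.im) ^ 2)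

/-- By the reflection, `F' / F (s) - F' / F (1 - conj s)` is `2 Re (F' / F) (s)`, and the two points
contribute the two terms of `zeroKernel`. -/
lemma IsCompletion.hasSum_zeroKernel (h : IsCompletion χ F) {σ : ℝ} (hσ : 1 ≤ σ) (t : ℝ) :
    HasSum (fun p : ZeroIndex F => zeroKernel σ t p.val)
      (2 * (logDeriv F (σ + t * Complex.I)).re) := by
  set z : ℂ := σ + t * Complex.I with hz
  have hzr : z.re = σ := by simp [hz]
  have hzi : z.im = t := by simp [hz]
  have hz0 : F z ≠ 0 := h.ne_zero_of_one_le (by rw [hzr]; exact hσ)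
  have hw0 : F (1 - conj z) ≠ 0 := h.ne_zero_of_le_zero (by simp [hzr, hσ])
  have hT := tendsto_sum_logDeriv_sub h.differentiable (by norm_num) (by norm_num) h.growth hw0 hz0
  rw [h.logDeriv_reflect hz0] at hT
  have hT' := (Complex.continuous_re.tendsto _).comp hT
  have hval : (logDeriv F z - -conj (logDeriv F z)).re = 2 * (logDeriv F z).re := by
    simp; ring
  rw [hval] at hT'
  refine hasSum_zeros_of_tendsto h.differentiable hw0 (fun c hc => ?_) (hT'.congr fun R => ?_)
  · obtain ⟨h0, h1⟩ := h.zero_re c hc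
    have a1 : 0 ≤ σ - c.re := by linarith
    have a2 : 0 ≤ σ - 1 + c.re := by linarith
    unfold zeroKernel; positivity
  · rw [Function.comp_apply, Complex.re_sum]
    refine Finset.sum_congr rfl fun c _ => ?_
    rw [← Complex.ofReal_natCast, Complex.re_ofReal_mul]
    congr 1
    rw [zeroKernel, Complex.sub_re, one_div, one_div, Complex.inv_re, Complex.inv_re,
      Complex.normSq_apply, Complex.normSq_apply]
    simp only [Complex.sub_re, Complex.sub_im, Complex.one_re, Complex.one_im, Complex.conj_re,
      Complex.conj_im, hzr, hzi]
    have e1 : (1 - σ - c.re) * (1 - σ - c.re) + (0 - -t - c.im) * (0 - -t - c.im) =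
        (σ - 1 + c.re) ^ 2 + (t - c.im) ^ 2 := by ring
    rw [e1, ← sq, ← sq]
    ring

/-- The mean value theorem on `[σ, σ + 2]`, where `F (s + 2) / F s` is known, gives the sum over
the zeros at some point of the interval. -/
lemma IsCompletion.exists_hasSum_zeroKernel (h : IsCompletion χ F) :
    ∃ C : ℝ, ∀ σ t : ℝ, 2 ≤ σ → ∃ σ' ∈ Set.Ioo σ (σ + 2), ∃ v : ℝ,
      |v - Real.log ‖(σ + t * Complex.I : ℂ)‖| ≤ C ∧
      HasSum (fun p : ZeroIndex F => zeroKernel σ' t p.val) v := by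
  obtain ⟨C, hC⟩ := h.shift
  refine ⟨C, fun σ t hσ => ?_⟩
  set g : ℝ → ℝ := fun x => Real.log ‖F (x + t * Complex.I)‖ with hg
  have hder : ∀ x : ℝ, 1 ≤ x → HasDerivAt g (logDeriv F (x + t * Complex.I)).re x := by
    intro x hx
    have hne : F (x + t * Complex.I) ≠ 0 := h.ne_zero_of_one_le (by simp [hx])
    have h1 : HasDerivAt (fun y : ℝ => F (y + t * Complex.I)) (deriv F (x + t * Complex.I)) x := by
      have h2 := (h.differentiable (x + t * Complex.I)).hasDerivAt
      have h3 : HasDerivAt (fun y : ℝ => (y : ℂ) + t * Complex.I) 1 x :=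
        (Complex.ofRealCLM.hasDerivAt (x := x)).add_const _
      simpa [Function.comp_def] using h2.comp x h3
    have h4 := (h1.norm_sq.log (by positivity)).div_const 2
    have h5 : g = fun y : ℝ => Real.log (‖F (y + t * Complex.I)‖ ^ 2) / 2 := by
      ext y; rw [Real.log_pow]; simp [hg]
    rw [h5]
    refine h4.congr_deriv ?_
    rw [logDeriv_apply, Complex.div_re, Complex.inner, ← Complex.normSq_eq_norm_sq]
    simp only [Complex.mul_re, Complex.conj_re, Complex.conj_im]
    ring
  obtain ⟨σ', hσ', hslope⟩ := exists_hasDerivAt_eq_slope g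
    (fun x => (logDeriv F (x + t * Complex.I)).re) (by linarith : σ < σ + 2)
    (fun x hx => (hder x (by linarith [hx.1])).continuousAt.continuousWithinAt)
    (fun x hx => hder x (by linarith [hx.1]))
  refine ⟨σ', hσ', _, ?_, h.hasSum_zeroKernel (by linarith [hσ'.1]) t⟩
  rw [hslope]
  have h1 := hC (σ + t * Complex.I) (by simp [hσ])
  have h2 : (2 : ℝ) * ((g (σ + 2) - g σ) / (σ + 2 - σ)) = g (σ + 2) - g σ := by
    field_simp; ring
  rw [h2]
  simp only [hg]
  convert h1 using 6
  push_cast; ring_nf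

/-- The kernel is comparable to the Poisson kernel of height `σ`, whatever the real part of the
zero in the critical strip. -/
lemma zeroKernel_lower {σ σ' t : ℝ} {c : ℂ} (hσ : 2 ≤ σ) (hσ' : σ' ∈ Set.Ioo σ (σ + 2))
    (h0 : 0 < c.re) (h1 : c.re < 1) :
    σ / (σ ^ 2 + (t - c.im) ^ 2) ≤ 4 * zeroKernel σ' t c := by
  have key : ∀ a : ℝ, σ / 2 ≤ a → a ≤ 2 * σ →
      σ / (σ ^ 2 + (t - c.im) ^ 2) ≤ 8 * (a / (a ^ 2 + (t - c.im) ^ 2)) := by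
    intro a ha hb
    have ha0 : 0 < a := by linarith
    have hs0 : 0 < σ := by linarith
    rw [mul_div_assoc', div_le_div_iff₀ (by positivity) (by positivity)]
    nlinarith [sq_nonneg (t - c.im), mul_nonneg ha0.le (sq_nonneg (t - c.im)),
      mul_pos ha0 hs0, mul_nonneg (sub_nonneg.2 hb) (mul_pos ha0 hs0).le,
      mul_nonneg (sub_nonneg.2 ha) (sq_nonneg (t - c.im)), mul_pos (mul_pos ha0 hs0) hs0]
  have k1 := key (σ' - c.re) (by linarith [hσ'.1]) (by linarith [hσ'.2])
  have k2 := key (σ' - 1 + c.re) (by linarith [hσ'.1]) (by linarith [hσ'.2])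
  unfold zeroKernel
  linarith

lemma zeroKernel_upper {σ σ' t : ℝ} {c : ℂ} (hσ : 2 ≤ σ) (hσ' : σ' ∈ Set.Ioo σ (σ + 2))
    (h0 : 0 < c.re) (h1 : c.re < 1) :
    zeroKernel σ' t c ≤ 16 * (σ / (σ ^ 2 + (t - c.im) ^ 2)) := by
  have key : ∀ a : ℝ, σ / 2 ≤ a → a ≤ 2 * σ →
      a / (a ^ 2 + (t - c.im) ^ 2) ≤ 8 * (σ / (σ ^ 2 + (t - c.im) ^ 2)) := by
    intro a ha hb
    have ha0 : 0 < a := by linarith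
    have hs0 : 0 < σ := by linarith
    rw [mul_div_assoc', div_le_div_iff₀ (by positivity) (by positivity)]
    nlinarith [sq_nonneg (t - c.im), mul_nonneg hs0.le (sq_nonneg (t - c.im)),
      mul_pos ha0 hs0, mul_nonneg (sub_nonneg.2 ha) (mul_pos ha0 hs0).le,
      mul_nonneg (sub_nonneg.2 hb) (sq_nonneg (t - c.im)), mul_pos (mul_pos ha0 hs0) ha0]
  have k1 := key (σ' - c.re) (by linarith [hσ'.1]) (by linarith [hσ'.2])
  have k2 := key (σ' - 1 + c.re) (by linarith [hσ'.1]) (by linarith [hσ'.2])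
  unfold zeroKernel
  linarith

/-- The Poisson kernel at distance `σ` from the critical strip, summed over the zeros, is of the size
of `log |σ + i t|`, uniformly in `σ ≥ 2` and `t`. -/
lemma IsCompletion.poisson_bounds (h : IsCompletion χ F) :
    ∃ C : ℝ, 0 ≤ C ∧ ∀ σ t : ℝ, 2 ≤ σ →
      Summable (fun p : ZeroIndex F => σ / (σ ^ 2 + (t - p.val.im) ^ 2)) ∧
      ∑' p : ZeroIndex F, σ / (σ ^ 2 + (t - p.val.im) ^ 2) ≤
        4 * (Real.log ‖(σ + t * Complex.I : ℂ)‖ + C) ∧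
      (Real.log ‖(σ + t * Complex.I : ℂ)‖ - C) / 16 ≤
        ∑' p : ZeroIndex F, σ / (σ ^ 2 + (t - p.val.im) ^ 2) := by
  obtain ⟨C, hC⟩ := h.exists_hasSum_zeroKernel
  refine ⟨C, ?_, fun σ t hσ => ?_⟩
  · obtain ⟨_, _, v, hv, _⟩ := hC 2 0 le_rfl
    exact (abs_nonneg _).trans hv
  obtain ⟨σ', hσ', v, hv, hs⟩ := hC σ t hσ
  have hz : ∀ p : ZeroIndex F, 0 < p.val.re ∧ p.val.re < 1 := fun p => h.zero_re _ p.apply_val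
  have hnn : ∀ p : ZeroIndex F, 0 ≤ σ / (σ ^ 2 + (t - p.val.im) ^ 2) := fun p => by
    have : 0 ≤ σ := by linarith
    positivity
  have hlow := fun p : ZeroIndex F => zeroKernel_lower (t := t) hσ hσ' (hz p).1 (hz p).2
  have hup := fun p : ZeroIndex F => zeroKernel_upper (t := t) hσ hσ' (hz p).1 (hz p).2
  have hsum : Summable (fun p : ZeroIndex F => σ / (σ ^ 2 + (t - p.val.im) ^ 2)) :=
    Summable.of_nonneg_of_le hnn hlow (hs.summable.mul_left 4)
  rw [abs_le] at hv
  refine ⟨hsum, ?_, ?_⟩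
  · have := hasSum_le hlow hsum.hasSum (hs.mul_left 4)
    linarith
  · have := hasSum_le hup hs (hsum.hasSum.mul_left 16)
    linarith

/-- The zeros counted by `TailZero χ u`, as zeros of the completed function. -/
noncomputable def IsCompletion.tailZeroEquiv (h : IsCompletion χ F) (u : ℝ) :
    TailZero χ u ≃ {p : ZeroIndex F | u < p.val.im} where
  toFun z := ⟨⟨z.1, by
    obtain ⟨h0, h1, _, _, h3⟩ := z.2
    have e : analyticOrderNatAt F z.1.1 = analyticOrderNatAt χ.LFunction z.1.1 := by
      rw [analyticOrderNatAt, analyticOrderNatAt, h.order_eq _ h0 h1]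
    exact ⟨apply_eq_zero_of_analyticOrderNatAt_ne_zero (by omega), by omega⟩⟩, z.2.2.2.1⟩
  invFun p := ⟨p.1.1, by
    obtain ⟨h0, h1⟩ := h.zero_re _ p.1.2.1
    have e : analyticOrderNatAt F p.1.1.1 = analyticOrderNatAt χ.LFunction p.1.1.1 := by
      rw [analyticOrderNatAt, analyticOrderNatAt, h.order_eq _ h0 h1]
    have h2 := p.1.2.2
    exact ⟨h0, h1, p.2, apply_eq_zero_of_analyticOrderNatAt_ne_zero (by omega), by omega⟩⟩
  left_inv _ := rfl
  right_inv _ := rfl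

lemma IsCompletion.summable_inv (h : IsCompletion χ F) :
    Summable fun p : ZeroIndex F => 1 / (1 / 4 + p.val.im ^ 2) := by
  obtain ⟨C, _, hC⟩ := h.poisson_bounds
  have h1 := (hC 2 0 le_rfl).1.mul_left 8
  refine Summable.of_nonneg_of_le (fun p => by positivity) (fun p => ?_) h1
  rw [mul_div_assoc', div_le_div_iff₀ (by positivity) (by positivity)]
  nlinarith [sq_nonneg p.val.im]

lemma inv_pow_le {g : ℝ} {k : ℕ} (hk : 1 ≤ k) :
    1 / (1 / 4 + g ^ 2) ^ k ≤ 4 ^ (k - 1) * (1 / (1 / 4 + g ^ 2)) := by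
  obtain ⟨n, rfl⟩ := Nat.exists_eq_add_of_le' hk
  rw [← one_div_pow, pow_succ, Nat.add_sub_cancel]
  have h4 : 1 / (1 / 4 + g ^ 2) ≤ 4 := by
    rw [div_le_iff₀ (by positivity)]; nlinarith [sq_nonneg g]
  exact mul_le_mul_of_nonneg_right (pow_le_pow_left₀ (by positivity) h4 n) (by positivity)

lemma summable_tailZero (χ : DirichletCharacter ℂ q) (u : ℝ) {k : ℕ} (hk : 1 ≤ k) :
    Summable fun z : TailZero χ u => 1 / (1 / 4 + z.ordinate ^ 2) ^ k := by
  obtain ⟨F, h⟩ := exists_isCompletion χ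
  have h1 := (h.summable_inv.subtype {p : ZeroIndex F | u < p.val.im})
  have h2 := ((h.tailZeroEquiv u).summable_iff.2 h1).mul_left (4 ^ (k - 1))
  exact Summable.of_nonneg_of_le (fun z => by positivity) (fun z => inv_pow_le hk) h2

lemma IsCompletion.b_eq (h : IsCompletion χ F) (k : ℕ) (u : ℝ) :
    b k χ u = ∑' p : ZeroIndex F,
      {p : ZeroIndex F | u < p.val.im}.indicator (fun p => 1 / (1 / 4 + p.val.im ^ 2) ^ k) p := by
  rw [← tsum_subtype, ← (h.tailZeroEquiv u).tsum_eq]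
  rfl

lemma IsCompletion.summable_indicator (h : IsCompletion χ F) {k : ℕ} (hk : 1 ≤ k) (u : ℝ) :
    Summable ({p : ZeroIndex F | u < p.val.im}.indicator
      (fun p => 1 / (1 / 4 + p.val.im ^ 2) ^ k)) := by
  refine Summable.indicator (Summable.of_nonneg_of_le (fun p => by positivity)
    (fun p => inv_pow_le hk) (h.summable_inv.mul_left (4 ^ (k - 1)))) _

lemma b_antitone (χ : DirichletCharacter ℂ q) {k : ℕ} (hk : 1 ≤ k) : Antitone (b k χ) := by
  obtain ⟨F, h⟩ := exists_isCompletion χ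
  intro u v huv
  rw [h.b_eq, h.b_eq]
  refine (h.summable_indicator hk v).tsum_le_tsum (fun p => ?_) (h.summable_indicator hk u)
  refine Set.indicator_le_indicator_of_subset (fun p hp => lt_of_le_of_lt huv hp)
    (fun p => by positivity) p

lemma b_nonneg (k : ℕ) (χ : DirichletCharacter ℂ q) (u : ℝ) : 0 ≤ b k χ u :=
  tsum_nonneg fun z => by positivity

/-- Few zeros: `b_1(χ, u) ≪ log u / u`. -/
lemma IsCompletion.b_one_le (h : IsCompletion χ F) {C u : ℝ} (hu : 2 ≤ u)
    (hs : Summable (fun p : ZeroIndex F => u / (u ^ 2 + (0 - p.val.im) ^ 2)))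
    (hC : ∑' p : ZeroIndex F, u / (u ^ 2 + (0 - p.val.im) ^ 2) ≤ C) :
    b 1 χ u ≤ 2 / u * C := by
  have hu0 : 0 < u := by linarith
  refine le_trans ?_ (mul_le_mul_of_nonneg_left hC (by positivity : 0 ≤ 2 / u))
  rw [h.b_eq, ← tsum_mul_left]
  refine (h.summable_indicator le_rfl u).tsum_le_tsum (fun p => ?_) (hs.mul_left _)
  by_cases hp : u < p.val.im
  · rw [Set.indicator_of_mem (show p ∈ {p : ZeroIndex F | u < p.val.im} from hp)]
    have e : 2 / u * (u / (u ^ 2 + (0 - p.val.im) ^ 2)) = 2 / (u ^ 2 + p.val.im ^ 2) := by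
      field_simp; ring
    rw [e, pow_one, div_le_div_iff₀ (by positivity) (by positivity)]
    nlinarith
  · rw [Set.indicator_of_notMem (show p ∉ {p : ZeroIndex F | u < p.val.im} from hp)]
    positivity

/-- Many zeros between `u` and `2 u`: the Poisson kernels of heights `ε u` and `u` above
`3 u / 2` are compared. -/
lemma IsCompletion.le_b_two (h : IsCompletion χ F) {ε u : ℝ} (hε : 0 < ε) (hu : 0 < u)
    (hs : Summable (fun p : ZeroIndex F => (ε * u) / ((ε * u) ^ 2 + (3 / 2 * u - p.val.im) ^ 2)))
    (hs' : Summable (fun p : ZeroIndex F => u / (u ^ 2 + (3 / 2 * u - p.val.im) ^ 2))) :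
    ∑' p : ZeroIndex F, (ε * u) / ((ε * u) ^ 2 + (3 / 2 * u - p.val.im) ^ 2) ≤
      5 * ε * ∑' p : ZeroIndex F, u / (u ^ 2 + (3 / 2 * u - p.val.im) ^ 2) +
      (1 / 4 + 4 * u ^ 2) ^ 2 / (ε * u) * b 2 χ u := by
  rw [h.b_eq, ← tsum_mul_left, ← tsum_mul_left, ← (hs'.mul_left _).tsum_add
    ((h.summable_indicator (by norm_num) u).mul_left _)]
  refine hs.tsum_le_tsum (fun p => ?_) ((hs'.mul_left _).add
    ((h.summable_indicator (by norm_num) u).mul_left _))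
  set x := 3 / 2 * u - p.val.im with hx
  have hind : 0 ≤ (1 / 4 + 4 * u ^ 2) ^ 2 / (ε * u) * {p : ZeroIndex F | u < p.val.im}.indicator
      (fun p => 1 / (1 / 4 + p.val.im ^ 2) ^ 2) p :=
    mul_nonneg (by positivity) (Set.indicator_nonneg (fun p _ => by positivity) p)
  by_cases hnear : |x| < u / 2
  · rw [abs_lt] at hnear
    have hmem : u < p.val.im := by linarith
    have h2u : p.val.im < 2 * u := by linarith
    have h1 : 0 ≤ 5 * ε * (u / (u ^ 2 + x ^ 2)) := by positivity
    refine le_trans ?_ (le_add_of_nonneg_left h1)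
    rw [Set.indicator_of_mem (show p ∈ {p : ZeroIndex F | u < p.val.im} from hmem)]
    have h2 : ε * u / ((ε * u) ^ 2 + x ^ 2) ≤ 1 / (ε * u) := by
      rw [div_le_div_iff₀ (by positivity) (by positivity)]
      nlinarith [sq_nonneg x]
    refine h2.trans ?_
    have h3 : 1 ≤ (1 / 4 + 4 * u ^ 2) ^ 2 * (1 / (1 / 4 + p.val.im ^ 2) ^ 2) := by
      rw [mul_one_div, le_div_iff₀ (by positivity), one_mul]
      refine pow_le_pow_left₀ (by positivity) ?_ 2
      nlinarith
    calc 1 / (ε * u) = 1 / (ε * u) * 1 := by ring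
      _ ≤ 1 / (ε * u) * ((1 / 4 + 4 * u ^ 2) ^ 2 * (1 / (1 / 4 + p.val.im ^ 2) ^ 2)) := by gcongr
      _ = _ := by ring
  · refine le_trans ?_ (le_add_of_nonneg_right hind)
    have hx2 : u ^ 2 ≤ 4 * x ^ 2 := by
      rw [not_lt] at hnear
      have := mul_self_le_mul_self (by positivity) hnear
      rw [← sq, ← sq, sq_abs] at this
      linarith
    rw [mul_div_assoc', div_le_div_iff₀ (by positivity) (by positivity)]
    have h0 : u ^ 2 + x ^ 2 ≤ 5 * ((ε * u) ^ 2 + x ^ 2) := by nlinarith [sq_nonneg (ε * u)]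
    nlinarith [mul_pos hε hu]

/-- The zeros above `u` are concentrated near `u`: a positive proportion of the sum `b_1(χ, u)` comes
from zeros with `γ` of the size of `u`. -/
theorem exists_mul_b_one_le (χ : DirichletCharacter ℂ q) :
    ∃ c : ℝ, 0 < c ∧ ∀ u : ℝ, 0 ≤ u → c * b 1 χ u ≤ (1 / 4 + u ^ 2) * b 2 χ u := by
  obtain ⟨F, h⟩ := exists_isCompletion χ
  obtain ⟨C, hC0, hC⟩ := h.poisson_bounds
  -- the Poisson sum at height `ε u` is about `log u / 16` or more, and with this `ε` the zeros
  -- farther than `u / 2` from `3 u / 2` contribute at most about `log u / 64` to it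
  set ε : ℝ := 1 / 1280 with hε
  -- for `u ≥ U`, both bounds hold and `log u` dominates all constants
  set U : ℝ := Real.exp (16 * (C + 2) + 2560) with hU
  have hU2 : 2560 ≤ U := by
    have := Real.add_one_le_exp (16 * (C + 2) + 2560)
    linarith
  have hlarge : ∀ u, U ≤ u → 0 < b 2 χ u ∧
      ε / 25600 * b 1 χ u ≤ (1 / 4 + u ^ 2) * b 2 χ u := by
    intro u hu
    have hu0 : 0 < u := by linarith
    have hu1 : 1 ≤ u := by linarith
    have hlog : 16 * (C + 2) + 2560 ≤ Real.log u := by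
      rw [Real.le_log_iff_exp_le hu0]; exact hu
    obtain ⟨s1, u1, -⟩ := hC u 0 (by linarith)
    obtain ⟨s2, u2, -⟩ := hC u (3 / 2 * u) (by linarith)
    obtain ⟨s3, -, l3⟩ := hC (ε * u) (3 / 2 * u) (by rw [hε]; linarith)
    have n1 : Real.log ‖((u : ℂ) + (0 : ℝ) * Complex.I)‖ = Real.log u := by
      simp [abs_of_pos hu0]
    have n2 : Real.log ‖((u : ℂ) + (3 / 2 * u : ℝ) * Complex.I)‖ ≤ Real.log u + 1 := by
      have e : ‖((u : ℂ) + (3 / 2 * u : ℝ) * Complex.I)‖ ≤ 5 / 2 * u := by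
        refine (norm_add_le _ _).trans ?_
        simp only [norm_mul, Complex.norm_real, Complex.norm_I, mul_one,
          Real.norm_of_nonneg hu0.le, Real.norm_of_nonneg (by positivity : 0 ≤ 3 / 2 * u)]
        linarith
      have e0 : 0 < ‖((u : ℂ) + (3 / 2 * u : ℝ) * Complex.I)‖ := by
        refine norm_pos_iff.2 fun h0 => ?_
        have := congrArg Complex.re h0
        simp at this
        exact hu0.ne' this
      have := Real.log_le_log e0 e
      rw [Real.log_mul (by norm_num) hu0.ne'] at this
      have e2 : Real.log (5 / 2) ≤ 1 := by
        rw [Real.log_le_iff_le_exp (by norm_num)]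
        linarith [Real.exp_one_gt_d9]
      linarith
    have n3 : Real.log u ≤ Real.log ‖((ε * u : ℝ) : ℂ) + (3 / 2 * u : ℝ) * Complex.I‖ := by
      refine Real.log_le_log hu0 ?_
      have := Complex.abs_im_le_norm (((ε * u : ℝ) : ℂ) + (3 / 2 * u : ℝ) * Complex.I)
      simp only [Complex.add_im, Complex.ofReal_im, Complex.mul_im, Complex.I_re, Complex.I_im,
        Complex.ofReal_re, mul_zero, mul_one, zero_add, add_zero] at this
      rw [abs_of_pos (by positivity)] at this
      linarith
    rw [n1] at u1
    have hb1 := h.b_one_le (by linarith) s1 u1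
    have hb2 := h.le_b_two (ε := ε) (by rw [hε]; norm_num) hu0 s3 s2
    have hB : Real.log u / 64 ≤ (1 / 4 + 4 * u ^ 2) ^ 2 / (ε * u) * b 2 χ u := by
      have : 5 * ε * ∑' p : ZeroIndex F, u / (u ^ 2 + (3 / 2 * u - p.val.im) ^ 2) ≤
          5 * ε * (4 * (Real.log u + 1 + C)) :=
        mul_le_mul_of_nonneg_left (by linarith) (by rw [hε]; norm_num)
      rw [hε] at this hb2 ⊢
      linarith
    have hεu : 0 < ε * u := by rw [hε]; positivity
    have hB2 : ε * u * Real.log u / 64 ≤ (1 / 4 + 4 * u ^ 2) ^ 2 * b 2 χ u := by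
      have := mul_le_mul_of_nonneg_left hB hεu.le
      have e : ε * u * ((1 / 4 + 4 * u ^ 2) ^ 2 / (ε * u) * b 2 χ u) =
        (1 / 4 + 4 * u ^ 2) ^ 2 * b 2 χ u := by field_simp
      rw [e] at this
      linarith
    have hlog0 : 0 < Real.log u := by linarith
    have hpos : 0 < b 2 χ u := by
      have : 0 < (1 / 4 + 4 * u ^ 2) ^ 2 * b 2 χ u := lt_of_lt_of_le (by positivity) hB2
      exact pos_of_mul_pos_right this (by positivity)
    refine ⟨hpos, ?_⟩
    have h5 : (1 / 4 + 4 * u ^ 2) ^ 2 ≤ 25 * u ^ 2 * (1 / 4 + u ^ 2) := by nlinarith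
    have h6 : ε * u * Real.log u / 64 ≤ 25 * u ^ 2 * ((1 / 4 + u ^ 2) * b 2 χ u) := by
      rw [← mul_assoc]
      exact hB2.trans (mul_le_mul_of_nonneg_right h5 hpos.le)
    have h7 : b 1 χ u ≤ 16 * Real.log u / u := by
      refine hb1.trans ?_
      rw [div_mul_eq_mul_div]
      refine div_le_div_of_nonneg_right ?_ hu0.le
      linarith
    have h8 : ε / 25600 * b 1 χ u ≤ ε / 25600 * (16 * Real.log u / u) :=
      mul_le_mul_of_nonneg_left h7 (by rw [hε]; norm_num)
    refine h8.trans ?_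
    have h9 : ε / 25600 * (16 * Real.log u / u) = (ε * u * Real.log u / 64) / (25 * u ^ 2) := by
      field_simp; norm_num
    rw [h9, div_le_iff₀ (by positivity)]
    linarith
  -- on `[0, U]` both sides are bounded away from `0` and `∞` by monotonicity
  have hb2U := (hlarge U le_rfl).1
  have hb0 := b_nonneg 1 χ 0
  refine ⟨min (ε / 25600) (b 2 χ U / (4 * (b 1 χ 0 + 1))), lt_min (by rw [hε]; norm_num)
    (by positivity), fun u hu => ?_⟩
  rcases le_total U u with hUu | hUu
  · exact (mul_le_mul_of_nonneg_right (min_le_left _ _) (b_nonneg _ _ _)).trans (hlarge u hUu).2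
  · have h1 : b 1 χ u ≤ b 1 χ 0 + 1 := by linarith [b_antitone χ (le_refl 1) hu]
    have h2 := b_antitone χ (by norm_num : 1 ≤ 2) hUu
    calc _ ≤ b 2 χ U / (4 * (b 1 χ 0 + 1)) * (b 1 χ 0 + 1) :=
          mul_le_mul (min_le_right _ _) h1 (b_nonneg _ _ _) (by positivity)
      _ = 1 / 4 * b 2 χ U := by field_simp
      _ ≤ (1 / 4 + u ^ 2) * b 2 χ u := by
          refine mul_le_mul (by nlinarith [sq_nonneg u]) h2 hb2U.le (by positivity)

end TailZeros

/-! ### The Bessel function `J_0` and its zeros -/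

/-- A power series whose coefficients are at most those of the exponential may be differentiated
term by term on the whole plane. -/
lemma hasDerivAt_tsum_pow {a : ℕ → ℂ} (ha : ∀ n, ‖a n‖ ≤ 1 / (n ! : ℝ)) (z : ℂ) :
    HasDerivAt (fun z => ∑' n, a n * z ^ n) (∑' n, ((n + 1 : ℕ) * a (n + 1)) * z ^ n) z := by
  set R := ‖z‖ + 1 with hR
  have hR0 : 0 < R := by positivity
  set v : ℕ → ℝ := fun n => (n : ℝ) * (1 / (n ! : ℝ)) * R ^ (n - 1) with hv
  have hvs : Summable v := by
    rw [← summable_nat_add_iff 1]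
    refine (Real.summable_pow_div_factorial R).congr fun n => ?_
    simp only [hv, Nat.add_sub_cancel, Nat.factorial_succ]
    push_cast
    field_simp
  have h := hasDerivAt_tsum_of_isPreconnected (g := fun n z => a n * z ^ n)
    (g' := fun n z => a n * (n * z ^ (n - 1))) (t := Metric.ball 0 R) (y₀ := 0) (y := z) hvs
    Metric.isOpen_ball (convex_ball 0 R).isPreconnected
    (fun n y _ => (hasDerivAt_pow n y).const_mul (a n)) (fun n y hy => ?_)
    (Metric.mem_ball_self hR0) ?_ (by simp [hR])
  · refine h.congr_deriv ?_
    have hs : Summable fun n => a n * (n * z ^ (n - 1)) := by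
      refine Summable.of_norm_bounded hvs fun n => ?_
      rw [norm_mul, norm_mul, norm_pow, Complex.norm_natCast]
      simp only [hv]
      rw [mul_comm (n : ℝ) (1 / (n ! : ℝ)), mul_assoc]
      exact mul_le_mul (ha n) (mul_le_mul_of_nonneg_left
        (pow_le_pow_left₀ (norm_nonneg _) (by simp [hR]) _) (by positivity)) (by positivity)
        (by positivity)
    rw [hs.tsum_eq_zero_add]
    simp only [Nat.cast_zero, zero_mul, mul_zero, zero_add, Nat.add_sub_cancel]
    exact tsum_congr fun n => by ring
  · have hy' : ‖y‖ ≤ R := (by simpa using hy : ‖y‖ < R).le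
    rw [norm_mul, norm_mul, norm_pow, Complex.norm_natCast]
    simp only [hv]
    rw [mul_comm (n : ℝ) (1 / (n ! : ℝ)), mul_assoc]
    exact mul_le_mul (ha n) (mul_le_mul_of_nonneg_left
      (pow_le_pow_left₀ (norm_nonneg _) hy' _) (by positivity)) (by positivity) (by positivity)
  · refine summable_of_ne_finset_zero (s := {0}) fun n hn => ?_
    rw [Finset.mem_singleton] at hn
    simp [hn]

/-- The entire function `∑ z ^ n / (n !) ^ 2`, so that `J_0(w) = besselSeries (-w ^ 2 / 4)` and
`I_0(w) = besselSeries (w ^ 2 / 4)`. -/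
noncomputable def besselSeries (z : ℂ) : ℂ := ∑' n : ℕ, (1 / (n ! : ℂ) ^ 2) * z ^ n

/-- The function `z ↦ z * besselSeries' z`. -/
noncomputable def besselEuler (z : ℂ) : ℂ := ∑' n : ℕ, ((n : ℂ) / (n ! : ℂ) ^ 2) * z ^ n

lemma besselSeries_coeff_le (n : ℕ) : ‖(1 / (n ! : ℂ) ^ 2)‖ ≤ 1 / (n ! : ℝ) := by
  have h1 : (1 : ℝ) ≤ n ! := by exact_mod_cast Nat.one_le_iff_ne_zero.2 n.factorial_ne_zero
  rw [norm_div, norm_one, norm_pow, Complex.norm_natCast]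
  exact one_div_le_one_div_of_le (by positivity) (by nlinarith)

lemma besselEuler_coeff_le (n : ℕ) : ‖((n : ℂ) / (n ! : ℂ) ^ 2)‖ ≤ 1 / (n ! : ℝ) := by
  have h1 : (n : ℝ) ≤ n ! := by exact_mod_cast n.self_le_factorial
  have h2 : (0 : ℝ) < n ! := by exact_mod_cast n.factorial_pos
  rw [norm_div, norm_pow, Complex.norm_natCast, Complex.norm_natCast,
    div_le_div_iff₀ (by positivity) h2]
  nlinarith

lemma hasDerivAt_besselEuler (z : ℂ) : HasDerivAt besselEuler (besselSeries z) z := by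
  refine (hasDerivAt_tsum_pow besselEuler_coeff_le z).congr_deriv ?_
  refine tsum_congr fun n => ?_
  congr 1
  rw [Nat.factorial_succ]
  have h2 : (n ! : ℂ) ≠ 0 := by exact_mod_cast n.factorial_ne_zero
  have h3 : ((n + 1 : ℕ) : ℂ) ≠ 0 := by exact_mod_cast n.succ_ne_zero
  push_cast at *
  field_simp

lemma hasDerivAt_besselSeries (z : ℂ) : HasDerivAt besselSeries (deriv besselSeries z) z :=
  (hasDerivAt_tsum_pow besselSeries_coeff_le z).differentiableAt.hasDerivAt

lemma differentiable_besselSeries : Differentiable ℂ besselSeries :=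
  fun z => (hasDerivAt_besselSeries z).differentiableAt

lemma summable_besselSeries (z : ℂ) : Summable fun n : ℕ => (1 / (n ! : ℂ) ^ 2) * z ^ n := by
  refine Summable.of_norm_bounded (Real.summable_pow_div_factorial ‖z‖) fun n => ?_
  rw [norm_mul, norm_pow, mul_comm]
  exact (mul_le_mul_of_nonneg_left (besselSeries_coeff_le n) (by positivity)).trans_eq
    (mul_one_div _ _)

lemma mul_deriv_besselSeries (z : ℂ) : z * deriv besselSeries z = besselEuler z := by
  have h := (hasDerivAt_tsum_pow besselSeries_coeff_le z).deriv
  change deriv besselSeries z = _ at h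
  have hs : Summable fun n : ℕ => ((n : ℂ) / (n ! : ℂ) ^ 2) * z ^ n := by
    refine Summable.of_norm_bounded (Real.summable_pow_div_factorial ‖z‖) fun n => ?_
    rw [norm_mul, norm_pow, mul_comm]
    exact (mul_le_mul_of_nonneg_left (besselEuler_coeff_le n) (by positivity)).trans_eq
      (mul_one_div _ _)
  rw [h, besselEuler, hs.tsum_eq_zero_add, ← tsum_mul_left]
  simp only [Nat.cast_zero, zero_div, zero_mul, zero_add]
  refine tsum_congr fun n => ?_
  ring

lemma besselSeries_zero : besselSeries 0 = 1 := by
  rw [besselSeries, tsum_eq_single 0 (fun n hn => by simp [hn])]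
  simp

lemma deriv_besselSeries_zero : deriv besselSeries 0 = 1 := by
  have h := (hasDerivAt_tsum_pow besselSeries_coeff_le 0).deriv
  change deriv besselSeries 0 = _ at h
  rw [h, tsum_eq_single 0 (fun n hn => by simp [hn])]
  simp

/-- The restriction of `besselSeries` to the real line. -/
noncomputable def besselReal (x : ℝ) : ℝ := ∑' n : ℕ, (1 / (n ! : ℝ) ^ 2) * x ^ n

lemma ofReal_besselReal (x : ℝ) : (besselReal x : ℂ) = besselSeries x := by
  rw [besselReal, besselSeries, Complex.ofReal_tsum]
  exact tsum_congr fun n => by push_cast; rfl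

lemma J0_eq_besselReal (w : ℝ) : J0 w = besselReal (-(w ^ 2 / 4)) := by
  rw [J0, besselReal]
  refine tsum_congr fun n => ?_
  have h : (-(w ^ 2 / 4)) ^ n = (-1) ^ n * (w / 2) ^ (2 * n) := by
    rw [neg_pow, pow_mul]
    congr 2
    ring
  rw [h]
  ring

lemma summable_besselReal (x : ℝ) : Summable fun n : ℕ => (1 / (n ! : ℝ) ^ 2) * x ^ n := by
  rw [← Complex.summable_ofReal]
  refine (summable_besselSeries x).congr fun n => by push_cast; rfl

lemma one_le_besselReal {x : ℝ} (hx : 0 ≤ x) : 1 ≤ besselReal x := by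
  have h := (summable_besselReal x).le_tsum 0 fun n _ => by positivity
  simpa [besselReal] using h

/-- Growth of order `1 / 2`: `n`-th term of the series is the square of that of `exp √|z|`. -/
lemma hasGrowth_besselSeries : HasGrowth besselSeries (1 / 2) := by
  refine ⟨2, fun z => ?_⟩
  set x := √‖z‖ with hx
  have hx0 : 0 ≤ x := Real.sqrt_nonneg _
  have hexp : HasSum (fun n : ℕ => x ^ n / (n ! : ℝ)) (Real.exp x) := by
    rw [Real.exp_eq_exp_ℝ]; exact NormedSpace.expSeries_div_hasSum_exp x
  have hterm : ∀ n : ℕ, x ^ n / (n ! : ℝ) ≤ Real.exp x := fun n =>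
    le_hasSum hexp n fun m _ => by positivity
  have h1 : ‖besselSeries z‖ ≤ Real.exp x * Real.exp x := by
    refine tsum_of_norm_bounded (hexp.mul_left (Real.exp x)) fun n => ?_
    have e : ‖1 / (n ! : ℂ) ^ 2 * z ^ n‖ = (x ^ n / (n ! : ℝ)) * (x ^ n / (n ! : ℝ)) := by
      have hz : ‖z‖ = x * x := (Real.mul_self_sqrt (norm_nonneg z)).symm
      rw [norm_mul, norm_pow, norm_div, norm_one, norm_pow, Complex.norm_natCast, hz, mul_pow]
      ring
    rw [e]
    exact mul_le_mul_of_nonneg_right (hterm n) (by positivity)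
  refine h1.trans ?_
  rw [← Real.exp_add]
  refine Real.exp_le_exp.2 ?_
  have : x ≤ (1 + ‖z‖) ^ (1 / 2 : ℝ) := by
    rw [hx, Real.sqrt_eq_rpow]
    exact Real.rpow_le_rpow (norm_nonneg _) (by linarith) (by norm_num)
  linarith

/-- The zeros of `besselSeries` are real: by the differential equation `(z f')' = f`, the
derivative of `Im (x ζ f' (x ζ) * conj (f (x ζ)))` is `Im ζ * |f (x ζ)| ^ 2`. -/
lemma im_eq_zero_of_besselSeries_eq_zero {ζ : ℂ} (hζ : besselSeries ζ = 0) : ζ.im = 0 := by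
  set v : ℝ → ℝ := fun x => (besselEuler (ζ * x) * conj (besselSeries (ζ * x))).im with hv
  have hder : ∀ x : ℝ, HasDerivAt v (ζ.im * ‖besselSeries (ζ * x)‖ ^ 2) x := by
    intro x
    have hlin : HasDerivAt (fun y : ℝ => ζ * (y : ℂ)) ζ x := by
      simpa using (Complex.ofRealCLM.hasDerivAt (x := x)).const_mul ζ
    have h1 : HasDerivAt (fun y : ℝ => besselEuler (ζ * y)) (besselSeries (ζ * x) * ζ) x :=
      HasDerivAt.comp (h := fun y : ℝ => ζ * (y : ℂ)) x (hasDerivAt_besselEuler (ζ * x)) hlin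
    have h2 : HasDerivAt (fun y : ℝ => besselSeries (ζ * y)) (deriv besselSeries (ζ * x) * ζ) x :=
      HasDerivAt.comp (h := fun y : ℝ => ζ * (y : ℂ)) x (hasDerivAt_besselSeries (ζ * x)) hlin
    have h3 : HasDerivAt (fun y : ℝ => conj (besselSeries (ζ * y)))
        (conj (deriv besselSeries (ζ * x) * ζ)) x :=
      Complex.conjCLE.toContinuousLinearMap.hasFDerivAt.comp_hasDerivAt x h2
    have h4 := Complex.imCLM.hasFDerivAt.comp_hasDerivAt x (h1.mul h3)
    refine HasDerivAt.congr_deriv (f := v) h4 ?_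
    rw [← mul_deriv_besselSeries]
    set A := besselSeries (ζ * x)
    set D := deriv besselSeries (ζ * x)
    have e1 : A * ζ * conj A + ζ * x * D * conj (D * ζ) =
        ζ * (Complex.normSq A : ℂ) + ((x * Complex.normSq (D * ζ) : ℝ) : ℂ) := by
      rw [Complex.ofReal_mul, ← Complex.mul_conj, ← Complex.mul_conj]; ring
    simp only [Complex.imCLM_apply]
    rw [e1, Complex.add_im, Complex.ofReal_im, Complex.im_mul_ofReal, Complex.normSq_eq_norm_sq]
    ring
  -- `v` vanishes at `0` and at the first zero on the segment, so its derivative vanishes between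
  by_contra him
  set S := {x : ℝ | x ∈ Set.Icc (0 : ℝ) 1 ∧ besselSeries (ζ * x) = 0} with hS
  have hcont : Continuous fun x : ℝ => besselSeries (ζ * x) :=
    differentiable_besselSeries.continuous.comp (by fun_prop)
  have hScomp : IsCompact S :=
    isCompact_Icc.inter_right (isClosed_singleton.preimage hcont)
  obtain ⟨x₀, ⟨hx₀, hx₀'⟩, hleast⟩ := hScomp.exists_isLeast ⟨1, by simp [hS, hζ]⟩
  have hx₀pos : 0 < x₀ := by
    refine lt_of_le_of_ne hx₀.1 fun h => ?_
    rw [← h] at hx₀'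
    simp [besselSeries_zero] at hx₀'
  have hv0 : v 0 = 0 := by
    have : besselEuler 0 = 0 := by rw [← mul_deriv_besselSeries, zero_mul]
    simp [hv, this]
  have hv1 : v x₀ = 0 := by simp [hv, hx₀']
  obtain ⟨x, hx, hx'⟩ := exists_hasDerivAt_eq_zero hx₀pos
    (fun x _ => (hder x).continuousAt.continuousWithinAt) (hv0.trans hv1.symm) (fun x _ => hder x)
  have hx0 : besselSeries (ζ * x) = 0 := by
    rcases mul_eq_zero.1 hx' with h | h
    · exact absurd h him
    · exact norm_eq_zero.1 (pow_eq_zero_iff (two_ne_zero) |>.1 h)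
  exact absurd (hleast ⟨⟨hx.1.le, hx.2.le.trans hx₀.2⟩, hx0⟩) (not_le.2 hx.2)

lemma zero_besselSeries {ζ : ℂ} (hζ : besselSeries ζ = 0) : ζ = (ζ.re : ℂ) ∧ ζ.re < 0 := by
  have him := im_eq_zero_of_besselSeries_eq_zero hζ
  have he : ζ = (ζ.re : ℂ) := Complex.ext rfl (by simp [him])
  refine ⟨he, ?_⟩
  by_contra! h
  have h1 := one_le_besselReal h
  rw [he, ← ofReal_besselReal] at hζ
  have : besselReal ζ.re = 0 := by exact_mod_cast hζ
  linarith

/-- The positive numbers `-1 / ζ`, with `ζ` a zero of `besselSeries`; equivalently the numbers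
`4 / j ^ 2`, with `j` a positive zero of `J_0`. -/
noncomputable def besselWeight (p : ZeroIndex besselSeries) : ℝ := -1 / p.val.re

lemma besselWeight_pos (p : ZeroIndex besselSeries) : 0 < besselWeight p :=
  div_pos_of_neg_of_neg (by norm_num) (zero_besselSeries p.apply_val).2

/-- The partial fraction expansion of the logarithmic derivative at a real point to the right of all
zeros. -/
lemma hasSum_logDeriv_besselSeries {x : ℝ} (hx : ∀ c, besselSeries c = 0 → c.re < x) :
    HasSum (fun p : ZeroIndex besselSeries => 1 / (x - p.val.re))
      (logDeriv besselSeries x).re := by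
  have hx0 : besselSeries x ≠ 0 := fun h => absurd (hx x h) (by simp)
  have hT := tendsto_sum_logDeriv differentiable_besselSeries (by norm_num) (by norm_num)
    hasGrowth_besselSeries hx0
  have hT' := (Complex.continuous_re.tendsto _).comp hT
  refine hasSum_zeros_of_tendsto (ψ := fun c => 1 / (x - c.re)) differentiable_besselSeries hx0
    (fun c hc => ?_) (hT'.congr fun R => ?_)
  · have := hx c hc
    exact one_div_nonneg.2 (by linarith)
  · rw [Function.comp_apply, Complex.re_sum]
    refine Finset.sum_congr rfl fun c hc => ?_
    have hc0 : besselSeries c = 0 := by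
      have : c ∈ (finite_zeros_of_entire differentiable_besselSeries hx0 R).toFinset := hc
      simpa using ((Set.Finite.mem_toFinset _).1 this).1
    have he := (zero_besselSeries hc0).1
    rw [← Complex.ofReal_natCast, Complex.re_ofReal_mul]
    congr 1
    conv_lhs => rw [he]
    rw [← Complex.ofReal_sub, ← Complex.ofReal_one, ← Complex.ofReal_div, Complex.ofReal_re]

/-- The partial fraction expansion at `0`, where `besselSeries' / besselSeries = 1`. -/
lemma hasSum_besselWeight : HasSum besselWeight 1 := by
  have h := hasSum_logDeriv_besselSeries (x := 0) fun c hc => (zero_besselSeries hc).2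
  have e : (logDeriv besselSeries (0 : ℝ)).re = 1 := by
    rw [logDeriv_apply, Complex.ofReal_zero, besselSeries_zero, deriv_besselSeries_zero]
    simp
  rw [e] at h
  convert h using 2 with p
  rw [besselWeight, zero_sub, neg_div, one_div, one_div, inv_neg]

lemma besselWeight_le_one (p : ZeroIndex besselSeries) : besselWeight p ≤ 1 :=
  le_hasSum hasSum_besselWeight p fun p _ => (besselWeight_pos p).le

lemma re_le_neg_one {c : ℂ} (hc : besselSeries c = 0) : c.re ≤ -1 := by
  have hord : analyticOrderNatAt besselSeries c ≠ 0 := by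
    intro h
    have h1 := analyticOrderAt_ne_top_of_entire differentiable_besselSeries (w := 0)
      (by simp [besselSeries_zero]) c
    have h2 := Nat.cast_analyticOrderNatAt h1
    rw [h, eq_comm, Nat.cast_zero,
      (differentiable_besselSeries.analyticAt c).analyticOrderAt_eq_zero] at h2
    exact h2 hc
  have h := besselWeight_le_one ⟨(c, 0), hc, Nat.pos_of_ne_zero hord⟩
  have hneg := (zero_besselSeries hc).2
  change -1 / c.re ≤ 1 at h
  rw [div_le_iff_of_neg hneg] at h
  linarith

lemma besselReal_pos {x : ℝ} (hx : -1 < x) : 0 < besselReal x := by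
  have hne : ∀ y : ℝ, -1 < y → besselReal y ≠ 0 := by
    intro y hy h
    have : besselSeries y = 0 := by rw [← ofReal_besselReal, h, Complex.ofReal_zero]
    have := re_le_neg_one this
    simp at this
    linarith
  have hcont : Continuous besselReal := by
    have : besselReal = fun x : ℝ => (besselSeries x).re := by
      ext x; rw [← ofReal_besselReal, Complex.ofReal_re]
    rw [this]
    exact Complex.continuous_re.comp
      (differentiable_besselSeries.continuous.comp Complex.continuous_ofReal)
  by_contra! hle
  have h0 : (1 : ℝ) ≤ besselReal 0 := one_le_besselReal le_rfl
  obtain ⟨y, hy, hy0⟩ := intermediate_value_uIcc (a := x) (b := 0) hcont.continuousOn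
    (show (0 : ℝ) ∈ Set.uIcc (besselReal x) (besselReal 0) from
      Set.mem_uIcc.2 (Or.inl ⟨hle, by linarith⟩))
  refine hne y ?_ hy0
  rcases Set.mem_uIcc.1 hy with h | h
  · linarith [h.1]
  · linarith [h.1]

/-- The product formula `besselReal x = ∏ (1 + x * besselWeight p)`, in logarithmic form. -/
theorem hasSum_log_besselReal {x : ℝ} (hx : -(1 / 2) < x) :
    HasSum (fun p => Real.log (1 + x * besselWeight p)) (Real.log (besselReal x)) := by
  have hpos : ∀ y : ℝ, -(1 / 2) < y → ∀ p, 1 / 2 < 1 + y * besselWeight p := by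
    intro y hy p
    nlinarith [besselWeight_pos p, besselWeight_le_one p]
  have hlog0 : ∀ p, Real.log (1 + (0 : ℝ) * besselWeight p) = 0 := fun p => by simp
  have hbound : ∀ p, ∀ y ∈ Set.Ioi (-(1 / 2) : ℝ),
      ‖besselWeight p / (1 + y * besselWeight p)‖ ≤ 2 * besselWeight p := by
    intro p y hy
    have h1 := hpos y hy p
    have h2 := besselWeight_pos p
    rw [Real.norm_of_nonneg (by positivity), div_le_iff₀ (by linarith)]
    nlinarith
  have hderp : ∀ p, ∀ y ∈ Set.Ioi (-(1 / 2) : ℝ),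
      HasDerivAt (fun y => Real.log (1 + y * besselWeight p))
        (besselWeight p / (1 + y * besselWeight p)) y := by
    intro p y hy
    have h1 := hpos y hy p
    have := (((hasDerivAt_id y).mul_const (besselWeight p)).const_add 1).log (by simp; linarith)
    simpa using this
  have h0mem : (0 : ℝ) ∈ Set.Ioi (-(1 / 2) : ℝ) := by norm_num
  have hder : ∀ y ∈ Set.Ioi (-(1 / 2) : ℝ),
      HasDerivAt (fun z => ∑' p, Real.log (1 + z * besselWeight p))
        (∑' p, besselWeight p / (1 + y * besselWeight p)) y := fun y hy =>
    hasDerivAt_tsum_of_isPreconnected (hasSum_besselWeight.summable.mul_left 2) isOpen_Ioi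
      isPreconnected_Ioi hderp hbound h0mem (by simp) hy
  have hsumm : Summable fun p => Real.log (1 + x * besselWeight p) := by
    refine Summable.of_norm_bounded ((hasSum_besselWeight.summable.mul_left (2 * |x|))) fun p => ?_
    have h := Convex.norm_image_sub_le_of_norm_hasDerivWithin_le
      (fun y hy => (hderp p y hy).hasDerivWithinAt) (hbound p) (convex_Ioi _) h0mem hx
    rw [hlog0, sub_zero, sub_zero, Real.norm_eq_abs x] at h
    linarith
  have hlogder : ∀ y ∈ Set.Ioi (-(1 / 2) : ℝ), HasDerivAt (fun y => Real.log (besselReal y))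
      (∑' p, besselWeight p / (1 + y * besselWeight p)) y := by
    intro y hy
    have hy' : -(1 / 2) < y := hy
    have hs := hasSum_logDeriv_besselSeries (x := y) fun c hc => by
      linarith [re_le_neg_one hc]
    have hbp := besselReal_pos (x := y) (by linarith)
    have hd : HasDerivAt besselReal (deriv besselSeries y).re y := by
      have h1 := (hasDerivAt_besselSeries y).real_of_complex
      refine h1.congr_of_eventuallyEq (Eventually.of_forall fun z => ?_)
      change besselReal z = (besselSeries z).re
      rw [← ofReal_besselReal, Complex.ofReal_re]
    refine (hd.log hbp.ne').congr_deriv ?_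
    have e1 : (logDeriv besselSeries y).re = (deriv besselSeries y).re / besselReal y := by
      rw [logDeriv_apply, ← ofReal_besselReal, Complex.div_ofReal_re]
    rw [← e1, ← hs.tsum_eq]
    refine tsum_congr fun p => ?_
    have h1 := (zero_besselSeries p.apply_val).2
    have h2 := re_le_neg_one p.apply_val
    have h3 : y - p.val.re ≠ 0 := by linarith
    have h4 : 1 + y * besselWeight p ≠ 0 := by linarith [hpos y hy' p]
    have h5 := h1.ne
    rw [div_eq_div_iff h3 h4, besselWeight]
    field_simp
    ring
  have hconst := (convex_Ioi (-(1 / 2) : ℝ)).norm_image_sub_le_of_norm_hasDerivWithin_le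
    (f := fun y => Real.log (besselReal y) - ∑' p, Real.log (1 + y * besselWeight p)) (C := 0)
    (fun y hy => ((hlogder y hy).sub (hder y hy)).hasDerivWithinAt) (fun y _ => by simp) h0mem hx
  have hb0 : besselReal 0 = 1 := by
    have := ofReal_besselReal 0
    rw [Complex.ofReal_zero, besselSeries_zero] at this
    exact_mod_cast this
  rw [zero_mul] at hconst
  have h0 := norm_le_zero_iff.1 hconst
  simp only [hlog0, tsum_zero, hb0, Real.log_one, sub_zero] at h0
  rw [sub_eq_zero.1 h0]
  exact hsumm.hasSum

lemma summable_besselWeight_pow {k : ℕ} (hk : 1 ≤ k) : Summable fun p => besselWeight p ^ k := by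
  refine Summable.of_nonneg_of_le (fun p => pow_nonneg (besselWeight_pos p).le k) (fun p => ?_)
    hasSum_besselWeight.summable
  exact pow_le_of_le_one (besselWeight_pos p).le (besselWeight_le_one p) (by omega)

/-- The coefficients `c k` as power sums over the zeros of `J_0`. -/
theorem c_eq_tsum {k : ℕ} (hk : 1 ≤ k) : c k = (∑' p, besselWeight p ^ k) / (2 ^ k * k) := by
  set S : ℕ → ℝ := fun k => ∑' p, besselWeight p ^ k with hS
  -- the Taylor coefficients of `log J0`
  set a : ℕ → ℝ := fun n => if Even n ∧ n ≠ 0 then -(S (n / 2) / (4 ^ (n / 2) * (n / 2 : ℕ))) else 0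
    with ha
  have hser : ∀ w : ℝ, |w| < 1 → HasSum (fun n => w ^ n * a n) (Real.log (J0 w)) := by
    intro w hw
    set x := w ^ 2 / 4 with hx
    have hx0 : 0 ≤ x := by positivity
    have hx1 : x < 1 / 4 := by
      have : w ^ 2 < 1 := (sq_lt_one_iff_abs_lt_one w).2 hw
      linarith
    have h1 := hasSum_log_besselReal (x := -x) (by linarith)
    rw [← J0_eq_besselReal] at h1
    have hterm : ∀ p, HasSum (fun n : ℕ => (x * besselWeight p) ^ (n + 1) / (n + 1))
        (-Real.log (1 + -x * besselWeight p)) := by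
      intro p
      have h2 := besselWeight_pos p
      have h3 := besselWeight_le_one p
      have h4 : |x * besselWeight p| < 1 := by
        rw [abs_of_nonneg (by positivity)]; nlinarith
      convert Real.hasSum_pow_div_log_of_abs_lt_one h4 using 2
      rw [neg_mul, sub_eq_add_neg]
    have hsummable : Summable fun z : ZeroIndex besselSeries × ℕ =>
        (x * besselWeight z.1) ^ (z.2 + 1) / (z.2 + 1) := by
      have hg : Summable fun z : ZeroIndex besselSeries × ℕ => besselWeight z.1 * x ^ z.2 :=
        hasSum_besselWeight.summable.mul_of_nonneg
          (summable_geometric_of_lt_one hx0 (by linarith)) (fun p => (besselWeight_pos p).le)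
          (fun n => by positivity)
      refine Summable.of_nonneg_of_le (fun z => ?_) (fun z => ?_) hg
      · have := besselWeight_pos z.1
        positivity
      · have h2 := besselWeight_pos z.1
        have h3 := besselWeight_le_one z.1
        rw [mul_pow]
        have h5 : x ^ (z.2 + 1) ≤ x ^ z.2 := pow_le_pow_of_le_one hx0 (by linarith) (by omega)
        have h6 : besselWeight z.1 ^ (z.2 + 1) ≤ besselWeight z.1 :=
          pow_le_of_le_one h2.le h3 (by omega)
        rw [div_le_iff₀ (by positivity)]
        have h7 : x ^ (z.2 + 1) * besselWeight z.1 ^ (z.2 + 1) ≤ x ^ z.2 * besselWeight z.1 :=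
          mul_le_mul h5 h6 (by positivity) (by positivity)
        have h8 : 0 ≤ x ^ z.2 * besselWeight z.1 := by positivity
        nlinarith [Nat.cast_nonneg (α := ℝ) z.2]
    have h2 := hsummable.prod_symm.hasSum.prod_fiberwise
      (g := fun n : ℕ => x ^ (n + 1) / (n + 1) * S (n + 1)) (fun n => by
        have := (summable_besselWeight_pow (k := n + 1) (by omega)).hasSum.mul_left
          (x ^ (n + 1) / ((n : ℝ) + 1))
        refine this.congr_fun fun p => ?_
        change (x * besselWeight p) ^ (n + 1) / ((n : ℝ) + 1) = _
        rw [mul_pow]; ring)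
    have h3 : ∑' z : ℕ × ZeroIndex besselSeries,
        (x * besselWeight z.swap.1) ^ (z.swap.2 + 1) / ((z.swap.2 : ℝ) + 1) = -Real.log (J0 w) := by
      have h4 := hsummable.hasSum.prod_fiberwise hterm
      have h5 := h4.unique h1.neg
      rw [← h5]
      exact (Equiv.prodComm ℕ (ZeroIndex besselSeries)).tsum_eq
        (fun z : ZeroIndex besselSeries × ℕ => (x * besselWeight z.1) ^ (z.2 + 1) / ((z.2 : ℝ) + 1))
    rw [h3] at h2
    have h6 := h2.neg
    rw [neg_neg] at h6
    have hinj : Function.Injective fun n : ℕ => 2 * (n + 1) := fun m n h => by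
      simp only at h; omega
    refine (hinj.hasSum_iff (fun n hn => ?_)).1 (h6.congr_fun ?_)
    · have : ¬ (Even n ∧ n ≠ 0) := by
        rintro ⟨⟨m, rfl⟩, hm⟩
        exact hn ⟨m - 1, by simp only; omega⟩
      simp [ha, this]
    · intro n
      have h7 : Even (2 * (n + 1)) ∧ 2 * (n + 1) ≠ 0 := ⟨even_two_mul _, by omega⟩
      have h8 : 2 * (n + 1) / 2 = n + 1 := by omega
      have h9 : ((n : ℝ) + 1) ≠ 0 := by positivity
      simp only [Function.comp_apply, ha, if_pos h7, h8, hx, pow_mul w, div_pow]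
      push_cast
      field_simp
  have hps : HasFPowerSeriesAt (fun w => Real.log (J0 w)) (FormalMultilinearSeries.ofScalars ℝ a) 0 := by
    rw [hasFPowerSeriesAt_iff]
    filter_upwards [Metric.ball_mem_nhds (0 : ℝ) one_pos] with w hw
    have := hser w (by simpa using hw)
    simpa [FormalMultilinearSeries.coeff_ofScalars] using this
  have heq := hps.analyticAt.hasFPowerSeriesAt.eq_formalMultilinearSeries hps
  have hcoef := congrArg (fun p => p.coeff (2 * k)) heq
  simp only [FormalMultilinearSeries.coeff_ofScalars] at hcoef
  have h7 : Even (2 * k) ∧ 2 * k ≠ 0 := ⟨even_two_mul _, by omega⟩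
  have h8 : 2 * k / 2 = k := by omega
  simp only [ha, if_pos h7, h8] at hcoef
  rw [c, mul_div_assoc, hcoef]
  have h9 : (4 : ℝ) ^ k = 2 ^ k * 2 ^ k := by rw [← mul_pow]; norm_num
  have h10 : (k : ℝ) ≠ 0 := by exact_mod_cast (by omega : k ≠ 0)
  rw [h9]
  field_simp
  rfl

/-! ### Derivatives of the model error term -/

lemma iteratedDeriv_comp_mul_left (n : ℕ) (f : ℝ → ℝ) (a x : ℝ) :
    iteratedDeriv n (fun x => f (a * x)) x = a ^ n * iteratedDeriv n f (a * x) := by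
  induction n generalizing x with
  | zero => simp
  | succ n ih =>
    rw [iteratedDeriv_succ, funext ih, iteratedDeriv_succ, deriv_const_mul_field,
      deriv_comp_mul_left, smul_eq_mul]
    ring

lemma contDiffAt_inv_one_sub_sq {x : ℝ} (hx : |x| < 1) {n : WithTop ℕ∞} :
    ContDiffAt ℝ n (fun x : ℝ => (1 - x ^ 2)⁻¹) x := by
  have : x ^ 2 < 1 := (sq_lt_one_iff_abs_lt_one x).2 hx
  exact (contDiffAt_const.sub (contDiffAt_id.pow 2)).inv (by simp; linarith)

lemma iteratedDeriv_inv_one_sub_sq (j : ℕ) {x : ℝ} (hx : |x| < 1) :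
    iteratedDeriv j (fun x : ℝ => (1 - x ^ 2)⁻¹) x =
      (j ! : ℝ) / 2 * (((1 - x) ^ (j + 1))⁻¹ + (-1) ^ j * ((1 + x) ^ (j + 1))⁻¹) := by
  have hx' := abs_lt.1 hx
  have hopen : Set.Ioo (-1 : ℝ) 1 ∈ 𝓝 x := Ioo_mem_nhds hx'.1 hx'.2
  have h1 : (fun x : ℝ => (1 - x ^ 2)⁻¹) =ᶠ[𝓝 x]
      fun x => (1 / 2 : ℝ) * ((-1 * x + 1)⁻¹ + (1 * x + 1)⁻¹) := by
    filter_upwards [hopen] with z hz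
    have e1 : 1 - z ≠ 0 := by linarith [hz.2]
    have e2 : 1 + z ≠ 0 := by linarith [hz.1]
    have e3 : 1 - z ^ 2 = (1 - z) * (1 + z) := by ring
    have e4 : -1 * z + 1 = 1 - z := by ring
    have e5 : 1 * z + 1 = 1 + z := by ring
    rw [e3, e4, e5]
    field_simp
    ring
  have hn1 : (-1 * x + 1) ≠ 0 := by linarith [hx'.2]
  have hn2 : (1 * x + 1) ≠ 0 := by linarith [hx'.1]
  have hc1 : ContDiffAt ℝ j (fun x : ℝ => (-1 * x + 1)⁻¹) x := ContDiffAt.inv (by fun_prop) hn1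
  have hc2 : ContDiffAt ℝ j (fun x : ℝ => (1 * x + 1)⁻¹) x := ContDiffAt.inv (by fun_prop) hn2
  have hz : ∀ w : ℝ, w ^ (-1 - (j : ℤ)) = (w ^ (j + 1))⁻¹ := fun w => by
    rw [← zpow_natCast, ← zpow_neg]; congr 1; push_cast; ring
  rw [h1.iteratedDeriv_eq, iteratedDeriv_const_mul_field, iteratedDeriv_fun_add hc1 hc2,
    iteratedDeriv_eq_iterate, iteratedDeriv_eq_iterate, iter_deriv_inv_linear,
    iter_deriv_inv_linear]
  simp only [hz, one_pow]
  have e4 : ((-1 : ℝ) ^ j * (j ! : ℝ) * (-1) ^ j) = j ! := by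
    rw [mul_right_comm, ← mul_pow]; simp
  rw [e4]
  have e5 : -1 * x + 1 = 1 - x := by ring
  have e6 : 1 * x + 1 = 1 + x := by ring
  rw [e5, e6]
  ring

/-- The derivatives of `1 / (1 - x ^ 2)` are at least `1` or `x` on `[0, 1)`, according to the
parity of their order. -/
lemma le_iteratedDeriv_inv_one_sub_sq (j : ℕ) {x : ℝ} (hx0 : 0 ≤ x) (hx1 : x < 1) :
    (if Even j then 1 else x) ≤ iteratedDeriv j (fun x : ℝ => (1 - x ^ 2)⁻¹) x := by
  rw [iteratedDeriv_inv_one_sub_sq j (by rwa [abs_of_nonneg hx0])]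
  have hfac : (1 : ℝ) ≤ j ! := by exact_mod_cast j.factorial_pos
  have hd : 0 < 1 - x := by linarith
  have hpos : 0 < ((1 + x) ^ (j + 1))⁻¹ := by positivity
  have hle : ((1 + x) ^ (j + 1))⁻¹ ≤ 1 := inv_le_one_of_one_le₀ (one_le_pow₀ (by linarith))
  have hge : 1 + (j + 1 : ℕ) * x ≤ ((1 - x) ^ (j + 1))⁻¹ := by
    rw [← inv_pow]
    have h1 : 1 + x ≤ (1 - x)⁻¹ := by
      rw [le_inv_comm₀ (by linarith) hd, ← one_div, le_div_iff₀ (by linarith)]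
      nlinarith
    exact (one_add_mul_le_pow (by linarith) (j + 1)).trans
      (pow_le_pow_left₀ (by linarith) h1 _)
  push_cast at hge
  have hj : (0 : ℝ) ≤ j := j.cast_nonneg
  split_ifs with he
  · rw [he.neg_one_pow]
    -- the sum of the two terms is at least `2` because the product of the bases is at most `1`
    have h2 : 1 ≤ ((1 - x) ^ (j + 1))⁻¹ * ((1 + x) ^ (j + 1))⁻¹ := by
      rw [← mul_inv, ← mul_pow]
      refine (one_le_inv₀ (by apply pow_pos; nlinarith)).2 (pow_le_one₀ (by nlinarith) (by nlinarith))
    have h3 : 2 ≤ ((1 - x) ^ (j + 1))⁻¹ + ((1 + x) ^ (j + 1))⁻¹ := by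
      nlinarith [sq_nonneg (((1 - x) ^ (j + 1))⁻¹ - ((1 + x) ^ (j + 1))⁻¹)]
    nlinarith
  · have ho := Nat.not_even_iff_odd.1 he
    rw [ho.neg_one_pow]
    have hj1 : (1 : ℝ) ≤ j := by exact_mod_cast ho.pos
    have h3 : 2 * x ≤ ((1 - x) ^ (j + 1))⁻¹ + -1 * ((1 + x) ^ (j + 1))⁻¹ := by nlinarith
    nlinarith

/-- The error term `x ^ (2 K + 2) / (1 - x ^ 2)`, without its coefficient and for `τ = 1`. -/
noncomputable def errorModel (K : ℕ) (x : ℝ) : ℝ := x ^ (2 * K + 2) / (1 - x ^ 2)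

lemma errorModel_neg (K : ℕ) (x : ℝ) : errorModel K (-x) = errorModel K x := by
  have h : Even (2 * K + 2) := ⟨K + 1, by ring⟩
  rw [errorModel, errorModel, h.neg_pow, neg_sq]

lemma abs_iteratedDeriv_errorModel (m K : ℕ) (x : ℝ) :
    |iteratedDeriv m (errorModel K) x| = |iteratedDeriv m (errorModel K) (|x|)| := by
  rcases abs_cases x with ⟨h, _⟩ | ⟨h, _⟩
  · rw [h]
  · rw [h]
    have e := iteratedDeriv_comp_neg m (errorModel K) x
    rw [funext (errorModel_neg K)] at e
    rw [e, smul_eq_mul, abs_mul, abs_pow, abs_neg, abs_one, one_pow, one_mul]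

/-- All terms of the Leibniz expansion of a derivative of `errorModel` are nonnegative on `[0, 1)`,
so each of them is a lower bound. -/
lemma le_iteratedDeriv_errorModel {m i : ℕ} (hi : i ≤ m) (K : ℕ) {x : ℝ} (hx0 : 0 ≤ x)
    (hx1 : x < 1) :
    ((2 * K + 2).descFactorial i : ℝ) * x ^ (2 * K + 2 - i) * (if Even (m - i) then 1 else x) ≤
      iteratedDeriv m (errorModel K) x := by
  have e : errorModel K = fun x => x ^ (2 * K + 2) * (1 - x ^ 2)⁻¹ := by
    ext x; rw [errorModel, div_eq_mul_inv]
  have hψ : ∀ j, 0 ≤ iteratedDeriv j (fun x : ℝ => (1 - x ^ 2)⁻¹) x := fun j =>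
    le_trans (by split_ifs <;> linarith) (le_iteratedDeriv_inv_one_sub_sq j hx0 hx1)
  rw [e, iteratedDeriv_fun_mul (by fun_prop)
    (contDiffAt_inv_one_sub_sq (by rwa [abs_of_nonneg hx0]))]
  simp only [iteratedDeriv_pow]
  refine le_trans ?_ (Finset.single_le_sum (f := fun i => (m.choose i : ℝ) *
    ((2 * K + 2).descFactorial i * x ^ (2 * K + 2 - i)) *
      iteratedDeriv (m - i) (fun x : ℝ => (1 - x ^ 2)⁻¹) x)
    (fun j _ => mul_nonneg (by positivity) (hψ _)) (Finset.mem_range_succ_iff.2 hi))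
  have hc : (1 : ℝ) ≤ m.choose i := by exact_mod_cast Nat.choose_pos hi
  rw [mul_assoc (m.choose i : ℝ)]
  refine le_trans ?_ (le_mul_of_one_le_left (mul_nonneg (by positivity) (hψ _)) hc)
  exact mul_le_mul_of_nonneg_left (le_iteratedDeriv_inv_one_sub_sq _ hx0 hx1) (by positivity)

/-- The derivatives of `1 / (1 + θ x ^ 2)` are bounded uniformly for `θ` in a bounded set, since this
is `1 / (1 + y ^ 2)` at `y = √θ x`. -/
lemma exists_iteratedDeriv_inv_le (M : ℝ) (n : ℕ) : ∃ C : ℝ, 0 ≤ C ∧ ∀ θ, 0 ≤ θ → θ ≤ M →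
    ∀ x, |x| ≤ 1 → ∀ j ≤ n, |iteratedDeriv j (fun x : ℝ => (1 + θ * x ^ 2)⁻¹) x| ≤ C := by
  set f : ℝ → ℝ := fun x => (1 + x ^ 2)⁻¹ with hf
  have hsm : ContDiff ℝ ∞ f := ContDiff.inv (by fun_prop) fun x => by positivity
  have key : ∀ j : ℕ, ∃ C : ℝ, 0 ≤ C ∧ ∀ θ, 0 ≤ θ → θ ≤ M →
      ∀ x, |x| ≤ 1 → |iteratedDeriv j (fun x : ℝ => (1 + θ * x ^ 2)⁻¹) x| ≤ C := by
    intro j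
    have hcont : Continuous (iteratedDeriv j f) :=
      hsm.continuous_iteratedDeriv j (by exact_mod_cast le_top)
    obtain ⟨C, hC⟩ := (isCompact_Icc (a := -√M) (b := √M)).exists_bound_of_continuousOn
      hcont.continuousOn
    refine ⟨|√M ^ j * C|, abs_nonneg _, fun θ h0 hM x hx => ?_⟩
    have e : (fun x : ℝ => (1 + θ * x ^ 2)⁻¹) = fun x => f (√θ * x) := by
      ext x; rw [hf]; simp only; rw [mul_pow, Real.sq_sqrt h0]
    rw [e, iteratedDeriv_comp_mul_left, abs_mul, abs_of_nonneg (by positivity : 0 ≤ √θ ^ j)]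
    have hs : √θ ≤ √M := Real.sqrt_le_sqrt hM
    have hmem : √θ * x ∈ Set.Icc (-√M) √M := by
      rw [Set.mem_Icc, ← abs_le, abs_mul, abs_of_nonneg (Real.sqrt_nonneg _)]
      exact (mul_le_of_le_one_right (Real.sqrt_nonneg _) hx).trans hs
    exact le_trans (mul_le_mul (pow_le_pow_left₀ (Real.sqrt_nonneg _) hs j) (hC _ hmem)
      (abs_nonneg _) (by positivity)) (le_abs_self _)
  choose C hC0 hC using key
  refine ⟨∑ j ∈ Finset.range (n + 1), C j, Finset.sum_nonneg fun j _ => hC0 j,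
    fun θ h0 hM x hx j hj => (hC j θ h0 hM x hx).trans ?_⟩
  exact Finset.single_le_sum (f := C) (fun j _ => hC0 j) (Finset.mem_range_succ_iff.2 hj)

/-- The derivatives of `x ^ N / (1 + θ x ^ 2)` are as small as those of `x ^ N`, uniformly in `N`, as
long as their order is at most `N`, and bounded beyond. -/
lemma exists_iteratedDeriv_pow_mul_le (M : ℝ) (n : ℕ) : ∃ C : ℝ, 0 ≤ C ∧ ∀ θ, 0 ≤ θ → θ ≤ M →
    ∀ x, |x| ≤ 1 → ∀ N : ℕ, |iteratedDeriv n (fun x : ℝ => x ^ N * (1 + θ * x ^ 2)⁻¹) x| ≤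
      C * if n ≤ N then N.descFactorial n * |x| ^ (N - n) else 1 := by
  obtain ⟨C, hC0, hC⟩ := exists_iteratedDeriv_inv_le M n
  refine ⟨∑ i ∈ Finset.range (n + 1), n.choose i * (n ! : ℝ) * C, by positivity,
    fun θ h0 hM x hx N => ?_⟩
  have hne : 1 + θ * x ^ 2 ≠ 0 := by positivity
  have hsm : ContDiffAt ℝ n (fun x : ℝ => (1 + θ * x ^ 2)⁻¹) x := ContDiffAt.inv (by fun_prop) hne
  rw [iteratedDeriv_fun_mul (by fun_prop) hsm, Finset.sum_mul]
  refine (Finset.abs_sum_le_sum_abs _ _).trans (Finset.sum_le_sum fun i hi => ?_)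
  have hin : i ≤ n := Finset.mem_range_succ_iff.1 hi
  rw [iteratedDeriv_pow, abs_mul, abs_mul, Nat.abs_cast, abs_mul, Nat.abs_cast, abs_pow]
  have hφ := hC θ h0 hM x hx (n - i) (Nat.sub_le _ _)
  have hfac : (1 : ℝ) ≤ n ! := by exact_mod_cast n.factorial_pos
  have hmain : (N.descFactorial i : ℝ) * |x| ^ (N - i) ≤
      n ! * if n ≤ N then N.descFactorial n * |x| ^ (N - n) else 1 := by
    split_ifs with hnN
    · have h1 : (N.descFactorial i : ℝ) ≤ N.descFactorial n := by
        have : N.descFactorial i ≤ N.descFactorial n := by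
          rw [← Nat.descFactorial_mul_descFactorial hin]
          exact Nat.le_mul_of_pos_left _ (Nat.descFactorial_pos.2 (by omega))
        exact_mod_cast this
      have h2 : |x| ^ (N - i) ≤ |x| ^ (N - n) :=
        pow_le_pow_of_le_one (abs_nonneg x) hx (by omega)
      refine (mul_le_mul h1 h2 (by positivity) (by positivity)).trans ?_
      exact le_mul_of_one_le_left (by positivity) hfac
    · push Not at hnN
      rw [mul_one]
      have h1 : (N.descFactorial i : ℝ) ≤ n ! := by
        have : N.descFactorial i ≤ n ! :=
          le_trans (by
            rcases le_or_gt i N with h | h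
            · rw [← Nat.factorial_mul_descFactorial h]
              exact Nat.le_mul_of_pos_left _ (Nat.factorial_pos _)
            · simp [Nat.descFactorial_of_lt h]) (Nat.factorial_le hnN.le)
        exact_mod_cast this
      exact (mul_le_of_le_one_right (Nat.cast_nonneg _) (pow_le_one₀ (abs_nonneg x) hx)).trans h1
  refine (mul_le_mul (mul_le_mul_of_nonneg_left hmain (Nat.cast_nonneg _)) hφ (abs_nonneg _)
    (by split_ifs <;> positivity)).trans_eq (by ring)

/-! ### Taylor remainders of `log (1 + x)` -/

/-- The remainder of the Taylor expansion of `log (1 + x)` after `K` terms. -/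
noncomputable def logRem (K : ℕ) (x : ℝ) : ℝ :=
  Real.log (1 + x) - ∑ k ∈ Finset.Icc 1 K, (-1) ^ (k - 1) * x ^ k / k

lemma logRem_succ (K : ℕ) (x : ℝ) :
    logRem (K + 1) x = logRem K x - (-1) ^ K * x ^ (K + 1) / (K + 1 : ℕ) := by
  rw [logRem, logRem, Finset.sum_Icc_succ_top (by omega), Nat.add_sub_cancel, sub_sub]

lemma hasDerivAt_logRem (K : ℕ) {x : ℝ} (hx : 1 + x ≠ 0) :
    HasDerivAt (logRem K) ((-1) ^ K * x ^ K * (1 + x)⁻¹) x := by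
  induction K with
  | zero =>
    have h := ((hasDerivAt_id x).const_add 1).log hx
    have e : logRem 0 = fun x => Real.log (1 + x) := by ext z; simp [logRem]
    rw [e]
    exact h.congr_deriv (by simp)
  | succ K ih =>
    have hK : ((K + 1 : ℕ) : ℝ) ≠ 0 := by positivity
    have h := ih.sub (((hasDerivAt_pow (K + 1) x).const_mul ((-1 : ℝ) ^ K)).div_const (K + 1 : ℕ))
    rw [funext (logRem_succ K)]
    refine h.congr_deriv ?_
    rw [Nat.add_sub_cancel]
    field_simp
    ring

lemma logRem_zero (K : ℕ) : logRem K 0 = 0 := by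
  rw [logRem, Finset.sum_eq_zero]
  · simp
  · intro k hk
    have : k ≠ 0 := by have := (Finset.mem_Icc.1 hk).1; omega
    simp [this]

lemma abs_logRem_le (K : ℕ) {x : ℝ} (hx : 0 ≤ x) : |logRem K x| ≤ x ^ (K + 1) / (K + 1) := by
  have hd : ∀ z : ℝ, 0 ≤ z → HasDerivAt (logRem K) ((-1) ^ K * z ^ K * (1 + z)⁻¹) z := fun z hz =>
    hasDerivAt_logRem K (by positivity)
  have hB : ∀ z : ℝ, HasDerivAt (fun z : ℝ => z ^ (K + 1) / ((K : ℝ) + 1)) (z ^ K) z := fun z => by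
    refine ((hasDerivAt_pow (K + 1) z).div_const ((K : ℝ) + 1)).congr_deriv ?_
    have hK : ((K : ℝ) + 1) ≠ 0 := by positivity
    push_cast
    field_simp
  refine image_norm_le_of_norm_deriv_right_le_deriv_boundary (a := 0) (b := x)
    (fun z hz => (hd z hz.1).continuousAt.continuousWithinAt)
    (fun z hz => (hd z hz.1).hasDerivWithinAt) (by simp [logRem_zero]) hB (fun z hz => ?_)
    ⟨hx, le_rfl⟩
  have hz : 0 ≤ z := hz.1
  rw [norm_mul, norm_mul, norm_pow, norm_neg, norm_one, one_pow, one_mul, norm_pow,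
    Real.norm_of_nonneg hz, Real.norm_of_nonneg (by positivity)]
  exact mul_le_of_le_one_right (by positivity) (inv_le_one_of_one_le₀ (by linarith))

lemma deriv_logRem_comp (K : ℕ) {θ : ℝ} (hθ : 0 ≤ θ) :
    deriv (fun x => logRem K (θ * x ^ 2)) =
      fun x => 2 * (-1) ^ K * θ ^ (K + 1) * (x ^ (2 * K + 1) * (1 + θ * x ^ 2)⁻¹) := by
  ext x
  have h1 : HasDerivAt (fun x : ℝ => θ * x ^ 2) (θ * (2 * x)) x := by
    simpa using (hasDerivAt_pow 2 x).const_mul θ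
  have h := (hasDerivAt_logRem K (x := θ * x ^ 2) (by positivity)).comp x h1
  refine h.deriv.trans ?_
  ring

lemma iteratedDeriv_logRem_comp (n K : ℕ) {θ : ℝ} (hθ : 0 ≤ θ) (x : ℝ) :
    |iteratedDeriv (n + 1) (fun x => logRem K (θ * x ^ 2)) x| =
      2 * θ ^ (K + 1) * |iteratedDeriv n (fun x => x ^ (2 * K + 1) * (1 + θ * x ^ 2)⁻¹) x| := by
  rw [iteratedDeriv_succ', deriv_logRem_comp K hθ, iteratedDeriv_const_mul_field, abs_mul, abs_mul,
    abs_mul, abs_pow, abs_neg, abs_one, one_pow, mul_one, abs_of_pos two_pos,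
    abs_of_nonneg (by positivity)]

lemma contDiff_pow_mul_inv (N : ℕ) {θ : ℝ} (hθ : 0 ≤ θ) {n : WithTop ℕ∞} :
    ContDiff ℝ n fun x : ℝ => x ^ N * (1 + θ * x ^ 2)⁻¹ :=
  ContDiff.mul (by fun_prop) (ContDiff.inv (by fun_prop) fun x => by positivity)

/-- Even derivatives of the odd function `x ^ (2 K + 1) / (1 + θ x ^ 2)` vanish at `0`, hence are
`O(|x|)`. -/
lemma exists_iteratedDeriv_odd_le (M : ℝ) {n : ℕ} (hn : Even n) : ∃ C : ℝ, 0 ≤ C ∧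
    ∀ θ, 0 ≤ θ → θ ≤ M → ∀ x, |x| ≤ 1 → ∀ K : ℕ, 2 * K + 1 < n →
      |iteratedDeriv n (fun x : ℝ => x ^ (2 * K + 1) * (1 + θ * x ^ 2)⁻¹) x| ≤ C * |x| := by
  obtain ⟨C, hC0, hC⟩ := exists_iteratedDeriv_pow_mul_le M (n + 1)
  refine ⟨C, hC0, fun θ h0 hM x hx K hK => ?_⟩
  set H : ℝ → ℝ := fun x => x ^ (2 * K + 1) * (1 + θ * x ^ 2)⁻¹ with hH
  have hodd : (fun x => H (-x)) = fun x => -H x := by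
    ext z
    simp only [hH, neg_sq, (odd_two_mul_add_one K).neg_pow]
    ring
  have hzero : iteratedDeriv n H 0 = 0 := by
    have h := iteratedDeriv_comp_neg n H 0
    rw [hodd, iteratedDeriv_fun_neg, hn.neg_one_pow, one_smul, neg_zero] at h
    linarith
  have hdiff : Differentiable ℝ (iteratedDeriv n H) :=
    (contDiff_pow_mul_inv (2 * K + 1) h0 (n := ∞)).differentiable_iteratedDeriv n
      (by exact_mod_cast WithTop.coe_lt_top _)
  have hle := (convex_Icc (-1 : ℝ) 1).norm_image_sub_le_of_norm_deriv_le (f := iteratedDeriv n H)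
    (C := C) (fun z _ => hdiff z) (fun z hz => by
      rw [← iteratedDeriv_succ]
      have := hC θ h0 hM z (abs_le.2 hz) (2 * K + 1)
      rwa [if_neg (by omega), mul_one] at this) (x := 0) (y := x) (by norm_num) (abs_le.1 hx)
  rwa [hzero, sub_zero, sub_zero] at hle

/-- The comparison of the remainder with the model error term, uniformly in `K` and in bounded
`θ`. -/
theorem exists_iteratedDeriv_logRem_le_errorModel {M : ℝ} (hM0 : 0 ≤ M) (m : ℕ) :
    ∃ C : ℝ, 0 ≤ C ∧ ∀ θ, 0 ≤ θ → θ ≤ M → ∀ K : ℕ, 1 ≤ K → ∀ x : ℝ, |x| < 1 →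
      |iteratedDeriv m (fun x => logRem K (θ * x ^ 2)) x| ≤
        C * (θ ^ K / K) * |iteratedDeriv m (errorModel K) x| := by
  rcases m with _ | n
  · refine ⟨M, hM0, fun θ h0 hM K hK x hx => ?_⟩
    simp only [iteratedDeriv_zero]
    have hx2 : x ^ 2 < 1 := (sq_lt_one_iff_abs_lt_one x).2 hx
    have hKpos : (0 : ℝ) < K := by exact_mod_cast hK
    refine (abs_logRem_le K (by positivity)).trans ?_
    have hev : 0 ≤ x ^ (2 * K + 2) := Even.pow_nonneg ⟨K + 1, by ring⟩ x
    have h1 : x ^ (2 * K + 2) ≤ |errorModel K x| := by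
      refine le_trans ?_ (le_abs_self _)
      rw [errorModel, le_div_iff₀ (by linarith)]
      exact mul_le_of_le_one_right hev (by nlinarith [sq_nonneg x])
    have h2 : (θ * x ^ 2) ^ (K + 1) / ((K : ℝ) + 1) ≤ M * (θ ^ K / K) * x ^ (2 * K + 2) := by
      have e : (θ * x ^ 2) ^ (K + 1) / ((K : ℝ) + 1) =
          θ * (θ ^ K / (K + 1)) * x ^ (2 * K + 2) := by
        rw [mul_pow, ← pow_mul, pow_succ θ]; ring
      rw [e]
      refine mul_le_mul_of_nonneg_right ?_ hev
      exact mul_le_mul hM (div_le_div_of_nonneg_left (by positivity) hKpos (by linarith))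
        (by positivity) hM0
    exact h2.trans (mul_le_mul_of_nonneg_left h1 (by positivity))
  · obtain ⟨C₁, hC₁0, hC₁⟩ := exists_iteratedDeriv_pow_mul_le M n
    obtain ⟨C₂, hC₂0, hC₂⟩ : ∃ C : ℝ, 0 ≤ C ∧ (Even n → ∀ θ, 0 ≤ θ → θ ≤ M → ∀ x, |x| ≤ 1 →
        ∀ K : ℕ, 2 * K + 1 < n →
        |iteratedDeriv n (fun x : ℝ => x ^ (2 * K + 1) * (1 + θ * x ^ 2)⁻¹) x| ≤ C * |x|) := by
      by_cases hn : Even n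
      · obtain ⟨C, hC0, hC⟩ := exists_iteratedDeriv_odd_le M hn
        exact ⟨C, hC0, fun _ => hC⟩
      · exact ⟨0, le_rfl, fun h => absurd h hn⟩
    refine ⟨2 * M * (n + 1) * (C₁ + C₂), by positivity, fun θ h0 hM K hK x hx => ?_⟩
    have hKpos : (0 : ℝ) < K := by exact_mod_cast hK
    rw [iteratedDeriv_logRem_comp n K h0, abs_iteratedDeriv_errorModel]
    set G := |iteratedDeriv (n + 1) (errorModel K) (|x|)| with hG
    set H := |iteratedDeriv n (fun x => x ^ (2 * K + 1) * (1 + θ * x ^ 2)⁻¹) x| with hH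
    suffices hmain : K * H ≤ (n + 1) * (C₁ + C₂) * G by
      have e1 : 2 * θ ^ (K + 1) * H = 2 * θ * (θ ^ K / K) * (K * H) := by
        field_simp; ring
      rw [e1]
      have h3 : 2 * θ * (θ ^ K / K) ≤ 2 * M * (θ ^ K / K) :=
        mul_le_mul_of_nonneg_right (by linarith) (by positivity)
      refine (mul_le_mul h3 hmain (by positivity) (by positivity)).trans_eq (by ring)
    have hlow := fun i (hi : i ≤ n + 1) =>
      (le_iteratedDeriv_errorModel hi K (abs_nonneg x) hx).trans (le_abs_self _)
    have hup := hC₁ θ h0 hM x hx.le (2 * K + 1)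
    have hn0 : (0 : ℝ) ≤ n := n.cast_nonneg
    rcases le_or_gt n (2 * K + 1) with hnK | hnK
    -- all derivatives fall on the power `x ^ (2 K + 2)`
    · have h1 := hlow (n + 1) le_rfl
      rw [if_pos hnK] at hup
      rw [Nat.sub_self, if_pos Even.zero, mul_one, Nat.succ_descFactorial_succ,
        show 2 * K + 2 - (n + 1) = 2 * K + 1 - n by omega] at h1
      push_cast at h1
      set D := ((2 * K + 1).descFactorial n : ℝ) * |x| ^ (2 * K + 1 - n) with hD
      have hD0 : 0 ≤ D := by positivity
      have h2 : K * D ≤ G := le_trans (by rw [mul_assoc]; nlinarith) h1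
      calc K * H ≤ K * (C₁ * D) := mul_le_mul_of_nonneg_left hup hKpos.le
        _ = C₁ * (K * D) := by ring
        _ ≤ C₁ * G := mul_le_mul_of_nonneg_left h2 hC₁0
        _ ≤ (n + 1) * (C₁ + C₂) * G :=
          mul_le_mul_of_nonneg_right (by nlinarith) (abs_nonneg _)
    -- the power is differentiated away; `K` is bounded in terms of `n`
    · have h1 := hlow (2 * K + 2) (by omega)
      rw [if_neg (by omega), mul_one] at hup
      rw [Nat.sub_self, pow_zero, mul_one, Nat.descFactorial_self] at h1
      have hfac : (1 : ℝ) ≤ (2 * K + 2)! := by exact_mod_cast Nat.factorial_pos _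
      have hKn : (K : ℝ) ≤ n + 1 := by
        have : K ≤ n + 1 := by omega
        exact_mod_cast this
      have h2 : H ≤ (C₁ + C₂) * if Even (n + 1 - (2 * K + 2)) then 1 else |x| := by
        split_ifs with he
        · linarith
        · have : Even n := by
            rw [Nat.even_sub (by omega)] at he
            have h3 : Even (2 * K + 2) := ⟨K + 1, by ring⟩
            simp only [h3, iff_true] at he
            rw [Nat.even_add_one, not_not] at he
            exact he
          have := hC₂ this θ h0 hM x hx.le K hnK
          nlinarith [abs_nonneg x]
      have h4 : (if Even (n + 1 - (2 * K + 2)) then 1 else |x|) ≤ G :=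
        le_trans (le_mul_of_one_le_left (by split_ifs <;> positivity) hfac) h1
      calc K * H ≤ (n + 1) * ((C₁ + C₂) * G) :=
            mul_le_mul hKn (h2.trans (mul_le_mul_of_nonneg_left h4 (by positivity)))
              (abs_nonneg _) (by positivity)
        _ = _ := by ring

/-- The derivatives of `log (1 + θ x ^ 2)` are `O(θ)`, which makes sums of such terms smooth. -/
lemma exists_iteratedDeriv_log_le {M : ℝ} (m : ℕ) : ∃ C : ℝ, 0 ≤ C ∧
    ∀ θ, 0 ≤ θ → θ ≤ M → ∀ x : ℝ, |x| ≤ 1 →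
      |iteratedDeriv m (fun x => Real.log (1 + θ * x ^ 2)) x| ≤ C * θ := by
  have e : ∀ θ : ℝ, (fun x => Real.log (1 + θ * x ^ 2)) = fun x => logRem 0 (θ * x ^ 2) := by
    intro θ; ext x; simp [logRem]
  simp only [e]
  rcases m with _ | n
  · refine ⟨1, zero_le_one, fun θ h0 _ x hx => ?_⟩
    rw [iteratedDeriv_zero, one_mul]
    refine (abs_logRem_le 0 (by positivity)).trans ?_
    have : x ^ 2 ≤ 1 := (sq_le_one_iff_abs_le_one x).2 hx
    simp only [zero_add, pow_one, Nat.cast_zero, div_one]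
    exact mul_le_of_le_one_right h0 this
  · obtain ⟨C, hC0, hC⟩ := exists_iteratedDeriv_pow_mul_le M n
    refine ⟨2 * C, by positivity, fun θ h0 hM x hx => ?_⟩
    rw [iteratedDeriv_logRem_comp n 0 h0]
    have h1 := hC θ h0 hM x hx 1
    have h2 : (if n ≤ 1 then (Nat.descFactorial 1 n : ℝ) * |x| ^ (1 - n) else 1) ≤ 1 := by
      split_ifs with h
      · have : (Nat.descFactorial 1 n : ℝ) ≤ 1 := by
          interval_cases n <;> simp
        exact mul_le_one₀ this (by positivity) (pow_le_one₀ (abs_nonneg x) hx)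
      · exact le_rfl
    have h3 := h1.trans (mul_le_of_le_one_right hC0 h2)
    simp only [mul_zero, zero_add, pow_one] at h3 ⊢
    nlinarith

/-! ### Termwise differentiation -/

section Tsum

variable {ι : Type*} {f : ι → ℝ → ℝ}

lemma hasDerivAt_tsum_iteratedDeriv (hf : ∀ i, ContDiff ℝ ∞ (f i))
    (hb : ∀ (m : ℕ) (A : ℝ), 0 < A → ∃ v : ι → ℝ, Summable v ∧
      ∀ i s, |s| < A → |iteratedDeriv m (f i) s| ≤ v i) (m : ℕ) (s : ℝ) :
    HasDerivAt (fun s => ∑' i, iteratedDeriv m (f i) s) (∑' i, iteratedDeriv (m + 1) (f i) s) s := by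
  obtain ⟨v, hv, hvb⟩ := hb (m + 1) (|s| + 1) (by positivity)
  obtain ⟨w, hw, hwb⟩ := hb m (|s| + 1) (by positivity)
  have hball : ∀ z : ℝ, z ∈ Metric.ball (0 : ℝ) (|s| + 1) ↔ |z| < |s| + 1 := fun z => by simp
  have h0 : |(0 : ℝ)| < |s| + 1 := by rw [abs_zero]; positivity
  refine hasDerivAt_tsum_of_isPreconnected (g := fun i s => iteratedDeriv m (f i) s)
    (g' := fun i s => iteratedDeriv (m + 1) (f i) s) (t := Metric.ball 0 (|s| + 1)) (y₀ := 0)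
    hv Metric.isOpen_ball (convex_ball 0 _).isPreconnected (fun i z _ => ?_)
    (fun i z hz => hvb i z ((hball z).1 hz)) ((hball 0).2 h0)
    (Summable.of_norm_bounded hw fun i => hwb i 0 h0) ((hball s).2 (lt_add_one _))
  simp only [iteratedDeriv_succ]
  exact ((hf i).differentiable_iteratedDeriv m
    (by exact_mod_cast WithTop.coe_lt_top _)).differentiableAt.hasDerivAt

/-- Termwise differentiation of a series of smooth functions, under locally uniform bounds. -/
lemma iteratedDeriv_tsum_of_local_bound (hf : ∀ i, ContDiff ℝ ∞ (f i))
    (hb : ∀ (m : ℕ) (A : ℝ), 0 < A → ∃ v : ι → ℝ, Summable v ∧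
      ∀ i s, |s| < A → |iteratedDeriv m (f i) s| ≤ v i) (m : ℕ) :
    iteratedDeriv m (fun s => ∑' i, f i s) = fun s => ∑' i, iteratedDeriv m (f i) s := by
  induction m with
  | zero => simp
  | succ m ih =>
    ext s
    rw [iteratedDeriv_succ, ih]
    exact (hasDerivAt_tsum_iteratedDeriv hf hb m s).deriv

lemma contDiff_tsum_of_local_bound (hf : ∀ i, ContDiff ℝ ∞ (f i))
    (hb : ∀ (m : ℕ) (A : ℝ), 0 < A → ∃ v : ι → ℝ, Summable v ∧
      ∀ i s, |s| < A → |iteratedDeriv m (f i) s| ≤ v i) :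
    ContDiff ℝ ∞ (fun s => ∑' i, f i s) := by
  refine contDiff_of_differentiable_iteratedDeriv fun m _ => ?_
  rw [iteratedDeriv_tsum_of_local_bound hf hb m]
  exact fun s => (hasDerivAt_tsum_iteratedDeriv hf hb m s).differentiableAt

end Tsum

/-! ### Sums of terms `log (1 + l s ^ 2)` -/

lemma contDiff_log_one_add {l : ℝ} (hl : 0 ≤ l) {n : WithTop ℕ∞} :
    ContDiff ℝ n fun s : ℝ => Real.log (1 + l * s ^ 2) :=
  ContDiff.log (by fun_prop) fun s => by positivity

section LogSeries

variable {ι : Type*} {l : ι → ℝ}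

lemma log_one_add_local_bound (h0 : ∀ i, 0 ≤ l i) (hs : Summable l) (m : ℕ) (A : ℝ) (hA : 0 < A) :
    ∃ v : ι → ℝ, Summable v ∧ ∀ i s, |s| < A →
      |iteratedDeriv m (fun s : ℝ => Real.log (1 + l i * s ^ 2)) s| ≤ v i := by
  obtain ⟨C, hC0, hC⟩ := exists_iteratedDeriv_log_le (M := (∑' i, l i) * A ^ 2) m
  refine ⟨fun i => A⁻¹ ^ m * (C * (l i * A ^ 2)), ((hs.mul_right _).mul_left _).mul_left _,
    fun i s hsA => ?_⟩
  have e : (fun s : ℝ => Real.log (1 + l i * s ^ 2)) =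
      fun s => (fun x => Real.log (1 + l i * A ^ 2 * x ^ 2)) (A⁻¹ * s) := by
    ext s
    simp only
    congr 2
    field_simp
  rw [e, iteratedDeriv_comp_mul_left m (fun x => Real.log (1 + l i * A ^ 2 * x ^ 2)), abs_mul, abs_of_nonneg (by positivity : 0 ≤ A⁻¹ ^ m)]
  refine mul_le_mul_of_nonneg_left (hC _ (mul_nonneg (h0 i) (sq_nonneg A)) ?_ _ ?_) (by positivity)
  · exact mul_le_mul_of_nonneg_right (hs.le_tsum i fun j _ => h0 j) (sq_nonneg A)
  · rw [abs_mul, abs_of_nonneg (by positivity), ← div_eq_inv_mul, div_le_one hA]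
    exact hsA.le

lemma contDiff_logSeries (h0 : ∀ i, 0 ≤ l i) (hs : Summable l) :
    ContDiff ℝ ∞ fun s : ℝ => ∑' i, Real.log (1 + l i * s ^ 2) :=
  contDiff_tsum_of_local_bound (fun i => contDiff_log_one_add (h0 i))
    (log_one_add_local_bound h0 hs)

lemma summable_pow_of_summable (h0 : ∀ i, 0 ≤ l i) (hs : Summable l) {k : ℕ} (hk : 1 ≤ k) :
    Summable fun i => l i ^ k := by
  refine Summable.of_nonneg_of_le (fun i => pow_nonneg (h0 i) k) (fun i => ?_)
    (hs.mul_right ((∑' i, l i) ^ (k - 1)))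
  obtain ⟨n, rfl⟩ := Nat.exists_eq_add_of_le' hk
  rw [pow_succ', Nat.add_sub_cancel]
  exact mul_le_mul_of_nonneg_left
    (pow_le_pow_left₀ (h0 i) (hs.le_tsum i fun j _ => h0 j) n) (h0 i)

end LogSeries

/-- The remainder of one term `log (1 + l s ^ 2)`, by the scaling `s = τ x`, `θ = l τ ^ 2`. -/
lemma exists_iteratedDeriv_logRem_le {M : ℝ} (hM0 : 0 ≤ M) (m : ℕ) :
    ∃ C : ℝ, 0 ≤ C ∧ ∀ l τ : ℝ, 0 ≤ l → 0 < τ → l * τ ^ 2 ≤ M → ∀ K : ℕ, 1 ≤ K →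
      ∀ s : ℝ, |s| < τ →
        |iteratedDeriv m (fun s => logRem K (l * s ^ 2)) s| ≤
          C * (l ^ K / K) * |iteratedDeriv m (fun s => s ^ (2 * K + 2) / (τ ^ 2 - s ^ 2)) s| := by
  obtain ⟨C, hC0, hC⟩ := exists_iteratedDeriv_logRem_le_errorModel hM0 m
  refine ⟨C, hC0, fun l τ hl hτ hM K hK s hs => ?_⟩
  have hτ' : τ ≠ 0 := hτ.ne'
  have e1 : (fun s : ℝ => logRem K (l * s ^ 2)) =
      fun s => (fun x => logRem K (l * τ ^ 2 * x ^ 2)) (τ⁻¹ * s) := by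
    ext s
    simp only
    congr 1
    field_simp
  have e2 : (fun s : ℝ => s ^ (2 * K + 2) / (τ ^ 2 - s ^ 2)) =
      fun s => τ ^ (2 * K) * errorModel K (τ⁻¹ * s) := by
    ext s
    have h : τ ^ 2 - s ^ 2 = τ ^ 2 * (1 - (τ⁻¹ * s) ^ 2) := by field_simp
    rw [errorModel, h, mul_pow τ⁻¹ s (2 * K + 2), inv_pow, pow_add τ, div_mul_eq_div_div, ← mul_div_assoc]
    congr 1
    field_simp
  have hx : |τ⁻¹ * s| < 1 := by
    rw [abs_mul, abs_of_pos (inv_pos.2 hτ), ← div_eq_inv_mul, div_lt_one hτ]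
    exact hs
  rw [e1, iteratedDeriv_comp_mul_left m (fun x => logRem K (l * τ ^ 2 * x ^ 2)), e2,
    iteratedDeriv_const_mul_field, iteratedDeriv_comp_mul_left, abs_mul, abs_mul, abs_mul,
    abs_of_nonneg (by positivity : 0 ≤ τ⁻¹ ^ m), abs_of_nonneg (by positivity : 0 ≤ τ ^ (2 * K))]
  refine (mul_le_mul_of_nonneg_left (hC _ (by positivity) hM K hK _ hx) (by positivity)).trans_eq ?_
  rw [mul_pow, ← pow_mul]
  ring

/-- The comparison for a sum of terms `log (1 + l s ^ 2)`: the power sums of the `l i` are the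
coefficients of the main term and of the error term. -/
theorem exists_iteratedDeriv_logSeries_sub_le {M : ℝ} (hM0 : 0 ≤ M) (m : ℕ) :
    ∃ C : ℝ, ∀ (ι : Type) (l : ι → ℝ) (τ : ℝ), (∀ i, 0 ≤ l i) → Summable l → 0 < τ →
      (∀ i, l i * τ ^ 2 ≤ M) → ∀ K : ℕ, 1 ≤ K → ∀ s : ℝ, |s| < τ →
        |iteratedDeriv m (fun s => ∑' i, Real.log (1 + l i * s ^ 2)) s -
          iteratedDeriv m
            (fun s => ∑ k ∈ Finset.Icc 1 K, (-1) ^ (k - 1) * ((∑' i, l i ^ k) / k) * s ^ (2 * k)) s|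
        ≤ C * |iteratedDeriv m
            (fun s => (∑' i, l i ^ K) / K * (s ^ (2 * K + 2) / (τ ^ 2 - s ^ 2))) s| := by
  obtain ⟨C, hC0, hC⟩ := exists_iteratedDeriv_logRem_le hM0 m
  refine ⟨C, fun ι l τ h0 hs hτ hM K hK s hsτ => ?_⟩
  set G := |iteratedDeriv m (fun s => s ^ (2 * K + 2) / (τ ^ 2 - s ^ 2)) s| with hG
  have hp : ∀ k ∈ Finset.Icc 1 K, Summable fun i => l i ^ k := fun k hk =>
    summable_pow_of_summable h0 hs (Finset.mem_Icc.1 hk).1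
  obtain ⟨v, hv, hvb⟩ := log_one_add_local_bound h0 hs m τ hτ
  have hF : HasSum (fun i => iteratedDeriv m (fun s : ℝ => Real.log (1 + l i * s ^ 2)) s)
      (iteratedDeriv m (fun s => ∑' i, Real.log (1 + l i * s ^ 2)) s) := by
    rw [iteratedDeriv_tsum_of_local_bound (fun i => contDiff_log_one_add (h0 i))
      (log_one_add_local_bound h0 hs) m]
    exact (Summable.of_norm_bounded hv fun i => hvb i s hsτ).hasSum
  have hP : HasSum (fun i => ∑ k ∈ Finset.Icc 1 K,
        (-1) ^ (k - 1) * (l i ^ k / k) * iteratedDeriv m (fun s : ℝ => s ^ (2 * k)) s)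
      (iteratedDeriv m
        (fun s => ∑ k ∈ Finset.Icc 1 K, (-1) ^ (k - 1) * ((∑' i, l i ^ k) / k) * s ^ (2 * k)) s) := by
    rw [iteratedDeriv_fun_sum fun k _ => by fun_prop]
    simp only [iteratedDeriv_const_mul_field]
    exact hasSum_sum fun k hk => (((hp k hk).hasSum.div_const _).mul_left _).mul_right _
  have hterm : ∀ i, iteratedDeriv m (fun s : ℝ => Real.log (1 + l i * s ^ 2)) s -
      ∑ k ∈ Finset.Icc 1 K,
        (-1) ^ (k - 1) * (l i ^ k / k) * iteratedDeriv m (fun s : ℝ => s ^ (2 * k)) s =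
      iteratedDeriv m (fun s => logRem K (l i * s ^ 2)) s := by
    intro i
    have e : (fun s : ℝ => logRem K (l i * s ^ 2)) = fun s => Real.log (1 + l i * s ^ 2) -
        ∑ k ∈ Finset.Icc 1 K, (-1) ^ (k - 1) * (l i ^ k / k) * s ^ (2 * k) := by
      ext s
      rw [logRem]
      congr 1
      refine Finset.sum_congr rfl fun k _ => ?_
      rw [mul_pow, ← pow_mul]; ring
    rw [e, iteratedDeriv_fun_sub (contDiff_log_one_add (h0 i)).contDiffAt
      (ContDiff.contDiffAt (by fun_prop)), iteratedDeriv_fun_sum fun k _ => by fun_prop]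
    simp only [iteratedDeriv_const_mul_field]
  have hD := hF.sub hP
  simp only [hterm] at hD
  have hK' : Summable fun i => l i ^ K := summable_pow_of_summable h0 hs hK
  have hpK : 0 ≤ (∑' i, l i ^ K) / K := div_nonneg (tsum_nonneg fun i => pow_nonneg (h0 i) K)
    (Nat.cast_nonneg K)
  rw [iteratedDeriv_const_mul_field, abs_mul, abs_of_nonneg hpK, ← hG, ← hD.tsum_eq, ← mul_assoc]
  exact tsum_of_norm_bounded (f := fun i => iteratedDeriv m (fun s => logRem K (l i * s ^ 2)) s)
    (((hK'.hasSum.div_const (K : ℝ)).mul_left C).mul_right G)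
    fun i => hC (l i) τ (h0 i) hτ (hM i) K hK s hsτ

/-! ### The arcsine law -/

lemma cos_image_Ioo : Real.cos '' Set.Ioo 0 Real.pi = Set.Ioo (-1) 1 := by
  ext x
  constructor
  · rintro ⟨θ, ⟨h0, h1⟩, rfl⟩
    have a := Real.cos_lt_cos_of_nonneg_of_le_pi le_rfl h1.le h0
    have b := Real.cos_lt_cos_of_nonneg_of_le_pi h0.le le_rfl h1
    rw [Real.cos_zero] at a
    rw [Real.cos_pi] at b
    exact ⟨b, a⟩
  · rintro ⟨h0, h1⟩
    refine ⟨Real.arccos x, ⟨Real.arccos_pos.2 h1, ?_⟩, Real.cos_arccos h0.le h1.le⟩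
    refine lt_of_le_of_ne (Real.arccos_le_pi x) fun h => ?_
    rw [Real.arccos_eq_pi] at h
    linarith

lemma arcsineLaw_eq : arcsineLaw = (volume.restrict (Set.Ioo (-1) 1)).withDensity
    fun x : ℝ => ENNReal.ofReal (1 / (Real.pi * √(1 - x ^ 2))) :=
  withDensity_indicator measurableSet_Ioo _

lemma integral_arcsineLaw (g : ℝ → ℝ) :
    ∫ x, g x ∂arcsineLaw = Real.pi⁻¹ * ∫ θ in (0 : ℝ)..Real.pi, g (Real.cos θ) := by
  rw [arcsineLaw_eq, integral_withDensity_eq_integral_toReal_smul (by fun_prop)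
    (Eventually.of_forall fun _ => ENNReal.ofReal_lt_top), ← cos_image_Ioo,
    integral_image_eq_integral_abs_deriv_smul measurableSet_Ioo
      (fun x _ => (Real.hasDerivAt_cos x).hasDerivWithinAt)
      (Real.injOn_cos.mono Set.Ioo_subset_Icc_self),
    intervalIntegral.integral_of_le Real.pi_pos.le, integral_Ioc_eq_integral_Ioo,
    ← integral_const_mul]
  refine setIntegral_congr_fun measurableSet_Ioo fun θ hθ => ?_
  have hs : 0 < Real.sin θ := Real.sin_pos_of_pos_of_lt_pi hθ.1 hθ.2
  have h2 : √(1 - Real.cos θ ^ 2) = Real.sin θ := by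
    rw [← Real.sin_sq, Real.sqrt_sq hs.le]
  simp only [h2, smul_eq_mul]
  rw [ENNReal.toReal_ofReal (by positivity), abs_neg, abs_of_pos hs]
  field_simp

lemma ae_abs_lt_one_arcsineLaw : ∀ᵐ x ∂arcsineLaw, |x| < 1 := by
  rw [arcsineLaw_eq]
  refine (withDensity_absolutelyContinuous _ _).ae_le ?_
  filter_upwards [ae_restrict_mem measurableSet_Ioo] with x hx
  exact abs_lt.2 hx

lemma integral_cos_pow_add_two (n : ℕ) : ∫ θ in (0 : ℝ)..Real.pi, Real.cos θ ^ (n + 2) =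
    (n + 1) / (n + 2) * ∫ θ in (0 : ℝ)..Real.pi, Real.cos θ ^ n := by
  rw [integral_cos_pow]; simp

lemma integral_cos_pow_odd (n : ℕ) :
    ∫ θ in (0 : ℝ)..Real.pi, Real.cos θ ^ (2 * n + 1) = 0 := by
  induction n with
  | zero => simp
  | succ n ih =>
    rw [show 2 * (n + 1) + 1 = (2 * n + 1) + 2 by ring, integral_cos_pow_add_two, ih, mul_zero]

lemma integral_cos_pow_even (n : ℕ) : ∫ θ in (0 : ℝ)..Real.pi, Real.cos θ ^ (2 * n) =
    Real.pi * ((2 * n)! / (4 ^ n * (n ! : ℝ) ^ 2)) := by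
  induction n with
  | zero => simp
  | succ n ih =>
    rw [show 2 * (n + 1) = 2 * n + 2 by ring, integral_cos_pow_add_two, ih, Nat.factorial_succ,
      Nat.factorial_succ, Nat.factorial_succ]
    push_cast
    field_simp
    ring

/-- The moment generating function of the arcsine law is the Bessel function `I_0`. -/
lemma integral_exp_arcsineLaw (t : ℝ) :
    ∫ x, Real.exp (t * x) ∂arcsineLaw = besselReal (t ^ 2 / 4) := by
  rw [integral_arcsineLaw]
  have h := intervalIntegral.hasSum_integral_of_dominated_convergence (μ := volume)
    (a := 0) (b := Real.pi) (F := fun (n : ℕ) θ => t ^ n / (n ! : ℝ) * Real.cos θ ^ n)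
    (f := fun θ => Real.exp (t * Real.cos θ)) (fun n _ => |t| ^ n / (n ! : ℝ))
    (fun n => Continuous.aestronglyMeasurable (by fun_prop))
    (fun n => Eventually.of_forall fun θ _ => by
      rw [norm_mul, norm_div, norm_pow, norm_pow, Real.norm_natCast, Real.norm_eq_abs,
        Real.norm_eq_abs]
      exact mul_le_of_le_one_right (by positivity)
        (pow_le_one₀ (abs_nonneg _) (Real.abs_cos_le_one θ)))
    (Eventually.of_forall fun θ _ => Real.summable_pow_div_factorial |t|)
    intervalIntegrable_const
    (Eventually.of_forall fun θ _ => by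
      have := NormedSpace.expSeries_div_hasSum_exp (𝔸 := ℝ) (t * Real.cos θ)
      rw [← Real.exp_eq_exp_ℝ] at this
      refine this.congr_fun fun n => ?_
      rw [mul_pow]; ring)
  simp only [intervalIntegral.integral_const_mul] at h
  have hinj : Function.Injective fun n : ℕ => 2 * n := fun m n h => by simpa using h
  have h2 := (hinj.hasSum_iff (fun n hn => by
    have hodd : Odd n := Nat.not_even_iff_odd.1 fun ⟨m, hm⟩ => hn ⟨m, by simp only; omega⟩
    obtain ⟨m, rfl⟩ := hodd
    rw [integral_cos_pow_odd, mul_zero])).2 h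
  rw [← h2.tsum_eq, ← tsum_mul_left, besselReal]
  refine tsum_congr fun n => ?_
  have hfac : ((2 * n)! : ℝ) ≠ 0 := by exact_mod_cast Nat.factorial_ne_zero _
  rw [Function.comp_apply, integral_cos_pow_even, div_pow, ← pow_mul]
  have := Real.pi_ne_zero
  field_simp

lemma integral_id_arcsineLaw : ∫ x, x ∂arcsineLaw = 0 := by
  rw [integral_arcsineLaw]; simp

lemma integrable_exp_arcsineLaw (t : ℝ) : Integrable (fun x => Real.exp (t * x)) arcsineLaw := by
  refine Integrable.of_bound (by fun_prop) (Real.exp |t|) ?_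
  filter_upwards [ae_abs_lt_one_arcsineLaw] with x hx
  rw [Real.norm_of_nonneg (Real.exp_pos _).le]
  refine Real.exp_le_exp.2 ((le_abs_self _).trans ?_)
  rw [abs_mul]
  exact mul_le_of_le_one_right (abs_nonneg _) hx.le

lemma integrable_id_arcsineLaw : Integrable (fun x : ℝ => x) arcsineLaw := by
  refine Integrable.of_bound (by fun_prop) 1 ?_
  filter_upwards [ae_abs_lt_one_arcsineLaw] with x hx using hx.le

lemma besselReal_le_exp {x : ℝ} (hx : 0 ≤ x) : besselReal x ≤ Real.exp x := by
  have hexp : HasSum (fun n : ℕ => x ^ n / (n ! : ℝ)) (Real.exp x) := by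
    rw [Real.exp_eq_exp_ℝ]; exact NormedSpace.expSeries_div_hasSum_exp x
  rw [← hexp.tsum_eq]
  refine (summable_besselReal x).tsum_le_tsum (fun n => ?_) hexp.summable
  have h1 : (1 : ℝ) ≤ n ! := by exact_mod_cast n.factorial_pos
  rw [mul_comm, div_eq_mul_one_div (x ^ n)]
  refine mul_le_mul_of_nonneg_left ?_ (by positivity)
  exact one_div_le_one_div_of_le (by positivity) (by nlinarith)

/-! ### Convergence of expectations -/

/-- Expectations converge under almost sure convergence and boundedness in `L²`. -/
lemma tendsto_integral_of_sq_bounded {Ω : Type*} [MeasurableSpace Ω] {μ : Measure Ω}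
    [IsProbabilityMeasure μ] {f : ℕ → Ω → ℝ} {g : Ω → ℝ} {C : ℝ}
    (hf : ∀ n, AEStronglyMeasurable (f n) μ) (hf0 : ∀ n x, 0 ≤ f n x) (hg0 : ∀ x, 0 ≤ g x)
    (hsq : ∀ n, Integrable (fun x => f n x ^ 2) μ) (hC : ∀ n, ∫ x, f n x ^ 2 ∂μ ≤ C)
    (hlim : ∀ᵐ x ∂μ, Tendsto (fun n => f n x) atTop (𝓝 (g x))) :
    Integrable g μ ∧ Tendsto (fun n => ∫ x, f n x ∂μ) atTop (𝓝 (∫ x, g x ∂μ)) := by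
  have hgm : AEStronglyMeasurable g μ := aestronglyMeasurable_of_tendsto_ae atTop hf hlim
  have hC0 : 0 ≤ C := (integral_nonneg fun x => sq_nonneg (f 0 x)).trans (hC 0)
  -- Fatou's lemma
  have hfatou : ∫⁻ x, ENNReal.ofReal (g x ^ 2) ∂μ ≤ ENNReal.ofReal C := by
    calc ∫⁻ x, ENNReal.ofReal (g x ^ 2) ∂μ
        = ∫⁻ x, liminf (fun n => ENNReal.ofReal (f n x ^ 2)) atTop ∂μ := by
          refine lintegral_congr_ae ?_
          filter_upwards [hlim] with x hx
          exact ((ENNReal.tendsto_ofReal (hx.pow 2)).liminf_eq).symm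
      _ ≤ liminf (fun n => ∫⁻ x, ENNReal.ofReal (f n x ^ 2) ∂μ) atTop :=
          lintegral_liminf_le' fun n => ((hf n).aemeasurable.pow_const 2).ennreal_ofReal
      _ ≤ liminf (fun _ : ℕ => ENNReal.ofReal C) atTop := by
          refine liminf_le_liminf (Eventually.of_forall fun n => ?_)
          rw [← ofReal_integral_eq_lintegral_ofReal (hsq n)
            (Eventually.of_forall fun x => sq_nonneg _)]
          exact ENNReal.ofReal_le_ofReal (hC n)
      _ = ENNReal.ofReal C := liminf_const _
  have hgsq : Integrable (fun x => g x ^ 2) μ := by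
    refine ⟨hgm.pow 2, ?_⟩
    rw [hasFiniteIntegral_iff_ofReal (Eventually.of_forall fun x => sq_nonneg _)]
    exact hfatou.trans_lt ENNReal.ofReal_lt_top
  have hgC : ∫ x, g x ^ 2 ∂μ ≤ C := by
    rw [integral_eq_lintegral_of_nonneg_ae (Eventually.of_forall fun x => sq_nonneg _) (hgm.pow 2)]
    exact ENNReal.toReal_le_of_le_ofReal hC0 hfatou
  have hint : ∀ h : Ω → ℝ, AEStronglyMeasurable h μ → (∀ x, 0 ≤ h x) →
      Integrable (fun x => h x ^ 2) μ → Integrable h μ := fun h hm h0 h2 => by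
    refine Integrable.mono' ((integrable_const 1).add h2) hm (Eventually.of_forall fun x => ?_)
    rw [Real.norm_of_nonneg (h0 x)]
    simp only [Pi.add_apply]
    nlinarith [sq_nonneg (h x - 1), sq_nonneg (h x)]
  have hgi := hint g hgm hg0 hgsq
  refine ⟨hgi, ?_⟩
  -- the error made by truncating at height `N` is at most `C / N`
  have htrunc : ∀ N : ℝ, 0 < N → ∀ h : Ω → ℝ, AEStronglyMeasurable h μ → (∀ x, 0 ≤ h x) →
      Integrable (fun x => h x ^ 2) μ → ∫ x, h x ^ 2 ∂μ ≤ C →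
      |∫ x, h x ∂μ - ∫ x, min (h x) N ∂μ| ≤ C / N := by
    intro N hN h hm h0 h2 hhC
    have hi := hint h hm h0 h2
    have hi' : Integrable (fun x => min (h x) N) μ := hi.inf (integrable_const N)
    rw [← integral_sub hi hi', abs_of_nonneg (integral_nonneg fun x => by
      simp)]
    calc ∫ x, (h x - min (h x) N) ∂μ ≤ ∫ x, h x ^ 2 / N ∂μ := by
          refine integral_mono (hi.sub hi') (h2.div_const N) fun x => ?_
          simp only
          rw [le_div_iff₀ hN]
          rcases le_total (h x) N with hc | hc
          · rw [min_eq_left hc, sub_self, zero_mul]; positivity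
          · rw [min_eq_right hc]; nlinarith [h0 x]
      _ ≤ C / N := by
          rw [integral_div]
          exact div_le_div_of_nonneg_right hhC hN.le
  rw [Metric.tendsto_atTop]
  intro ε hε
  obtain ⟨N, hN0, hN⟩ : ∃ N : ℝ, 0 < N ∧ C / N < ε / 4 := by
    refine ⟨4 * (C + 1) / ε, by positivity, ?_⟩
    rw [div_lt_iff₀ (by positivity)]
    field_simp
    linarith
  have hdom : Tendsto (fun n => ∫ x, min (f n x) N ∂μ) atTop (𝓝 (∫ x, min (g x) N ∂μ)) := by
    refine tendsto_integral_of_dominated_convergence (fun _ => N)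
      (fun n => (hf n).inf aestronglyMeasurable_const) (integrable_const N) (fun n => ?_) ?_
    · refine Eventually.of_forall fun x => ?_
      rw [Real.norm_of_nonneg (le_min (hf0 n x) hN0.le)]
      exact min_le_right _ _
    · filter_upwards [hlim] with x hx using hx.min tendsto_const_nhds
  obtain ⟨n₀, hn₀⟩ := (Metric.tendsto_atTop.1 hdom) (ε / 2) (by positivity)
  refine ⟨n₀, fun n hn => ?_⟩
  have h1 := htrunc N hN0 (f n) (hf n) (hf0 n) (hsq n) (hC n)
  have h2 := htrunc N hN0 g hgm hg0 hgsq hgC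
  have h3 := hn₀ n hn
  rw [Real.dist_eq] at h3 ⊢
  rw [abs_lt] at h3 ⊢
  rw [abs_le] at h1 h2
  constructor <;> linarith [h1.1, h1.2, h2.1, h2.2, h3.1, h3.2]

/-! ### Random series with arcsine terms -/

section RandomSeries

open ProbabilityTheory

variable {ι : Type*}

/-- The law of an independent family of variables with the arcsine law. -/
noncomputable abbrev arcsineFamily (ι : Type*) : Measure (ι → ℝ) :=
  Measure.infinitePi fun _ : ι => arcsineLaw

lemma integral_eval_arcsineFamily (i : ι) {g : ℝ → ℝ} (hg : Measurable g) :
    ∫ X : ι → ℝ, g (X i) ∂arcsineFamily ι = ∫ x, g x ∂arcsineLaw := by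
  have h := measurePreserving_eval_infinitePi (fun _ : ι => arcsineLaw) i
  conv_rhs => rw [← h.map_eq]
  rw [integral_map h.measurable.aemeasurable hg.aestronglyMeasurable]

lemma integrable_eval_arcsineFamily (i : ι) {g : ℝ → ℝ} (hg : Integrable g arcsineLaw) :
    Integrable (fun X : ι → ℝ => g (X i)) (arcsineFamily ι) :=
  (measurePreserving_eval_infinitePi (fun _ : ι => arcsineLaw) i).integrable_comp_of_integrable hg

lemma iIndepFun_arcsineFamily (a : ι → ℝ) :
    iIndepFun (fun i (X : ι → ℝ) => a i * X i) (arcsineFamily ι) :=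
  iIndepFun_infinitePi (X := fun i x => a i * x) fun i => by fun_prop

lemma integrable_exp_sum (a : ι → ℝ) (A : Finset ι) (s : ℝ) :
    Integrable (fun X : ι → ℝ => Real.exp (s * ∑ i ∈ A, a i * X i)) (arcsineFamily ι) := by
  have h := (iIndepFun_arcsineFamily a).integrable_exp_mul_sum (s := A) (t := s)
    (fun i => by fun_prop) fun i _ => by
      have := integrable_eval_arcsineFamily i (integrable_exp_arcsineLaw (s * a i))
      simpa only [mul_assoc] using this
  simpa only [Finset.sum_apply] using h

lemma integral_exp_sum (a : ι → ℝ) (A : Finset ι) (s : ℝ) :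
    ∫ X : ι → ℝ, Real.exp (s * ∑ i ∈ A, a i * X i) ∂arcsineFamily ι =
      ∏ i ∈ A, besselReal (a i ^ 2 / 4 * s ^ 2) := by
  have h := (iIndepFun_arcsineFamily a).mgf_sum (t := s) (fun i => by fun_prop) A
  simp only [mgf, Finset.sum_apply] at h
  rw [h]
  refine Finset.prod_congr rfl fun i _ => ?_
  have e := integral_eval_arcsineFamily i (g := fun x => Real.exp (s * a i * x)) (by fun_prop)
  simp only [mul_assoc] at e ⊢
  rw [e]
  simp only [← mul_assoc]
  rw [integral_exp_arcsineLaw]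
  congr 1
  ring

lemma prod_besselReal_le {a : ι → ℝ} (ha : Summable fun i => a i ^ 2) (A : Finset ι) (s : ℝ) :
    ∏ i ∈ A, besselReal (a i ^ 2 / 4 * s ^ 2) ≤ Real.exp ((∑' i, a i ^ 2) / 4 * s ^ 2) := by
  calc ∏ i ∈ A, besselReal (a i ^ 2 / 4 * s ^ 2)
      ≤ ∏ i ∈ A, Real.exp (a i ^ 2 / 4 * s ^ 2) :=
        Finset.prod_le_prod (fun i _ => zero_le_one.trans (one_le_besselReal (by positivity)))
          fun i _ => besselReal_le_exp (by positivity)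
    _ = Real.exp ((∑ i ∈ A, a i ^ 2) / 4 * s ^ 2) := by
        rw [← Real.exp_sum, Finset.sum_div, Finset.sum_mul]
    _ ≤ _ := by
        refine Real.exp_le_exp.2 ?_
        gcongr
        exact ha.sum_le_tsum A fun i _ => sq_nonneg _

lemma integrable_sum (a : ι → ℝ) (A : Finset ι) :
    Integrable (fun X : ι → ℝ => ∑ i ∈ A, a i * X i) (arcsineFamily ι) :=
  integrable_finsetSum _ fun i _ =>
    (integrable_eval_arcsineFamily i integrable_id_arcsineLaw).const_mul (a i)

/-- The martingale convergence theorem for a random series summed along an increasing sequence of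
finite sets. -/
lemma ae_exists_tendsto_sum {a : ι → ℝ} (ha : Summable fun i => a i ^ 2) {A : ℕ → Finset ι}
    (hA : Monotone A) :
    ∀ᵐ X ∂arcsineFamily ι, ∃ c, Tendsto (fun n => ∑ i ∈ A n, a i * X i) atTop (𝓝 c) := by
  classical
  set m : ι → MeasurableSpace (ι → ℝ) := fun i =>
    MeasurableSpace.comap (fun X : ι → ℝ => X i) inferInstance with hm
  have hmle : ∀ i, m i ≤ MeasurableSpace.pi := fun i => (measurable_pi_apply i).comap_le
  have hind : iIndep m (arcsineFamily ι) :=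
    (iIndepFun_infinitePi (P := fun _ : ι => arcsineLaw) (X := fun _ x => x)
      fun i => measurable_id).iIndep
  have hsm : ∀ (S : Set ι) (B : Finset ι), (∀ i ∈ B, i ∈ S) →
      StronglyMeasurable[⨆ i ∈ S, m i] fun X : ι → ℝ => ∑ i ∈ B, a i * X i := by
    intro S B hB
    refine Measurable.stronglyMeasurable ?_
    refine Finset.measurable_fun_sum B fun i hi => Measurable.const_mul ?_ (a i)
    have h1 : m i ≤ ⨆ i ∈ S, m i := le_iSup₂ (f := fun i (_ : i ∈ S) => m i) i (hB i hi)
    exact (comap_measurable (fun X : ι → ℝ => X i)).mono h1 le_rfl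
  let ℱ : Filtration ℕ (MeasurableSpace.pi : MeasurableSpace (ι → ℝ)) :=
    { seq := fun n => ⨆ i ∈ (A n : Set ι), m i
      mono' := fun p q hpq => biSup_mono fun i hi => hA hpq hi
      le' := fun n => iSup₂_le fun i _ => hmle i }
  have hmart : Martingale (fun n (X : ι → ℝ) => ∑ i ∈ A n, a i * X i) ℱ (arcsineFamily ι) := by
    refine martingale_nat (fun n => hsm _ _ fun i hi => hi) (fun n => integrable_sum a (A n))
      fun n => ?_
    have hsplit : (fun X : ι → ℝ => ∑ i ∈ A (n + 1), a i * X i) =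
        (fun X => ∑ i ∈ A n, a i * X i) + fun X => ∑ i ∈ A (n + 1) \ A n, a i * X i := by
      ext X
      exact ((add_comm _ _).trans (Finset.sum_sdiff (hA n.le_succ))).symm
    rw [hsplit]
    have h1 := condExp_add (integrable_sum a (A n)) (integrable_sum a (A (n + 1) \ A n)) (ℱ n)
    have h2 : (arcsineFamily ι)[fun X => ∑ i ∈ A n, a i * X i | ℱ n] =
        fun X => ∑ i ∈ A n, a i * X i :=
      condExp_of_stronglyMeasurable (ℱ.le n) (hsm _ _ fun i hi => hi) (integrable_sum a (A n))
    have h3 := condExp_indep_eq (m₁ := ⨆ i ∈ ((A (n + 1) \ A n : Finset ι) : Set ι), m i)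
      (iSup₂_le fun i _ => hmle i) (ℱ.le n) (hsm _ (A (n + 1) \ A n) fun i hi => hi)
      (indep_iSup_of_disjoint hmle hind (by
        rw [Finset.disjoint_coe]; exact Finset.sdiff_disjoint))
    have h4 : ∫ X, ∑ i ∈ A (n + 1) \ A n, a i * X i ∂arcsineFamily ι = 0 := by
      rw [integral_finsetSum _ fun i _ =>
        (integrable_eval_arcsineFamily i integrable_id_arcsineLaw).const_mul (a i)]
      refine Finset.sum_eq_zero fun i _ => ?_
      rw [integral_const_mul, integral_eval_arcsineFamily i measurable_id']
      rw [integral_id_arcsineLaw, mul_zero]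
    filter_upwards [h1, h3] with X e1 e3
    rw [e1, Pi.add_apply, h2, e3, h4, add_zero]
  refine hmart.submartingale.exists_ae_tendsto_of_bdd
    (R := (2 * Real.exp ((∑' i, a i ^ 2) / 4)).toNNReal) fun n => ?_
  -- `|x| ≤ exp x + exp (-x)` bounds the first moments
  rw [eLpNorm_one_eq_lintegral_enorm, ← ofReal_integral_norm_eq_lintegral_enorm
    (integrable_sum a (A n))]
  refine ENNReal.ofReal_le_ofReal ?_
  have hle : ∫ X : ι → ℝ, ‖∑ i ∈ A n, a i * X i‖ ∂arcsineFamily ι ≤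
      ∫ X : ι → ℝ, (Real.exp (1 * ∑ i ∈ A n, a i * X i) +
        Real.exp (-1 * ∑ i ∈ A n, a i * X i)) ∂arcsineFamily ι := by
    refine integral_mono (integrable_sum a (A n)).norm
      ((integrable_exp_sum a (A n) 1).add (integrable_exp_sum a (A n) (-1))) fun X => ?_
    simp only [Real.norm_eq_abs, one_mul, neg_one_mul]
    set x := ∑ i ∈ A n, a i * X i
    have hx1 := Real.add_one_le_exp x
    have hx2 := Real.add_one_le_exp (-x)
    have hp1 := Real.exp_pos x
    have hp2 := Real.exp_pos (-x)
    rcases abs_cases x with ⟨h, _⟩ | ⟨h, _⟩ <;> rw [h] <;> linarith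
  refine hle.trans ?_
  rw [integral_add (integrable_exp_sum a (A n) 1) (integrable_exp_sum a (A n) (-1)),
    integral_exp_sum, integral_exp_sum]
  have b1 := prod_besselReal_le ha (A n) 1
  have b2 := prod_besselReal_le ha (A n) (-1)
  rw [show ((-1 : ℝ)) ^ 2 = 1 by norm_num] at b2 ⊢
  rw [one_pow, mul_one] at b1
  rw [mul_one] at b2
  simp only [one_pow] at b1 ⊢
  linarith

variable {e : ι → ℝ}

/-- The limit in the order of increasing `e` may be taken along a real bound: the set where
`e ≤ V` depends on `V` only through its cardinality. -/
lemma ae_exists_tendsto_sum_le (hfin : ∀ V : ℝ, {i | e i ≤ V}.Finite) {a : ι → ℝ}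
    (ha : Summable fun i => a i ^ 2) :
    ∀ᵐ X ∂arcsineFamily ι, ∃ c,
      Tendsto (fun V : ℝ => ∑ i ∈ (hfin V).toFinset, a i * X i) atTop (𝓝 c) := by
  classical
  set B : ℝ → Finset ι := fun V => (hfin V).toFinset with hB
  have hBmem : ∀ V i, i ∈ B V ↔ e i ≤ V := fun V i => by simp [hB]
  have hBmono : Monotone B := fun V W h i hi => (hBmem W i).2 (((hBmem V i).1 hi).trans h)
  set d : ℝ → ℕ := fun V => (B V).card with hd
  have hdmono : Monotone d := fun V W h => Finset.card_le_card (hBmono h)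
  have hBd : ∀ V W, d W ≤ d V → B W ⊆ B V := by
    intro V W h
    rcases le_total W V with hWV | hVW
    · exact hBmono hWV
    · rw [Finset.eq_of_subset_of_card_le (hBmono hVW) h]
  by_cases hbdd : ∃ N, ∀ V, d V ≤ N
  · -- finitely many terms: the partial sums are eventually constant
    obtain ⟨V₀, hV₀⟩ : ∃ V₀, ∀ V, d V ≤ d V₀ := by
      obtain ⟨N, hN⟩ := hbdd
      have hb : BddAbove (Set.range d) := ⟨N, by rintro _ ⟨V, rfl⟩; exact hN V⟩
      obtain ⟨V₀, h⟩ := Nat.sSup_mem (Set.range_nonempty d) hb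
      exact ⟨V₀, fun V => h ▸ le_csSup hb ⟨V, rfl⟩⟩
    refine Eventually.of_forall fun X => ⟨∑ i ∈ B V₀, a i * X i, ?_⟩
    refine tendsto_const_nhds.congr' ?_
    filter_upwards [eventually_ge_atTop V₀] with V hV
    rw [(hBmono hV).antisymm (hBd V₀ V (hV₀ V))]
  · push Not at hbdd
    have hdtop : Tendsto d atTop atTop := tendsto_atTop_atTop.2 fun N => by
      obtain ⟨V, hV⟩ := hbdd N
      exact ⟨V, fun W hW => hV.le.trans (hdmono hW)⟩
    -- the union of those `B V` that have at most `n` elements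
    have hA : ∀ n : ℕ, ∃ A : Finset ι, ∀ i, i ∈ A ↔ d (e i) ≤ n := by
      intro n
      obtain ⟨V, hV⟩ := hbdd n
      refine ⟨(B V).filter fun i => d (e i) ≤ n, fun i => ?_⟩
      rw [Finset.mem_filter, hBmem, and_iff_right_iff_imp]
      intro h
      by_contra! hlt
      exact absurd (hdmono hlt.le) (by omega)
    choose A hA using hA
    have hAmono : Monotone A := fun p q h i hi => (hA q i).2 (((hA p i).1 hi).trans h)
    have hAB : ∀ V, A (d V) = B V := by
      intro V
      ext i
      rw [hA, hBmem]
      refine ⟨fun h => ?_, fun h => hdmono h⟩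
      exact (hBmem V i).1 (hBd V (e i) h ((hBmem _ i).2 le_rfl))
    filter_upwards [ae_exists_tendsto_sum ha hAmono] with X hX
    obtain ⟨c, hc⟩ := hX
    refine ⟨c, (hc.comp hdtop).congr fun V => ?_⟩
    rw [Function.comp_apply, hAB]

/-- The Laplace transform of a random series with independent arcsine terms. -/
theorem laplace_randomSeries (hfin : ∀ V : ℝ, {i | e i ≤ V}.Finite) {a : ι → ℝ}
    (ha : Summable fun i => a i ^ 2) {S : (ι → ℝ) → ℝ}
    (hS : ∀ X, S X = limUnder atTop fun V : ℝ => ∑ i ∈ (hfin V).toFinset, a i * X i) :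
    AEMeasurable S (arcsineFamily ι) ∧ ∀ s : ℝ,
      Integrable (fun X => Real.exp (s * S X)) (arcsineFamily ι) ∧
      ∫ X, Real.exp (s * S X) ∂arcsineFamily ι =
        Real.exp (∑' i, Real.log (besselReal (a i ^ 2 / 4 * s ^ 2))) := by
  have hlim : ∀ᵐ X ∂arcsineFamily ι,
      Tendsto (fun V : ℕ => ∑ i ∈ (hfin V).toFinset, a i * X i) atTop (𝓝 (S X)) := by
    filter_upwards [ae_exists_tendsto_sum_le hfin ha] with X ⟨c, hc⟩
    rw [hS X, hc.limUnder_eq]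
    exact hc.comp tendsto_natCast_atTop_atTop
  refine ⟨aemeasurable_of_tendsto_metrizable_ae atTop (fun n => (integrable_sum a _).aemeasurable)
    hlim, fun s => ?_⟩
  have hsq : ∀ (V : ℕ) (X : ι → ℝ), Real.exp (s * ∑ i ∈ (hfin V).toFinset, a i * X i) ^ 2 =
      Real.exp (2 * s * ∑ i ∈ (hfin V).toFinset, a i * X i) := fun V X => by
    rw [← Real.exp_nat_mul]; congr 1; push_cast; ring
  obtain ⟨hint, htend⟩ := tendsto_integral_of_sq_bounded (μ := arcsineFamily ι)
    (f := fun (V : ℕ) X => Real.exp (s * ∑ i ∈ (hfin V).toFinset, a i * X i))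
    (g := fun X => Real.exp (s * S X)) (C := Real.exp ((∑' i, a i ^ 2) / 4 * (2 * s) ^ 2))
    (fun n => (integrable_exp_sum a _ s).aestronglyMeasurable) (fun n X => (Real.exp_pos _).le)
    (fun X => (Real.exp_pos _).le)
    (fun n => by simp only [hsq]; exact integrable_exp_sum a _ (2 * s))
    (fun n => by
      simp only [hsq]; rw [integral_exp_sum]; exact prod_besselReal_le ha _ (2 * s))
    (by filter_upwards [hlim] with X hX
        exact (Real.continuous_exp.tendsto _).comp (hX.const_mul s))
  refine ⟨hint, tendsto_nhds_unique htend ?_⟩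
  simp only [integral_exp_sum]
  have hpos : ∀ i, 1 ≤ besselReal (a i ^ 2 / 4 * s ^ 2) := fun i =>
    one_le_besselReal (by positivity)
  have hsum : Summable fun i => Real.log (besselReal (a i ^ 2 / 4 * s ^ 2)) := by
    refine Summable.of_nonneg_of_le (fun i => Real.log_nonneg (hpos i)) (fun i => ?_)
      ((ha.div_const 4).mul_right (s ^ 2))
    rw [Real.log_le_iff_le_exp (zero_lt_one.trans_le (hpos i))]
    exact besselReal_le_exp (by positivity)
  have hexh : Tendsto (fun V : ℕ => (hfin V).toFinset) atTop atTop := by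
    refine tendsto_atTop_finset_of_monotone (fun p q h i hi => ?_) fun i => ?_
    · simp only [Set.Finite.mem_toFinset, Set.mem_ofPred_eq] at hi ⊢
      exact hi.trans (by exact_mod_cast h)
    · obtain ⟨n, hn⟩ := exists_nat_ge (e i)
      exact ⟨n, by simpa using hn⟩
  refine ((Real.continuous_exp.tendsto _).comp (hsum.hasSum.comp hexh)).congr fun V => ?_
  rw [Function.comp_apply, Function.comp_apply, Real.exp_sum]
  exact Finset.prod_congr rfl fun i _ => Real.exp_log (zero_lt_one.trans_le (hpos i))

end RandomSeries

/-! ### The Laplace transform of the tail -/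

section Assembly

variable {q : ℕ} [NeZero q] (D : Distribution q) (u : ℝ)

/-- The quantities `α_χ ^ 2 / (1 / 4 + γ ^ 2)`, whose power sums are the `B_k`. -/
noncomputable def tailCoeff (i : TailIndex q u) : ℝ :=
  D.weight i.1 ^ 2 / (1 / 4 + i.2.ordinate ^ 2)

lemma tailCoeff_nonneg (i : TailIndex q u) : 0 ≤ tailCoeff D u i := by
  unfold tailCoeff; positivity

lemma hasSum_tailCoeff_pow {k : ℕ} (hk : 1 ≤ k) :
    HasSum (fun i => tailCoeff D u i ^ k) (B D k u) := by
  have e : ∀ i : TailIndex q u, tailCoeff D u i ^ k =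
      D.weight i.1 ^ (2 * k) * (1 / (1 / 4 + i.2.ordinate ^ 2) ^ k) := fun i => by
    rw [tailCoeff, div_pow, ← pow_mul, mul_one_div]
  have h1 : ∀ χ : DirichletCharacter ℂ q, HasSum (fun z : TailZero χ u =>
      D.weight χ ^ (2 * k) * (1 / (1 / 4 + z.ordinate ^ 2) ^ k))
      (D.weight χ ^ (2 * k) * b k χ u) := fun χ =>
    (summable_tailZero χ u hk).hasSum.mul_left _
  have hs : Summable fun i : TailIndex q u => tailCoeff D u i ^ k := by
    rw [summable_sigma_of_nonneg fun i => pow_nonneg (tailCoeff_nonneg D u i) k]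
    refine ⟨fun χ => ?_, Summable.of_finite⟩
    simp only [e]
    exact (h1 χ).summable
  have h2 := hs.hasSum.sigma (fun χ => by simp only [e]; exact h1 χ)
  have h3 := h2.unique (hasSum_fintype _)
  have e3 : B D k u = ∑' i, tailCoeff D u i ^ k := h3.symm
  rw [e3]
  exact hs.hasSum

lemma summable_tailCoeff : Summable (tailCoeff D u) := by
  simpa using (hasSum_tailCoeff_pow D u le_rfl).summable

lemma finite_ordinate_le (V : ℝ) : {i : TailIndex q u | i.2.ordinate ≤ V}.Finite := by
  have hs : ∀ χ : DirichletCharacter ℂ q, {z : TailZero χ u | z.ordinate ≤ V}.Finite := by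
    intro χ
    have h := (summable_tailZero χ u le_rfl).tendsto_cofinite_zero
    have hε : 0 < 1 / (1 / 4 + u ^ 2 + V ^ 2) := by positivity
    refine Set.Finite.subset (eventually_cofinite.1 (h.eventually_lt_const hε)) fun z hz => ?_
    have h1 : u < z.ordinate := z.2.2.2.1
    have h2 : z.ordinate ≤ V := hz
    change ¬ (1 / (1 / 4 + z.ordinate ^ 2) ^ 1 < 1 / (1 / 4 + u ^ 2 + V ^ 2))
    rw [not_lt, pow_one]
    refine one_div_le_one_div_of_le (by positivity) ?_
    rcases le_total 0 z.ordinate with h0 | h0 <;> nlinarith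
  refine (Set.finite_univ.biUnion fun χ _ => (hs χ).image (Sigma.mk χ)).subset fun i hi => ?_
  exact Set.mem_biUnion (Set.mem_univ i.1) ⟨i.2, hi, rfl⟩

/-- The products `α_χ ^ 2 / (1 / 4 + γ ^ 2) * 4 / j ^ 2` that appear in
`L_u(s) = ∑ log (1 + l s ^ 2)`. -/
noncomputable def tailRate (z : TailIndex q u × ZeroIndex besselSeries) : ℝ :=
  tailCoeff D u z.1 * besselWeight z.2

lemma tailRate_nonneg (z : TailIndex q u × ZeroIndex besselSeries) : 0 ≤ tailRate D u z :=
  mul_nonneg (tailCoeff_nonneg D u z.1) (besselWeight_pos z.2).le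

lemma summable_tailRate : Summable (tailRate D u) :=
  (summable_tailCoeff D u).mul_of_nonneg hasSum_besselWeight.summable
    (fun i => tailCoeff_nonneg D u i) fun p => (besselWeight_pos p).le

lemma tsum_tailRate_pow {k : ℕ} (hk : 1 ≤ k) :
    ∑' z, tailRate D u z ^ k = B D k u * (2 ^ k * k * c k) := by
  have hB := hasSum_tailCoeff_pow D u hk
  have hw := summable_besselWeight_pow hk
  have hk0 : (k : ℝ) ≠ 0 := by exact_mod_cast (by omega : k ≠ 0)
  have e : 2 ^ k * k * c k = ∑' p, besselWeight p ^ k := by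
    rw [c_eq_tsum hk]; field_simp
  rw [e, ← hB.tsum_eq, hB.summable.tsum_mul_tsum hw
    (hB.summable.mul_of_nonneg hw (fun i => pow_nonneg (tailCoeff_nonneg D u i) k)
      fun p => pow_nonneg (besselWeight_pos p).le k)]
  exact tsum_congr fun z => mul_pow _ _ _

lemma tsum_log_besselReal_tailCoeff (s : ℝ) :
    ∑' i, Real.log (besselReal (tailCoeff D u i * s ^ 2)) =
      ∑' z, Real.log (1 + tailRate D u z * s ^ 2) := by
  have hs : Summable fun z => Real.log (1 + tailRate D u z * s ^ 2) := by
    refine Summable.of_nonneg_of_le (fun z => Real.log_nonneg ?_) (fun z => ?_)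
      ((summable_tailRate D u).mul_right (s ^ 2))
    · have := tailRate_nonneg D u z
      have : 0 ≤ tailRate D u z * s ^ 2 := by positivity
      linarith
    · have := tailRate_nonneg D u z
      have h := Real.log_le_sub_one_of_pos (x := 1 + tailRate D u z * s ^ 2) (by positivity)
      linarith
  refine (hs.hasSum.prod_fiberwise fun i => ?_).tsum_eq
  have h := hasSum_log_besselReal (x := tailCoeff D u i * s ^ 2) (by
    have := tailCoeff_nonneg D u i
    have : 0 ≤ tailCoeff D u i * s ^ 2 := by positivity
    linarith)
  refine h.congr_fun fun p => ?_
  rw [tailRate]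
  congr 2
  ring

lemma tailSum_eq (X : TailIndex q u → ℝ) :
    tailSum D u X = limUnder atTop fun V : ℝ => ∑ i ∈ (finite_ordinate_le u V).toFinset,
      2 * D.weight i.1 / √(1 / 4 + i.2.ordinate ^ 2) * X i := by
  rw [tailSum]
  congr 1
  ext V
  rw [← finsum_mem_eq_finite_toFinset_sum _ (finite_ordinate_le u V)]
  exact finsum_mem_congr rfl fun i _ => by ring

lemma sq_div_four_eq_tailCoeff (i : TailIndex q u) :
    (2 * D.weight i.1 / √(1 / 4 + i.2.ordinate ^ 2)) ^ 2 / 4 = tailCoeff D u i := by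
  rw [tailCoeff, div_pow, Real.sq_sqrt (by positivity)]
  ring

/-- The Laplace transform of the tail as a product over zeros of `L`-functions and of `J_0`. -/
lemma integrable_and_tailLaplace_eq (s : ℝ) :
    Integrable (fun v => Real.exp (s * v)) (tailLaw D u) ∧
      tailLaplace D u s = Real.exp (∑' z, Real.log (1 + tailRate D u z * s ^ 2)) := by
  have ha : Summable fun i : TailIndex q u =>
      (2 * D.weight i.1 / √(1 / 4 + i.2.ordinate ^ 2)) ^ 2 := by
    refine ((summable_tailCoeff D u).mul_left 4).congr fun i => ?_
    rw [← sq_div_four_eq_tailCoeff]; ring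
  obtain ⟨hm, h⟩ := laplace_randomSeries (finite_ordinate_le u) ha (tailSum_eq D u)
  obtain ⟨hint, heq⟩ := h s
  refine ⟨?_, ?_⟩
  · rw [tailLaw, integrable_map_measure (by fun_prop) hm]
    exact hint
  · rw [tailLaplace, tailLaw, integral_map hm (by fun_prop), heq,
      ← tsum_log_besselReal_tailCoeff]
    simp only [sq_div_four_eq_tailCoeff]

lemma L_eq_logSeries : L D u = fun s => ∑' z, Real.log (1 + tailRate D u z * s ^ 2) := by
  ext s
  rw [L, (integrable_and_tailLaplace_eq D u s).2, Real.log_exp]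

lemma B_nonneg (k : ℕ) : 0 ≤ B D k u :=
  Finset.sum_nonneg fun χ _ => mul_nonneg ((even_two_mul k).pow_nonneg _) (b_nonneg k χ u)

variable {D u}

lemma sigma_pow (k : ℕ) : sigma D u ^ (2 * k) = 2 ^ k * B D 1 u ^ k := by
  have := B_nonneg D u 1
  rw [sigma, pow_mul, Real.sq_sqrt (by positivity), mul_pow]

lemma c_mul_R_mul_sigma_pow (hB : B D 1 u ≠ 0) {k : ℕ} (hk : 1 ≤ k) :
    c k * R D k u * sigma D u ^ (2 * k) = (∑' z, tailRate D u z ^ k) / k := by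
  have hk0 : (k : ℝ) ≠ 0 := by exact_mod_cast (by omega : k ≠ 0)
  rw [tsum_tailRate_pow D u hk, sigma_pow, R]
  field_simp

lemma mainTerm_eq (hB : B D 1 u ≠ 0) (K : ℕ) : mainTerm D u K = fun s =>
    ∑ k ∈ Finset.Icc 1 K, (-1) ^ (k - 1) * ((∑' z, tailRate D u z ^ k) / k) * s ^ (2 * k) := by
  ext s
  refine Finset.sum_congr rfl fun k hk => ?_
  rw [← c_mul_R_mul_sigma_pow hB (Finset.mem_Icc.1 hk).1, mul_pow]
  ring

lemma errorTerm_eq (hB : B D 1 u ≠ 0) (τ : ℝ) {K : ℕ} (hK : 1 ≤ K) :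
    errorTerm D u τ K = fun s => (∑' z, tailRate D u z ^ K) / K *
      (s ^ (2 * K + 2) / ((τ / sigma D u) ^ 2 - s ^ 2)) := by
  have hB0 : 0 < B D 1 u := lt_of_le_of_ne (B_nonneg D u 1) hB.symm
  have hσ : sigma D u ≠ 0 := (Real.sqrt_pos.2 (by positivity)).ne'
  ext s
  have e : τ ^ 2 - (sigma D u * s) ^ 2 =
      sigma D u ^ 2 * ((τ / sigma D u) ^ 2 - s ^ 2) := by field_simp
  rw [errorTerm, e, ← c_mul_R_mul_sigma_pow hB hK, mul_pow, pow_add (sigma D u),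
    div_mul_eq_div_div]
  field_simp

end Assembly

/-! ### The admissible range of `T` -/

lemma seriesFactor_nonneg {q : ℕ} (D : Distribution q) : 0 ≤ D.seriesFactor := by
  cases D
  · exact zero_le_one
  · exact div_nonneg (Nat.cast_nonneg _) zero_le_two

section Bound

variable {q : ℕ} [NeZero q] (D : Distribution q)

/-- The zeros just above `u` carry a positive proportion of `B_1`, so that
`B_1 = O((1 / 4 + u ^ 2) * B_2)`. -/
lemma exists_B_one_le : ∃ Q : ℝ, 0 ≤ Q ∧ ∀ u : ℝ, 0 ≤ u →
    B D 1 u ≤ Q * ((1 / 4 + u ^ 2) * B D 2 u) := by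
  choose c hc0 hc using fun χ : DirichletCharacter ℂ q => exists_mul_b_one_le χ
  refine ⟨∑ χ, (D.weight χ ^ 2 * c χ)⁻¹, Finset.sum_nonneg fun χ _ => inv_nonneg.2
    (mul_nonneg (sq_nonneg _) (hc0 χ).le), fun u hu => ?_⟩
  rw [B, B, Finset.mul_sum, Finset.mul_sum]
  refine Finset.sum_le_sum fun χ _ => ?_
  have hb2 := b_nonneg 2 χ u
  have hc0' := hc0 χ
  by_cases hw : D.weight χ = 0
  · simp [hw]
  · have h1 : (D.weight χ ^ 2 * c χ)⁻¹ ≤ ∑ χ, (D.weight χ ^ 2 * c χ)⁻¹ :=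
      Finset.single_le_sum (f := fun χ => (D.weight χ ^ 2 * c χ)⁻¹) (fun χ _ => inv_nonneg.2
        (mul_nonneg (sq_nonneg _) (hc0 χ).le)) (Finset.mem_univ χ)
    have hw2 : 0 ≤ D.weight χ ^ (2 * 1) := (even_two_mul 1).pow_nonneg _
    have hw4 : 0 ≤ D.weight χ ^ (2 * 2) := (even_two_mul 2).pow_nonneg _
    refine le_trans ?_ (mul_le_mul_of_nonneg_right h1 (by positivity))
    have h2 : b 1 χ u ≤ (1 / 4 + u ^ 2) * b 2 χ u / c χ := by
      rw [le_div_iff₀ hc0', mul_comm]; exact hc χ u hu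
    refine (mul_le_mul_of_nonneg_left h2 hw2).trans_eq ?_
    field_simp
    ring

lemma tailRate_le {u : ℝ} (hu : 0 < u) (z : TailIndex q u × ZeroIndex besselSeries) :
    tailRate D u z ≤ (∑ χ, D.weight χ ^ 2) / (1 / 4 + u ^ 2) := by
  have h1 : u < z.1.2.ordinate := z.1.2.2.2.2.1
  refine (mul_le_of_le_one_right (tailCoeff_nonneg D u z.1) (besselWeight_le_one z.2)).trans ?_
  rw [tailCoeff]
  refine div_le_div₀ (Finset.sum_nonneg fun χ _ => sq_nonneg _)
    (Finset.single_le_sum (f := fun χ => D.weight χ ^ 2) (fun χ _ => sq_nonneg _)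
      (Finset.mem_univ z.1.1)) (by positivity) ?_
  nlinarith

/-- The factor `(y + 1 / 3) / (y + 1)` is less than `1`, and only this is used about `y`. -/
lemma T_sq_le {u : ℝ} {χ : DirichletCharacter ℂ q} (hy : -1 / 3 < y χ u) :
    T D χ u ^ 2 ≤ j1 ^ 2 * (D.seriesFactor / 3 * (B D 1 u ^ 2 / B D 2 u)) := by
  have hκ := seriesFactor_nonneg D
  have hB2 := B_nonneg D u 2
  have hR : 0 ≤ R D 2 u := div_nonneg hB2 (sq_nonneg _)
  have h1 : 0 < y χ u + 1 / 3 := by linarith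
  have h2 : 0 < y χ u + 1 := by linarith
  have e : B D 1 u ^ 2 / B D 2 u = (R D 2 u)⁻¹ := by rw [R, inv_div]
  rw [T, mul_pow, Real.sq_sqrt (by positivity), e]
  refine mul_le_mul_of_nonneg_left ?_ (sq_nonneg _)
  have h3 : (y χ u + 1 / 3) / (y χ u + 1) ≤ 1 := (div_le_one h2).2 (by linarith)
  calc (y χ u + 1 / 3) * D.seriesFactor / (3 * (y χ u + 1) * R D 2 u)
      = (y χ u + 1 / 3) / (y χ u + 1) * (D.seriesFactor / 3 * (R D 2 u)⁻¹) := by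
        rw [← div_eq_mul_inv, div_div, div_mul_div_comm]
        congr 1
        ring
    _ ≤ _ := mul_le_of_le_one_left (by positivity) h3

/-- In the admissible range of `T`, the products `l * (T / σ) ^ 2` are bounded. -/
lemma exists_tailRate_mul_sq_le (Λ : ℝ) : ∃ M : ℝ, 0 ≤ M ∧ ∀ u : ℝ, 0 < u →
    ∀ χ : DirichletCharacter ℂ q, -1 / 3 < y χ u → ∀ τ : ℝ, 0 < τ → τ ≤ Λ * T D χ u →
      0 < B D 1 u ∧ ∀ z, tailRate D u z * (τ / sigma D u) ^ 2 ≤ M := by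
  obtain ⟨Q, hQ0, hQ⟩ := exists_B_one_le D
  have hκ := seriesFactor_nonneg D
  set W := ∑ χ, D.weight χ ^ 2 with hW
  have hW0 : 0 ≤ W := Finset.sum_nonneg fun χ _ => sq_nonneg _
  refine ⟨W * (Λ ^ 2 * (j1 ^ 2 * (D.seriesFactor / 6 * Q))), by positivity,
    fun u hu χ hy τ hτ hτT => ?_⟩
  have hB1 : 0 < B D 1 u := by
    refine lt_of_le_of_ne (B_nonneg D u 1) fun h => ?_
    -- otherwise `R_2`, hence `T_u`, is zero
    have : T D χ u = 0 := by simp [T, R, ← h]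
    rw [this, mul_zero] at hτT
    linarith
  have hB2 : 0 < B D 2 u := by
    refine lt_of_le_of_ne (B_nonneg D u 2) fun h => ?_
    have := hQ u hu.le
    rw [← h, mul_zero, mul_zero] at this
    linarith
  refine ⟨hB1, fun z => ?_⟩
  have hσ : sigma D u ^ 2 = 2 * B D 1 u := Real.sq_sqrt (by positivity)
  have h1 : τ ^ 2 ≤ Λ ^ 2 * (j1 ^ 2 * (D.seriesFactor / 3 * (B D 1 u ^ 2 / B D 2 u))) := by
    refine (pow_le_pow_left₀ hτ.le hτT 2).trans ?_
    rw [mul_pow]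
    exact mul_le_mul_of_nonneg_left (T_sq_le D hy) (sq_nonneg _)
  have h2 : B D 1 u / B D 2 u ≤ Q * (1 / 4 + u ^ 2) := by
    rw [div_le_iff₀ hB2, mul_assoc]; exact hQ u hu.le
  have h3 : (τ / sigma D u) ^ 2 ≤
      Λ ^ 2 * (j1 ^ 2 * (D.seriesFactor / 6 * (Q * (1 / 4 + u ^ 2)))) := by
    rw [div_pow, hσ, div_le_iff₀ (by positivity)]
    refine h1.trans (le_trans (le_of_eq ?_) (mul_le_mul_of_nonneg_right
      (mul_le_mul_of_nonneg_left (mul_le_mul_of_nonneg_left (mul_le_mul_of_nonneg_left h2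
        (by positivity)) (sq_nonneg j1)) (sq_nonneg Λ)) (by positivity)))
    field_simp
    ring
  refine (mul_le_mul (tailRate_le D hu z) h3 (sq_nonneg _) (by positivity)).trans_eq ?_
  rw [← hW]
  field_simp

end Bound

end PrimeRace

theorem theorem7 (q : ℕ) [NeZero q] (D : PrimeRace.Distribution q) :
    (∀ u : ℝ, 0 ≤ u →
      (∀ s : ℝ, Integrable (fun v => Real.exp (s * v)) (PrimeRace.tailLaw D u)) ∧
      ContDiff ℝ ∞ (PrimeRace.L D u)) ∧
    ∀ (Λ : ℝ) (m : ℕ), ∃ C : ℝ, ∀ u : ℝ, 0 < u →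
      ∀ χ : DirichletCharacter ℂ q, D.weight χ ≠ 0 → -1 / 3 < PrimeRace.y χ u →
      ∀ T : ℝ, 0 < T → T ≤ Λ * PrimeRace.T D χ u →
      ∀ K : ℕ, 1 ≤ K → ∀ s : ℝ, |PrimeRace.sigma D u * s| < T →
        |iteratedDeriv m (PrimeRace.L D u) s -
            iteratedDeriv m (PrimeRace.mainTerm D u K) s| ≤
          C * |iteratedDeriv m (PrimeRace.errorTerm D u T K) s| := by
  refine ⟨fun u _ => ⟨fun s => (PrimeRace.integrable_and_tailLaplace_eq D u s).1, ?_⟩,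
    fun Λ m => ?_⟩
  · rw [PrimeRace.L_eq_logSeries]
    exact PrimeRace.contDiff_logSeries (PrimeRace.tailRate_nonneg D u)
      (PrimeRace.summable_tailRate D u)
  · obtain ⟨M, hM0, hM⟩ := PrimeRace.exists_tailRate_mul_sq_le D Λ
    obtain ⟨C, hC⟩ := PrimeRace.exists_iteratedDeriv_logSeries_sub_le hM0 m
    refine ⟨C, fun u hu χ _ hy T hT hTΛ K hK s hs => ?_⟩
    obtain ⟨hB, hrate⟩ := hM u hu χ hy T hT hTΛ
    have hσ : 0 < PrimeRace.sigma D u := Real.sqrt_pos.2 (by positivity)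
    have hs' : |s| < T / PrimeRace.sigma D u := by
      rw [lt_div_iff₀ hσ, mul_comm]
      rwa [abs_mul, abs_of_pos hσ] at hs
    rw [PrimeRace.L_eq_logSeries, PrimeRace.mainTerm_eq hB.ne', PrimeRace.errorTerm_eq hB.ne' T hK]
    exact hC _ _ (T / PrimeRace.sigma D u) (PrimeRace.tailRate_nonneg D u)
      (PrimeRace.summable_tailRate D u) (div_pos hT hσ) hrate K hK s hs'
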